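/- Let $\mathbb{G}$ be a connected, simply connected, finite dimensional real Lie group whose Lie algebra is graded with two layers, $\mathcal{G}=V_1\oplus V_2$, $[V_1,V_1]\subset V_2$, $[V_1,V_2]=[V_2,V_2]=\{0\}$ (every two step stratified group, where moreover $[V_1,V_1]=V_2$, is of this kind). For $r>0$ let $\delta_r$ be the automorphism of $\mathbb{G}$ whose differential at the identity is $v_1+v_2\mapsto r v_1+r^2v_2$ ($v_i\in V_i$). Let $\rho$ be a homogeneous distance on $\mathbb{G}$, i.e. a continuous distance with $\rho(ux,uy)=\rho(x,y)$ and $\rho(\delta_rx,\delta_ry)=r\,\rho(x,y)$ for all $u,x,y\in\mathbb{G}$ and $r>0$, and let $B_{z,r}=\{y\in\mathbb{G}\mid\rho(z,y)<r\}$. Let $\tilde g$ be any smooth Riemannian metric on $\mathbb{G}$ (not necessarily left invariant), let $\Sigma\subset\mathbb{G}$ be a $p$-dimensional embedded submanifold of class $C^{1,1}$, and let $\tilde\mu_p$ be the Riemannian surface measure induced by $\tilde g$ on $\Sigma$. Fix a basis $(W_1,\dots,W_q)$ of $\mathcal{G}$ such that each $W_j$ belongs to $V_{d_j}$ for some $d_j\in\{1,2\}$.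 For $J=\{j_1<\dots<j_p\}$ put $W_J=W_{j_1}\wedge\dots\wedge W_{j_p}$, regarded as a left invariant field of $p$-vectors, and $d_J=d_{j_1}+\dots+d_{j_p}$. The pointwise degree of $\Sigma$ at $z\in\Sigma$ is $$d_\Sigma(z)=\max\{d_J\mid \tau_J\neq0\},$$ where $\sum_J\tau_J\,W_J(z)$ is a nonzero tangent $p$-vector of $\Sigma$ at $z$. Then for every $x\in\Sigma$ there exist a neighbourhood $U$ of $x$ and constants $c_1,c_2,r_0>0$ such that $$c_1\,r^{d_\Sigma(x)}\le\tilde\mu_p(\Sigma\cap B_{z,r})\le c_2\,r^{d_\Sigma(x)}$$ for every $z\in\Sigma\cap U$ with $d_\Sigma(z)=d_\Sigma(x)$ and every $0<r<r_0$. -/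

import Mathlib

open Set Filter Topology MeasureTheory Manifold
open scoped ENNReal NNReal ContDiff

noncomputable section

namespace BlowUp

/-! Real Lie groups are modelled on a finite dimensional real vector space `E`; the Lie algebra of
`G` is `GroupLieAlgebra 𝓘(ℝ, E) G`, the tangent space at the identity with the bracket of left
invariant vector fields. -/

section Grading

variable {E : Type*} [NormedAddCommGroup E] [NormedSpace ℝ E]
  {G : Type*} [TopologicalSpace G] [ChartedSpace E G] [Group G]

/-- `Lie(G) = V₁ ⊕ V₂` with `[Vᵢ, Vⱼ] ⊆ Vᵢ₊ⱼ` and `Vᵢ = 0` for `i ≥ 3`. -/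
structure IsTwoStepGrading (V₁ V₂ : Submodule ℝ (GroupLieAlgebra 𝓘(ℝ, E) G)) : Prop where
  isCompl : IsCompl V₁ V₂
  lie_one_one : ∀ X ∈ V₁, ∀ Y ∈ V₁, ⁅X, Y⁆ ∈ V₂
  lie_one_two : ∀ X ∈ V₁, ∀ Y ∈ V₂, ⁅X, Y⁆ = 0
  lie_two_one : ∀ X ∈ V₂, ∀ Y ∈ V₁, ⁅X, Y⁆ = 0
  lie_two_two : ∀ X ∈ V₂, ∀ Y ∈ V₂, ⁅X, Y⁆ = 0

/-- A smooth endomorphism of `G` whose differential at the identity is the dilation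
`v₁ + v₂ ↦ r v₁ + r² v₂` of the Lie algebra. -/
def IsDilation (V₁ V₂ : Submodule ℝ (GroupLieAlgebra 𝓘(ℝ, E) G)) (r : ℝ) (φ : G →* G) : Prop :=
  ContMDiff 𝓘(ℝ, E) 𝓘(ℝ, E) ∞ φ ∧
  (∀ X ∈ V₁, (mfderiv 𝓘(ℝ, E) 𝓘(ℝ, E) φ 1 X : E) = r • (X : E)) ∧
  (∀ X ∈ V₂, (mfderiv 𝓘(ℝ, E) 𝓘(ℝ, E) φ 1 X : E) = r ^ 2 • (X : E))

open Classical in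
/-- The dilation `δ_r` of the group. On a connected, simply connected group exactly one
homomorphism satisfies `IsDilation`, namely `exp ∘ δ_r ∘ exp⁻¹`. -/
def dilation (V₁ V₂ : Submodule ℝ (GroupLieAlgebra 𝓘(ℝ, E) G)) (r : ℝ) : G →* G :=
  if h : ∃ φ : G →* G, IsDilation V₁ V₂ r φ then h.choose else 1

/-- Homogeneous distances: continuous, left invariant distances that are homogeneous with respect
to dilations. -/
structure IsHomogeneousDist (V₁ V₂ : Submodule ℝ (GroupLieAlgebra 𝓘(ℝ, E) G))
    (ρ : G → G → ℝ) : Prop where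
  continuous : Continuous fun a : G × G => ρ a.1 a.2
  eq_zero_iff : ∀ x y, ρ x y = 0 ↔ x = y
  symm : ∀ x y, ρ x y = ρ y x
  triangle : ∀ x y z, ρ x z ≤ ρ x y + ρ y z
  mul_left : ∀ u x y, ρ (u * x) (u * y) = ρ x y
  dilation : ∀ r : ℝ, 0 < r → ∀ x y, ρ (dilation V₁ V₂ r x) (dilation V₁ V₂ r y) = r * ρ x y

/-- The open ball of centre `z` and radius `r` for the distance `ρ`. -/
def openBall (ρ : G → G → ℝ) (z : G) (r : ℝ) : Set G := {y | ρ z y < r}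

/-- A basis `W` of the Lie algebra made of elements of `V₁` (degree `1`) and of `V₂`
(degree `2`). -/
structure GradedBasis (V₁ V₂ : Submodule ℝ (GroupLieAlgebra 𝓘(ℝ, E) G)) (q : ℕ) where
  basis : Module.Basis (Fin q) ℝ (GroupLieAlgebra 𝓘(ℝ, E) G)
  deg : Fin q → ℕ
  mem : ∀ i, (deg i = 1 ∧ basis i ∈ V₁) ∨ (deg i = 2 ∧ basis i ∈ V₂)

/-- The degree of a `p`-vector `τ = ∑_J τ_J W_J`: the maximum of `d_J = ∑_{j ∈ J} d_j` over the
`J` with `τ_J ≠ 0`. -/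
def pvectorDegree {V₁ V₂ : Submodule ℝ (GroupLieAlgebra 𝓘(ℝ, E) G)} {q : ℕ}
    (W : GradedBasis V₁ V₂ q) {p : ℕ} (τ : ⋀[ℝ]^p (GroupLieAlgebra 𝓘(ℝ, E) G)) : ℕ :=
  ((W.basis.exteriorPower p).repr τ).support.sup fun J => ∑ j ∈ (J : Finset (Fin q)), W.deg j

/-- The tangent space of `S` at `x`: the span of the velocities at `0` of the curves contained in
`S` that start at `x` and are differentiable at `0`. -/
def tangentSpaceAt (S : Set G) (x : G) : Submodule ℝ (TangentSpace 𝓘(ℝ, E) x) :=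
  Submodule.span ℝ {v | ∃ γ : ℝ → G, γ 0 = x ∧ (∀ᶠ t in 𝓝 0, γ t ∈ S) ∧
    MDifferentiableAt 𝓘(ℝ, ℝ) 𝓘(ℝ, E) γ 0 ∧
    (mfderiv 𝓘(ℝ, ℝ) 𝓘(ℝ, E) γ 0 (1 : ℝ) : E) = (v : E)}

/-- The tangent space of `S` at `x` read in the Lie algebra: the elements whose left invariant
vector field is tangent to `S` at `x`. -/
def leftTangent (S : Set G) (x : G) : Submodule ℝ (GroupLieAlgebra 𝓘(ℝ, E) G) where
  carrier := {X | mulInvariantVectorField X x ∈ tangentSpaceAt (E := E) S x}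
  add_mem' {X Y} hX hY := by
    simp only [mem_ofPred_eq, mulInvariantVectorField_add, Pi.add_apply] at hX hY ⊢
    exact Submodule.add_mem _ hX hY
  zero_mem' := by
    have h := mulInvariantVectorField_smul (I := 𝓘(ℝ, E)) (G := G) (0 : ℝ) 0
    simp only [zero_smul] at h
    simp only [mem_ofPred_eq, h, Pi.zero_apply]
    exact Submodule.zero_mem _
  smul_mem' c X hX := by
    simp only [mem_ofPred_eq, mulInvariantVectorField_smul, Pi.smul_apply] at hX ⊢
    exact Submodule.smul_mem _ _ hX

/-- A tangent `p`-vector of `S` at `x`, in left invariant coordinates: `t₁ ∧ ⋯ ∧ t_p` for a basis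
`t` of the tangent space. Other bases give nonzero multiples of it. -/
def tangentPVector [FiniteDimensional ℝ E] (S : Set G) (x : G) :
    ⋀[ℝ]^(Module.finrank ℝ (leftTangent (E := E) S x)) (GroupLieAlgebra 𝓘(ℝ, E) G) :=
  haveI : FiniteDimensional ℝ (GroupLieAlgebra 𝓘(ℝ, E) G) := inferInstanceAs (FiniteDimensional ℝ E)
  exteriorPower.ιMulti ℝ _ fun i => (Module.finBasis ℝ (leftTangent (E := E) S x) i :
    GroupLieAlgebra 𝓘(ℝ, E) G)

/-- The pointwise degree `d_S(x)`. -/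
def degreeAt [FiniteDimensional ℝ E] {V₁ V₂ : Submodule ℝ (GroupLieAlgebra 𝓘(ℝ, E) G)} {q : ℕ}
    (W : GradedBasis V₁ V₂ q) (S : Set G) (x : G) : ℕ :=
  pvectorDegree W (tangentPVector (E := E) S x)

end Grading

section Submanifold

variable {E : Type*} [NormedAddCommGroup E] [NormedSpace ℝ E]
  {M : Type*} [TopologicalSpace M] [ChartedSpace E M]

/-- `p`-dimensional (embedded) submanifolds of class `C^{1,1}`: near each of its points, read in a
chart, `S` is the zero set of a submersion with Lipschitz differential. -/
def IsC11Submanifold (E : Type*) [NormedAddCommGroup E] [NormedSpace ℝ E]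
    {M : Type*} [TopologicalSpace M] [ChartedSpace E M] (p : ℕ) (S : Set M) : Prop :=
  ∀ x ∈ S, ∃ (k : ℕ) (U : Set E) (f : E → EuclideanSpace ℝ (Fin k)) (L : ℝ≥0),
    p + k = Module.finrank ℝ E ∧ IsOpen U ∧ extChartAt 𝓘(ℝ, E) x x ∈ U ∧
    U ⊆ (extChartAt 𝓘(ℝ, E) x).target ∧
    DifferentiableOn ℝ f U ∧ LipschitzOnWith L (fderiv ℝ f) U ∧
    (∀ y ∈ U, Function.Surjective (fderiv ℝ f y)) ∧
    ∀ y ∈ U, ((extChartAt 𝓘(ℝ, E) x).symm y ∈ S ↔ f y = 0)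

/-- A `C¹` injective immersion `Φ` of an open subset `W` of `ℝᵖ` into `M`, with values
in `S`. -/
def IsLocalParam (E : Type*) [NormedAddCommGroup E] [NormedSpace ℝ E]
    {M : Type*} [TopologicalSpace M] [ChartedSpace E M] {p : ℕ} (S : Set M)
    (W : Set (EuclideanSpace ℝ (Fin p))) (Φ : EuclideanSpace ℝ (Fin p) → M) : Prop :=
  IsOpen W ∧ ContMDiffOn 𝓘(ℝ, EuclideanSpace ℝ (Fin p)) 𝓘(ℝ, E) 1 Φ W ∧ InjOn Φ W ∧
    MapsTo Φ W S ∧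
    ∀ ξ ∈ W, Function.Injective (mfderiv 𝓘(ℝ, EuclideanSpace ℝ (Fin p)) 𝓘(ℝ, E) Φ ξ)

variable [IsManifold 𝓘(ℝ, E) ∞ M]

/-- Smooth Riemannian metrics on `M`. -/
abbrev RiemMetric (E : Type*) [NormedAddCommGroup E] [NormedSpace ℝ E]
    (M : Type*) [TopologicalSpace M] [ChartedSpace E M] [IsManifold 𝓘(ℝ, E) ∞ M] :=
  Bundle.ContMDiffRiemannianMetric 𝓘(ℝ, E) ∞ E (fun x : M => TangentSpace 𝓘(ℝ, E) x)

/-- The Riemannian area density `|∂₁Φ ∧ ⋯ ∧ ∂_pΦ|_g = √det (g(∂ᵢΦ, ∂ⱼΦ))`. -/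
def areaDensity (g : RiemMetric E M) {p : ℕ} (Φ : EuclideanSpace ℝ (Fin p) → M)
    (ξ : EuclideanSpace ℝ (Fin p)) : ℝ≥0∞ :=
  ENNReal.ofReal <| Real.sqrt <| Matrix.det <| Matrix.of fun i j : Fin p =>
    g.inner (Φ ξ)
      (mfderiv 𝓘(ℝ, EuclideanSpace ℝ (Fin p)) 𝓘(ℝ, E) Φ ξ (EuclideanSpace.single i (1 : ℝ)))
      (mfderiv 𝓘(ℝ, EuclideanSpace ℝ (Fin p)) 𝓘(ℝ, E) Φ ξ (EuclideanSpace.single j (1 : ℝ)))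

/-- The area needed to cover `A ∩ S` by (a Borel part of) one parametrized patch of `S`;
`∞` if this is impossible. -/
def patchArea (g : RiemMetric E M) (p : ℕ) (S : Set M) (A : Set M) : ℝ≥0∞ :=
  ⨅ (W : Set (EuclideanSpace ℝ (Fin p))) (Φ : EuclideanSpace ℝ (Fin p) → M)
    (K : Set (EuclideanSpace ℝ (Fin p))) (_ : IsLocalParam E S W Φ) (_ : MeasurableSet K)
    (_ : K ⊆ W) (_ : A ∩ S ⊆ Φ '' K), ∫⁻ ξ in K, areaDensity g Φ ξ

lemma patchArea_empty [Nonempty M] (g : RiemMetric E M) (p : ℕ) (S : Set M) :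
    patchArea g p S ∅ = 0 := by
  refine le_antisymm ?_ bot_le
  refine iInf_le_of_le ∅ <| iInf_le_of_le (fun _ => Classical.arbitrary M) <| iInf_le_of_le ∅ <|
    iInf_le_of_le ?_ <| iInf_le_of_le MeasurableSet.empty <| iInf_le_of_le (empty_subset _) <|
    iInf_le_of_le (by simp) (by simp)
  exact ⟨isOpen_empty, fun x hx => hx.elim, fun x hx => hx.elim, fun x hx => hx.elim,
    fun x hx => hx.elim⟩

/-- The outer measure obtained from countable covers by parametrized patches. -/
def surfaceOuterMeasure [Nonempty M] (g : RiemMetric E M) (p : ℕ) (S : Set M) : OuterMeasure M :=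
  OuterMeasure.ofFunction (patchArea g p S) (patchArea_empty g p S)

lemma borel_le_caratheodory [Nonempty M] [MeasurableSpace M] [BorelSpace M] (g : RiemMetric E M)
    (p : ℕ) (S : Set M) :
    ‹MeasurableSpace M› ≤ (surfaceOuterMeasure g p S).caratheodory := by
  intro s hs
  refine OuterMeasure.ofFunction_caratheodory fun t => ?_
  refine le_iInf fun W => le_iInf fun Φ => le_iInf fun K => le_iInf fun hΦ => le_iInf fun hK =>
    le_iInf fun hKW => le_iInf fun hcov => ?_
  have hmeas : MeasurableSet (K ∩ Φ ⁻¹' s) := by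
    have hc : ContinuousOn Φ K := hΦ.2.1.continuousOn.mono hKW
    have h1 : Measurable (K.domRestrict Φ) := (continuousOn_iff_continuous_domRestrict.1 hc).measurable
    have h2 := hK.subtype_image (h1 hs)
    convert h2 using 1
    ext ξ
    simp [Set.domRestrict, and_comm]
  have hdiff : MeasurableSet (K \ Φ ⁻¹' s) := by
    have : K \ Φ ⁻¹' s = K \ (K ∩ Φ ⁻¹' s) := by simp
    rw [this]
    exact hK.diff hmeas
  have e : ∫⁻ ξ in K, areaDensity g Φ ξ = (∫⁻ ξ in K ∩ Φ ⁻¹' s, areaDensity g Φ ξ)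
      + ∫⁻ ξ in K \ Φ ⁻¹' s, areaDensity g Φ ξ := by
    rw [← lintegral_union hdiff (disjoint_sdiff_inter.symm), inter_union_sdiff]
  rw [e]
  gcongr
  · refine iInf_le_of_le W <| iInf_le_of_le Φ <| iInf_le_of_le (K ∩ Φ ⁻¹' s) <|
      iInf_le_of_le hΦ <| iInf_le_of_le hmeas <| iInf_le_of_le (inter_subset_left.trans hKW) <|
      iInf_le_of_le ?_ le_rfl
    rintro y ⟨⟨hyt, hys⟩, hyS⟩
    obtain ⟨ξ, hξ, rfl⟩ := hcov ⟨hyt, hyS⟩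
    exact ⟨ξ, ⟨hξ, hys⟩, rfl⟩
  · refine iInf_le_of_le W <| iInf_le_of_le Φ <| iInf_le_of_le (K \ Φ ⁻¹' s) <|
      iInf_le_of_le hΦ <| iInf_le_of_le hdiff <| iInf_le_of_le (sdiff_subset.trans hKW) <|
      iInf_le_of_le ?_ le_rfl
    rintro y ⟨⟨hyt, hys⟩, hyS⟩
    obtain ⟨ξ, hξ, rfl⟩ := hcov ⟨hyt, hyS⟩
    exact ⟨ξ, ⟨hξ, hys⟩, rfl⟩

/-- The Riemannian surface measure induced by `g` on the `p`-dimensional submanifold `S`, as a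
Borel measure on `M`. It is the measure carried by `S` whose value on a Borel subset `A` of a patch
`Φ(W)` is the integral over `Φ⁻¹(A)` of the area density. -/
def surfaceMeasure [Nonempty M] [MeasurableSpace M] [BorelSpace M] (g : RiemMetric E M)
    (p : ℕ) (S : Set M) : Measure M :=
  (surfaceOuterMeasure g p S).toMeasure (borel_le_caratheodory g p S)

end Submanifold

end BlowUp

end

/-! Near `x` the submanifold is a C¹ graph over a linear projection `P` onto ℝᵖ, and its surface
measure is comparable with the Lebesgue measure of the projection. Let `a`, `b` be the chart
coordinates of two of its points `z`, `y`. The problem is then to find the volume of the set of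
those `v = P b - P a` for which `y` lies in the ball of centre `z` and radius `r`.

Two facts describe this set. By `LayerProjections.ball_box`, in suitable coordinates at the identity
the ball of radius `r` is comparable with the box `|u₁| ≲ r`, `|u₂| ≲ r²`. By `exists_local_model`,
the coordinates of `z⁻¹ y` are `T_a v + O(|v|²)`, where the range of `T_a` is the tangent space at
`z` translated to the identity; the C^{1,1} regularity gives the quadratic error. In the box `|v| ≲
r`, so the error is `O(r²)` and is harmless in both layers. The set is therefore comparable with
`|v| ≲ r`, `|A_a v| ≲ r²`, where `A_a = π₂ T_a`, and its volume has order `r ^ (p + rank A_a)`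
(`volume_aniso_le`, `le_volume_aniso`). The exponent is the pointwise degree
(`pvectorDegree_iotaMulti`, `degreeAt_eq`).

The upper volume bound needs `|A_a w| ≥ c |w|` on the orthogonal complement of `ker A_a`, with `c`
independent of `a`. Such a constant is lost where the rank jumps; at points with the degree of `x`
the rank is that of `A_{a₀}`, and `lower_bound_on_ker_orthogonal` transfers the bound from `a₀`.

The coordinates for the ball-box estimate satisfy `u(x⁻¹) = -u(x)`. A homomorphism commutes with
inversion, so it has no quadratic term in them: the dilations by 2 and 1/2 are linear up to cubic
errors (`oddChart_hom_cubic`). At scale `t` the layers have sizes `t` and `t²`, and the errors `t³`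
along an orbit are summable against these. Iteration between scale `r` and scale 1 thus preserves
boxes up to constants, while `ρ` scales exactly. -/

noncomputable section

namespace BlowUp

/-! ### The degree of a `p`-vector as a rank -/

section Degree

/-- A minor of the coordinates of a basis `t` of a subspace `T` is nonzero exactly when the
corresponding coordinate forms are linearly independent on `T`. -/
lemma iotaMultiDual_ne_zero_iff {V : Type*} [AddCommGroup V] [Module ℝ V] {q p : ℕ}
    (b : Module.Basis (Fin q) ℝ V) (T : Submodule ℝ V) (t : Module.Basis (Fin p) ℝ T)
    (J : Set.powersetCard (Fin q) p) :
    exteriorPower.ιMultiDual ℝ p b J (exteriorPower.ιMulti ℝ p fun i => (t i : V)) ≠ 0 ↔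
      LinearIndepOn ℝ (fun j => (b.coord j).domRestrict T) ((J : Finset (Fin q)) : Set (Fin q)) := by
  rw [exteriorPower.ιMultiDual_apply_ιMulti, ← isUnit_iff_ne_zero, ← Matrix.isUnit_iff_isUnit_det,
    ← Matrix.linearIndependent_cols_iff_isUnit]
  -- Evaluation on the basis `t` is injective on the dual of `T`, so independence of the restricted
  -- forms is independence of the columns of the minor.
  let ev : Module.Dual ℝ T →ₗ[ℝ] (Fin p → ℝ) := LinearMap.pi fun i => Module.Dual.eval ℝ T (t i)
  have hev : LinearMap.ker ev = ⊥ := by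
    refine LinearMap.ker_eq_bot'.2 fun φ hφ => t.ext fun i => ?_
    exact congrFun hφ i
  have h1 := LinearMap.linearIndependent_iff
    (v := fun k : Fin p => (b.coord (Set.powersetCard.ofFinEmbEquiv.symm J k)).domRestrict T) ev hev
  have h2 : (ev ∘ fun k : Fin p =>
      (b.coord (Set.powersetCard.ofFinEmbEquiv.symm J k)).domRestrict T) =
      (Matrix.of fun i j => b.coord (Set.powersetCard.ofFinEmbEquiv.symm J j) (t i : V)).col := by
    ext k i
    rfl
  rw [← h2, h1]
  have hinj := (Set.powersetCard.ofFinEmbEquiv.symm J).injective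
  have hr : Set.range (Set.powersetCard.ofFinEmbEquiv.symm J) =
      ((J : Finset (Fin q)) : Set (Fin q)) := by
    ext i
    rw [Set.powersetCard.mem_range_ofFinEmbEquiv_symm_iff_mem]
    rfl
  rw [← hr, linearIndepOn_range_iff hinj]
  rfl

/-- The common zeros in `T` of the forms indexed by `D` are the kernel of `P` restricted to `T`;
both sides are its codimension in `T`. -/
lemma finrank_span_coord {V F : Type*} [AddCommGroup V] [Module ℝ V] [FiniteDimensional ℝ V]
    [AddCommGroup F] [Module ℝ F] {q : ℕ} (b : Module.Basis (Fin q) ℝ V) (T : Submodule ℝ V)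
    (D : Set (Fin q)) (P : V →ₗ[ℝ] F) (hP : ∀ v, P v = 0 ↔ ∀ j ∈ D, b.coord j v = 0) :
    Module.finrank ℝ (Submodule.span ℝ ((fun j => (b.coord j).domRestrict T) '' D)) =
      Module.finrank ℝ (T.map P) := by
  have h1 := Subspace.finrank_add_finrank_dualCoannihilator_eq
    (Submodule.span ℝ ((fun j => (b.coord j).domRestrict T) '' D))
  have h2 : (Submodule.span ℝ ((fun j => (b.coord j).domRestrict T) '' D)).dualCoannihilator =
      LinearMap.ker (P.domRestrict T) := by
    ext v
    rw [Submodule.mem_dualCoannihilator, LinearMap.mem_ker, LinearMap.domRestrict_apply, hP]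
    constructor
    · intro h j hj
      exact h _ (Submodule.subset_span ⟨j, hj, rfl⟩)
    · intro h φ hφ
      induction hφ using Submodule.span_induction with
      | mem x hx => obtain ⟨j, hj, rfl⟩ := hx; exact h j hj
      | zero => rfl
      | add x y _ _ hx hy => simp [hx, hy]
      | smul a x _ hx => simp [hx]
  have h3 := LinearMap.finrank_range_add_finrank_ker (P.domRestrict T)
  have h4 : LinearMap.range (P.domRestrict T) = T.map P := by
    ext y; simp
  rw [h2] at h1
  rw [h4] at h3
  exact Nat.add_right_cancel (h1.trans h3.symm)

/-- Among index sets of fixed cardinality, maximizing the degree therefore amounts to maximizing the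
number of indices of degree 2. -/
lemma sum_deg_eq {q : ℕ} (deg : Fin q → ℕ) (hdeg : ∀ i, deg i = 1 ∨ deg i = 2)
    (J : Finset (Fin q)) :
    ∑ j ∈ J, deg j = J.card + (J.filter fun j => deg j = 2).card := by
  rw [Finset.card_eq_sum_ones, Finset.card_filter, ← Finset.sum_add_distrib]
  refine Finset.sum_congr rfl fun j _ => ?_
  rcases hdeg j with h | h <;> simp [h]

variable {E : Type*} [NormedAddCommGroup E] [NormedSpace ℝ E]
  {G : Type*} [TopologicalSpace G] [ChartedSpace E G] [Group G]

/-- The degree of the `p`-vector of a `p`-dimensional subspace `T` of the Lie algebra is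
`p` plus the rank of the restriction to `T` of the projection onto the second layer. -/
theorem pvectorDegree_iotaMulti [FiniteDimensional ℝ (GroupLieAlgebra 𝓘(ℝ, E) G)]
    {F : Type*} [AddCommGroup F] [Module ℝ F]
    {V₁ V₂ : Submodule ℝ (GroupLieAlgebra 𝓘(ℝ, E) G)} (hV : IsCompl V₁ V₂) {q p : ℕ}
    (W : GradedBasis V₁ V₂ q) (P : GroupLieAlgebra 𝓘(ℝ, E) G →ₗ[ℝ] F)
    (hP : LinearMap.ker P = V₁) (T : Submodule ℝ (GroupLieAlgebra 𝓘(ℝ, E) G))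
    (t : Module.Basis (Fin p) ℝ T) :
    pvectorDegree W (exteriorPower.ιMulti ℝ p fun i => (t i : GroupLieAlgebra 𝓘(ℝ, E) G)) =
      p + Module.finrank ℝ (T.map P) := by
  classical
  set b := W.basis with hb
  let D : Set (Fin q) := {j | W.deg j = 2}
  let c : Fin q → Module.Dual ℝ T := fun j => (b.coord j).domRestrict T
  have hdeg : ∀ i, W.deg i = 1 ∨ W.deg i = 2 := fun i => (W.mem i).imp And.left And.left
  have hker : ∀ v, P v = 0 ↔ ∀ j ∈ D, b.coord j v = 0 := by
    intro v
    rw [← LinearMap.mem_ker, hP]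
    have hsplit : v = ∑ j ∈ Finset.univ.filter (fun j => ¬ W.deg j = 2), b.repr v j • b j +
        ∑ j ∈ Finset.univ.filter (fun j => W.deg j = 2), b.repr v j • b j := by
      rw [add_comm, Finset.sum_filter_add_sum_filter_not, b.sum_repr]
    have h1 : ∑ j ∈ Finset.univ.filter (fun j => ¬ W.deg j = 2), b.repr v j • b j ∈ V₁ := by
      refine Submodule.sum_mem _ fun j hj => Submodule.smul_mem _ _ ?_
      rcases W.mem j with h | h
      · exact h.2
      · exact absurd h.1 (Finset.mem_filter.1 hj).2
    have h2 : ∑ j ∈ Finset.univ.filter (fun j => W.deg j = 2), b.repr v j • b j ∈ V₂ := by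
      refine Submodule.sum_mem _ fun j hj => Submodule.smul_mem _ _ ?_
      rcases W.mem j with h | h
      · have := (Finset.mem_filter.1 hj).2
        omega
      · exact h.2
    constructor
    · intro hv j hj
      have h3 : ∑ j ∈ Finset.univ.filter (fun j => W.deg j = 2), b.repr v j • b j ∈ V₁ := by
        have := V₁.sub_mem hv h1
        rwa [sub_eq_of_eq_add' hsplit] at this
      have h4 : ∑ j ∈ Finset.univ.filter (fun j => W.deg j = 2), b.repr v j • b j = 0 :=
        Submodule.disjoint_def.1 hV.disjoint _ h3 h2
      exact linearIndependent_iff'.1 b.linearIndependent _ (fun j => b.repr v j) h4 j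
        (Finset.mem_filter.2 ⟨Finset.mem_univ _, hj⟩)
    · intro h
      rw [hsplit]
      refine V₁.add_mem h1 ?_
      rw [Finset.sum_eq_zero fun j hj => ?_]
      · exact V₁.zero_mem
      · have : b.repr v j = 0 := h j (Finset.mem_filter.1 hj).2
        rw [this, zero_smul]
  have hspanD : Module.finrank ℝ (Submodule.span ℝ (c '' D)) = Module.finrank ℝ (T.map P) :=
    finrank_span_coord b T D P hker
  have hspan : Module.finrank ℝ (Submodule.span ℝ (c '' univ)) = p := by
    have := finrank_span_coord b T univ LinearMap.id fun v => by
      simp [← b.forall_coord_eq_zero_iff]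
    rw [this, Submodule.map_id, Module.finrank_eq_card_basis t, Fintype.card_fin]
  have hsupp : ∀ J, J ∈ ((b.exteriorPower p).repr
      (exteriorPower.ιMulti ℝ p fun i => (t i : GroupLieAlgebra 𝓘(ℝ, E) G))).support ↔
      LinearIndepOn ℝ c ((J : Finset (Fin q)) : Set (Fin q)) := by
    intro J
    rw [Finsupp.mem_support_iff, exteriorPower.basis_repr_apply, iotaMultiDual_ne_zero_iff]
  have hcard : ∀ (J : Finset (Fin q)), LinearIndepOn ℝ c (J : Set (Fin q)) →
      Module.finrank ℝ (Submodule.span ℝ (c '' (J : Set (Fin q)))) = J.card := by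
    intro J hJ
    have h := finrank_span_eq_card hJ
    rw [Set.image_eq_range]
    simpa using h
  refine le_antisymm (Finset.sup_le fun J hJ => ?_) ?_
  · rw [hsupp] at hJ
    rw [sum_deg_eq _ hdeg, J.2]
    refine Nat.add_le_add_left ?_ _
    -- The degree 2 indices of an admissible `J` give independent forms in the span of `c '' D`, so
    -- there are at most `rank P|_T` of them.
    have h1 : LinearIndepOn ℝ c
        (((J : Finset (Fin q)).filter fun j => W.deg j = 2 : Finset (Fin q)) : Set (Fin q)) :=
      hJ.mono fun j hj => (Finset.mem_filter.1 hj).1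
    rw [← hcard _ h1, ← hspanD]
    refine Submodule.finrank_mono (Submodule.span_mono (Set.image_mono ?_))
    intro j hj
    exact (Finset.mem_filter.1 hj).2
  -- The maximum is attained greedily: a maximal independent family of degree 2 forms, with `rank
  -- P|_T` members, is completed to a basis of the dual of `T`.
  · obtain ⟨J₀, hJ₀D, -, hJ₀span, hJ₀⟩ :=
      exists_linearIndepOn_extension (linearIndepOn_empty ℝ c) (Set.empty_subset D)
    obtain ⟨J, -, hJ₀J, hJspan, hJ⟩ :=
      exists_linearIndepOn_extension hJ₀ (Set.subset_univ J₀)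
    have e1 : (J.toFinset).card = p := by
      rw [← hcard J.toFinset (by simpa using hJ), ← hspan]
      refine le_antisymm (Submodule.finrank_mono (Submodule.span_mono (by simp)))
        (Submodule.finrank_mono (Submodule.span_le.2 (by simpa using hJspan)))
    have e2 : (J₀.toFinset).card = Module.finrank ℝ (T.map P) := by
      rw [← hcard J₀.toFinset (by simpa using hJ₀), ← hspanD]
      refine le_antisymm (Submodule.finrank_mono (Submodule.span_mono
        (Set.image_mono (by simpa using hJ₀D))))
        (Submodule.finrank_mono (Submodule.span_le.2 (by simpa using hJ₀span)))
    let J' : Set.powersetCard (Fin q) p := ⟨J.toFinset, e1⟩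
    have hmem : J' ∈ ((b.exteriorPower p).repr
        (exteriorPower.ιMulti ℝ p fun i => (t i : GroupLieAlgebra 𝓘(ℝ, E) G))).support := by
      rw [hsupp]
      simpa [J'] using hJ
    refine le_trans ?_ (Finset.le_sup (f := fun J : Set.powersetCard (Fin q) p =>
      ∑ j ∈ (J : Finset (Fin q)), W.deg j) hmem)
    change _ ≤ ∑ j ∈ J.toFinset, W.deg j
    rw [sum_deg_eq _ hdeg, e1, ← e2]
    refine Nat.add_le_add_left (Finset.card_le_card fun j hj => ?_) _
    rw [Finset.mem_filter]
    exact ⟨by simpa using hJ₀J (by simpa using hj), hJ₀D (by simpa using hj)⟩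

end Degree

/-! ### Volumes of anisotropic boxes -/

section AnisotropicBoxes

variable {p : ℕ} {F : Type*} [NormedAddCommGroup F] [NormedSpace ℝ F]

/-- The linear map equal to `r²` on `N` and to `r` on the orthogonal complement of `N`. -/
def anisoDilation (N : Submodule ℝ (EuclideanSpace ℝ (Fin p))) (r : ℝ) :
    EuclideanSpace ℝ (Fin p) →ₗ[ℝ] EuclideanSpace ℝ (Fin p) :=
  r • (LinearMap.id - (N.starProjection : EuclideanSpace ℝ (Fin p) →ₗ[ℝ] _)) +
    r ^ 2 • (N.starProjection : EuclideanSpace ℝ (Fin p) →ₗ[ℝ] _)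

lemma anisoDilation_apply (N : Submodule ℝ (EuclideanSpace ℝ (Fin p))) (r : ℝ)
    (v : EuclideanSpace ℝ (Fin p)) :
    anisoDilation N r v = r • (v - N.starProjection v) + r ^ 2 • N.starProjection v := rfl

/-- The map is block diagonal along `N ⊕ Nᗮ`, and `2 dim N + (p - dim N) = p + dim N`. -/
lemma det_anisoDilation (N : Submodule ℝ (EuclideanSpace ℝ (Fin p))) (r : ℝ) :
    LinearMap.det (anisoDilation N r) = r ^ (p + Module.finrank ℝ N) := by
  let e := N.prodEquivOfIsCompl _ N.isCompl_orthogonal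
  let b := (Module.finBasis ℝ N).prod (Module.finBasis ℝ Nᗮ)
  have h1 : ∀ v : N, anisoDilation N r v = r ^ 2 • (v : EuclideanSpace ℝ (Fin p)) := fun v => by
    rw [anisoDilation_apply, Submodule.starProjection_eq_self_iff.2 v.2]; simp
  have h2 : ∀ v : Nᗮ, anisoDilation N r v = r • (v : EuclideanSpace ℝ (Fin p)) := fun v => by
    rw [anisoDilation_apply, (Submodule.starProjection_apply_eq_zero_iff N).2 v.2]; simp
  have key : e.symm.toLinearMap ∘ₗ anisoDilation N r ∘ₗ e.symm.symm.toLinearMap =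
      LinearMap.prodMap (r ^ 2 • LinearMap.id) (r • LinearMap.id) := by
    refine LinearMap.ext fun v => e.injective ?_
    simp only [LinearMap.comp_apply, LinearEquiv.coe_coe, LinearEquiv.apply_symm_apply,
      LinearEquiv.symm_symm]
    have hv : e v = (v.1 : EuclideanSpace ℝ (Fin p)) + v.2 := rfl
    rw [hv, map_add, h1, h2]
    simp [e]
  rw [← LinearMap.det_conj _ e.symm, key, LinearMap.det_prodMap, LinearMap.det_smul,
    LinearMap.det_smul, LinearMap.det_id, LinearMap.det_id]
  have := N.finrank_add_finrank_orthogonal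
  rw [finrank_euclideanSpace_fin] at this
  rw [mul_one, mul_one, ← pow_mul, ← pow_add]
  congr 1
  omega

lemma norm_sub_starProjection_le (N : Submodule ℝ (EuclideanSpace ℝ (Fin p)))
    (v : EuclideanSpace ℝ (Fin p)) : ‖v - N.starProjection v‖ ≤ ‖v‖ := by
  rw [← Submodule.starProjection_orthogonal_val]
  exact Nᗮ.norm_starProjection_apply_le v

/-- By the rank condition `M` is a complement of `ker A`. Moving `w ∈ (ker A)ᗮ` along `ker A` into
`M` does not change `A w` and can only increase the norm, because `w` is the shortest vector of its
class modulo `ker A`. Hence the constant passes from `M` to `(ker A)ᗮ` without loss. -/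
lemma lower_bound_on_ker_orthogonal (A : EuclideanSpace ℝ (Fin p) →L[ℝ] F) {c : ℝ} (hc : 0 < c)
    (M : Submodule ℝ (EuclideanSpace ℝ (Fin p))) (hM : ∀ v ∈ M, c * ‖v‖ ≤ ‖A v‖)
    (hrank : Module.finrank ℝ A.range = Module.finrank ℝ M) :
    ∀ w ∈ (A.ker)ᗮ, c * ‖w‖ ≤ ‖A w‖ := by
  intro w hw
  have hdisj : Disjoint A.ker M := by
    rw [Submodule.disjoint_def]
    intro x hx hxM
    have h := hM x hxM
    rw [show A x = 0 from hx, norm_zero] at h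
    exact norm_le_zero_iff.1 (le_of_mul_le_mul_left (by simpa using h) hc)
  have hsup : A.ker ⊔ M = ⊤ := by
    refine Submodule.eq_top_of_disjoint _ _ ?_ hdisj
    have := LinearMap.finrank_range_add_finrank_ker (A : EuclideanSpace ℝ (Fin p) →ₗ[ℝ] F)
    rw [← this, ← hrank, add_comm]
  obtain ⟨n, hn, μ, hμ, rfl⟩ := Submodule.mem_sup.1 (hsup ▸ Submodule.mem_top : w ∈ A.ker ⊔ M)
  have hn0 : A n = 0 := hn
  rw [map_add, hn0, zero_add]
  refine le_trans ?_ (hM μ hμ)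
  gcongr
  have hin : inner ℝ n (n + μ) = 0 := (Submodule.mem_orthogonal _ _).1 hw n hn
  have : ‖μ‖ ^ 2 = ‖n + μ‖ ^ 2 + ‖n‖ ^ 2 := by
    have h : μ = (n + μ) - n := by abel
    conv_lhs => rw [h, norm_sub_sq_real, real_inner_comm, hin]
    ring
  exact le_of_sq_le_sq (by nlinarith [sq_nonneg ‖n‖]) (norm_nonneg _)

variable (A : EuclideanSpace ℝ (Fin p) →L[ℝ] F)

lemma finrank_ker_orthogonal : Module.finrank ℝ (A.kerᗮ : Submodule ℝ _) =
    Module.finrank ℝ A.range := by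
  have h1 := (A.ker).finrank_add_finrank_orthogonal
  have h2 := LinearMap.finrank_range_add_finrank_ker (A : EuclideanSpace ℝ (Fin p) →ₗ[ℝ] F)
  have h3 : Module.finrank ℝ A.ker + Module.finrank ℝ (A.kerᗮ : Submodule ℝ _) =
    Module.finrank ℝ A.ker + Module.finrank ℝ A.range := by
    rw [h1, ← h2, add_comm]
  exact Nat.add_left_cancel h3

lemma apply_starProjection_ker_orthogonal (v : EuclideanSpace ℝ (Fin p)) :
    A ((A.kerᗮ).starProjection v) = A v := by
  have h : v - (A.kerᗮ).starProjection v ∈ A.ker := by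
    have := (A.kerᗮ).sub_starProjection_mem_orthogonal v
    rwa [Submodule.orthogonal_orthogonal] at this
  have h' : A (v - (A.kerᗮ).starProjection v) = 0 := h
  rw [map_sub, sub_eq_zero] at h'
  exact h'.symm

/-- The set `{|v| ≤ R r, |A v| ≤ R r²}` has volume at most of order `r ^ (p + rank A)`. -/
lemma volume_aniso_le {c R r : ℝ} (hc : 0 < c) (hr : 0 < r)
    (hA : ∀ w ∈ (A.ker)ᗮ, c * ‖w‖ ≤ ‖A w‖) :
    volume {v : EuclideanSpace ℝ (Fin p) | ‖v‖ ≤ R * r ∧ ‖A v‖ ≤ R * r ^ 2} ≤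
      ENNReal.ofReal (r ^ (p + Module.finrank ℝ A.range)) *
        volume (Metric.closedBall (0 : EuclideanSpace ℝ (Fin p)) (R + R / c)) := by
  set N := (A.ker)ᗮ with hN
  have hsub : {v : EuclideanSpace ℝ (Fin p) | ‖v‖ ≤ R * r ∧ ‖A v‖ ≤ R * r ^ 2} ⊆
      anisoDilation N r '' Metric.closedBall 0 (R + R / c) := by
    rintro v ⟨hv, hAv⟩
    have hQ : N.starProjection (N.starProjection v) = N.starProjection v :=
      Submodule.starProjection_eq_self_iff.2 (N.starProjection_apply_mem v)
    -- This is the image of `v` under the inverse dilation. Its component in `N` is bounded through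
    -- `A`: `c |Q v| ≤ |A (Q v)| = |A v| ≤ R r²`, with `Q` the projection onto `N`.
    refine ⟨r⁻¹ • (v - N.starProjection v) + (r ^ 2)⁻¹ • N.starProjection v, ?_, ?_⟩
    · rw [mem_closedBall_zero_iff]
      refine (norm_add_le _ _).trans (add_le_add ?_ ?_)
      · rw [norm_smul, norm_inv, Real.norm_of_nonneg hr.le, inv_mul_le_iff₀ hr, mul_comm r]
        refine le_trans ?_ hv
        exact norm_sub_starProjection_le N v
      · rw [norm_smul, norm_inv, Real.norm_of_nonneg (by positivity), inv_mul_le_iff₀ (by positivity)]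
        have h1 := hA _ (N.starProjection_apply_mem v)
        rw [show A (N.starProjection v) = A v from apply_starProjection_ker_orthogonal A v] at h1
        rw [mul_div_assoc', le_div_iff₀ hc]
        calc _ = c * ‖N.starProjection v‖ := mul_comm _ _
          _ ≤ R * r ^ 2 := h1.trans hAv
          _ = _ := mul_comm _ _
    · rw [anisoDilation_apply]
      simp only [map_add, map_smul, map_sub, hQ, sub_self, smul_zero, zero_add]
      rw [add_sub_cancel_right, smul_smul, smul_smul, mul_inv_cancel₀ hr.ne',
        mul_inv_cancel₀ (by positivity), one_smul, one_smul, sub_add_cancel]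
  refine (measure_mono hsub).trans_eq ?_
  rw [Measure.addHaar_image_linearMap, det_anisoDilation, finrank_ker_orthogonal,
    abs_of_nonneg (by positivity)]

/-- The set `{|v| ≤ ε r, |A v| ≤ ε r²}` has volume at least of order `r ^ (p + rank A)`. -/
lemma le_volume_aniso {C ε δ r : ℝ} (hC : ‖A‖ ≤ C) (h2 : 2 * δ ≤ ε)
    (hCδ : C * δ ≤ ε) (hr : 0 < r) (hr1 : r ≤ 1) :
    ENNReal.ofReal (r ^ (p + Module.finrank ℝ A.range)) *
        volume (Metric.closedBall (0 : EuclideanSpace ℝ (Fin p)) δ) ≤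
      volume {v : EuclideanSpace ℝ (Fin p) | ‖v‖ ≤ ε * r ∧ ‖A v‖ ≤ ε * r ^ 2} := by
  set N := (A.ker)ᗮ with hN
  have hsub : anisoDilation N r '' Metric.closedBall 0 δ ⊆
      {v : EuclideanSpace ℝ (Fin p) | ‖v‖ ≤ ε * r ∧ ‖A v‖ ≤ ε * r ^ 2} := by
    rintro _ ⟨u, hu, rfl⟩
    rw [mem_closedBall_zero_iff] at hu
    have hQu : ‖N.starProjection u‖ ≤ ‖u‖ := N.norm_starProjection_apply_le u
    constructor
    · rw [anisoDilation_apply]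
      refine (norm_add_le _ _).trans ?_
      rw [norm_smul, norm_smul, Real.norm_of_nonneg hr.le, Real.norm_of_nonneg (by positivity)]
      have h1 := norm_sub_starProjection_le N u
      have h3 : r ^ 2 ≤ r := by nlinarith
      calc _ ≤ r * δ + r * δ := by
            gcongr
            · exact h1.trans hu
            · exact hQu.trans hu
        _ = 2 * δ * r := by ring
        _ ≤ ε * r := by gcongr
    -- `A` kills the component scaled by `r`; only the one scaled by `r²` survives.
    · rw [anisoDilation_apply, map_add, map_smul, map_smul, map_sub,
        show A (N.starProjection u) = A u from apply_starProjection_ker_orthogonal A u, sub_self, smul_zero, zero_add, norm_smul,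
        Real.norm_of_nonneg (by positivity), mul_comm ε]
      gcongr
      calc ‖A u‖ ≤ ‖A‖ * ‖u‖ := A.le_opNorm u
        _ ≤ C * δ := by gcongr; exact (norm_nonneg _).trans hC
        _ ≤ ε := hCδ
  refine le_trans (Eq.le ?_) (measure_mono hsub)
  rw [Measure.addHaar_image_linearMap, det_anisoDilation, finrank_ker_orthogonal,
    abs_of_nonneg (by positivity)]

end AnisotropicBoxes

/-! ### Jacobians and Gram determinants -/

section Gram

/-- If `|Q v|² ≤ C² B(v, v)` then `|det (Q ∘ D)| ≤ C ^ p √det (B (D eᵢ, D eⱼ))`. -/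
lemma abs_det_comp_le_sqrt_det_gram {p : ℕ} {V : Type*} [AddCommGroup V] [Module ℝ V]
    (B : V → V → ℝ) (hadd : ∀ u v w, B (u + v) w = B u w + B v w)
    (hsmul : ∀ (a : ℝ) u v, B (a • u) v = a * B u v) (hsymm : ∀ u v, B u v = B v u)
    (D : EuclideanSpace ℝ (Fin p) →ₗ[ℝ] V) (Q : V →ₗ[ℝ] EuclideanSpace ℝ (Fin p)) {C : ℝ}
    (hC : 0 < C) (hQ : ∀ v, ‖Q v‖ ^ 2 ≤ C ^ 2 * B v v) :
    |LinearMap.det (Q ∘ₗ D)| ≤ C ^ p * √(Matrix.det (Matrix.of fun i j : Fin p =>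
      B (D (EuclideanSpace.single i 1)) (D (EuclideanSpace.single j 1)))) := by
  by_cases hdet : LinearMap.det (Q ∘ₗ D) = 0
  · rw [hdet, abs_zero]; positivity
  have hadd' : ∀ u v w, B u (v + w) = B u v + B u w := fun u v w => by
    rw [hsymm, hadd, hsymm v, hsymm w]
  let Bl : V →ₗ[ℝ] V →ₗ[ℝ] ℝ := LinearMap.mk₂ ℝ B hadd (fun a u v => hsmul a u v) hadd'
    (fun a u v => by rw [hsymm, hsmul, hsymm]; rfl)
  -- Normalize `D` to `D' = D ∘ (Q ∘ D)⁻¹`, so that `Q ∘ D'` is the identity. The assumption on `Q`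
  -- then says that the Gram matrix `G'` of `D'` is at least `C⁻² I`, and the determinant of `Q ∘ D`
  -- enters through `G = hᵀ G' h`.
  let H := LinearMap.equivOfDetNeZero (Q ∘ₗ D) hdet
  have hH : ∀ v, H v = Q (D v) := fun v => rfl
  let D' : EuclideanSpace ℝ (Fin p) →ₗ[ℝ] V := D ∘ₗ H.symm.toLinearMap
  let e := (EuclideanSpace.basisFun (Fin p) ℝ).toBasis
  have he : ∀ i, e i = EuclideanSpace.single i 1 := fun i => by simp [e]
  let G : Matrix (Fin p) (Fin p) ℝ := Matrix.of fun i j => B (D (e i)) (D (e j))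
  let G' : Matrix (Fin p) (Fin p) ℝ := Matrix.of fun i j => B (D' (e i)) (D' (e j))
  let h : Matrix (Fin p) (Fin p) ℝ := LinearMap.toMatrix e e (Q ∘ₗ D)
  have hG : G = h.transpose * G' * h := by
    have hGm : G = LinearMap.toMatrix₂ e e (Bl.compl₁₂ D D) := by
      ext i j; rw [LinearMap.toMatrix₂_apply]; rfl
    have hGm' : G' = LinearMap.toMatrix₂ e e (Bl.compl₁₂ D' D') := by
      ext i j; rw [LinearMap.toMatrix₂_apply]; rfl
    have hcomp : Bl.compl₁₂ D D = (Bl.compl₁₂ D' D').compl₁₂ (Q ∘ₗ D) (Q ∘ₗ D) := by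
      ext i j
      have hs : ∀ v, D' (Q (D v)) = D v := fun v => by
        rw [← hH]; simp [D']
      simp [hs]
    rw [hGm, hcomp, LinearMap.toMatrix₂_compl₁₂ e e e e, hGm']
  have hquad : ∀ x : EuclideanSpace ℝ (Fin p), (C ^ 2)⁻¹ * ‖x‖ ^ 2 ≤
      x.ofLp ⬝ᵥ (G'.mulVec x.ofLp) := by
    intro x
    have h1 : x.ofLp ⬝ᵥ (G'.mulVec x.ofLp) = Bl (D' x) (D' x) := by
      have hGm' : G' = LinearMap.toMatrix₂ e e (Bl.compl₁₂ D' D') := by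
        ext i j; rw [LinearMap.toMatrix₂_apply]; rfl
      rw [hGm']
      refine (dotProduct_toMatrix₂_mulVec e e (Bl.compl₁₂ D' D') x.ofLp x.ofLp).trans ?_
      have hx : e.equivFun.symm x.ofLp = x := by
        rw [LinearEquiv.symm_apply_eq]
        ext i; simp [e]
      rw [hx]; rfl
    have h2 := hQ (D' x)
    have h3 : Q (D' x) = x := H.apply_symm_apply x
    rw [h3] at h2
    rw [h1, inv_mul_le_iff₀ (by positivity)]
    exact h2
  have hherm : G'.IsHermitian := by
    ext i j
    simp [G', hsymm]
  have hdetG' : (C ^ 2)⁻¹ ^ p ≤ G'.det := by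
    rw [hherm.det_eq_prod_eigenvalues]
    have : (C ^ 2)⁻¹ ^ p = ∏ _i : Fin p, (C ^ 2)⁻¹ := by simp
    rw [this]
    -- The quadratic form of `G'` at a unit eigenvector is the eigenvalue, so each eigenvalue is at
    -- least `C⁻²`.
    refine Finset.prod_le_prod (fun i _ => by positivity) fun i _ => ?_
    have := hquad (hherm.eigenvectorBasis i)
    rw [hherm.eigenvectorBasis.orthonormal.1 i, hherm.mulVec_eigenvectorBasis] at this
    rw [dotProduct_smul] at this
    have h5 : (hherm.eigenvectorBasis i).ofLp ⬝ᵥ (hherm.eigenvectorBasis i).ofLp = 1 := by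
      have h6 := EuclideanSpace.real_norm_sq_eq (hherm.eigenvectorBasis i)
      rw [hherm.eigenvectorBasis.orthonormal.1 i] at h6
      rw [dotProduct, ← one_pow 2, h6]
      exact Finset.sum_congr rfl fun _ _ => by ring
    rw [h5] at this
    simpa using this
  have hfin : |LinearMap.det (Q ∘ₗ D)| ^ 2 ≤ (C ^ p) ^ 2 * G.det := by
    have : LinearMap.det (Q ∘ₗ D) = h.det := (LinearMap.det_toMatrix e _).symm
    rw [hG, Matrix.det_mul, Matrix.det_mul, Matrix.det_transpose, this, sq_abs]
    have h4 : 1 ≤ (C ^ p) ^ 2 * G'.det := by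
      rw [inv_pow, inv_le_iff_one_le_mul₀ (by positivity)] at hdetG'
      calc 1 ≤ _ := hdetG'
        _ = _ := by ring
    nlinarith [sq_nonneg h.det]
  have hGe : (Matrix.of fun i j : Fin p =>
      B (D (EuclideanSpace.single i 1)) (D (EuclideanSpace.single j 1))) = G := by
    ext i j; simp [G, he]
  rw [hGe]
  have := Real.abs_le_sqrt (x := |LinearMap.det (Q ∘ₗ D)|) hfin
  rw [abs_abs, Real.sqrt_mul (by positivity), Real.sqrt_sq (by positivity)] at this
  exact this

end Gram

/-! ### Boxes and balls under approximate dilations -/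

section Dynamics

variable {G : Type*} [TopologicalSpace G] [Group G]

/-- Two functions `a`, `b` with the properties of the norms of the two layers of a system of
coordinates centred at the identity and defined on `N`. -/
structure LayerNorms (N : Set G) (a b : G → ℝ) : Prop where
  mem_nhds : N ∈ 𝓝 1
  nonneg_left : ∀ x, 0 ≤ a x
  nonneg_right : ∀ x, 0 ≤ b x
  tendsto_left : Tendsto a (𝓝 1) (𝓝 0)
  tendsto_right : Tendsto b (𝓝 1) (𝓝 0)
  basis : ∀ O ∈ 𝓝 (1 : G), ∃ ε > 0, ∀ x ∈ N, a x < ε → b x < ε → x ∈ O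

variable {N : Set G} {a b : G → ℝ}

/-- Under a map which expands the layers by `2` and `4` up to cubic errors, boxes expand into a
fixed neighbourhood: the box of size `r` is contained in the ball of radius `r`. -/
theorem box_subset_ball (h : LayerNorms N a b) {ρ : G → G → ℝ}
    (hρc : Continuous (ρ 1)) (hρ1 : ρ 1 1 = 0) (ψ : G →* G) (hψc : Tendsto ψ (𝓝 1) (𝓝 1))
    (hψ : ∀ x y, ρ (ψ x) (ψ y) = 2 * ρ x y) {K : ℝ} (hK : 0 ≤ K)
    (ha : ∀ x ∈ N, a (ψ x) ≤ 2 * a x + K * (a x + b x) ^ 3)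
    (hb : ∀ x ∈ N, b (ψ x) ≤ 4 * b x + K * (a x + b x) ^ 3) :
    ∃ c > 0, ∀ x ∈ N, ∀ r : ℝ, 0 < r → r ≤ 1 → a x ≤ c * r → b x ≤ c * r ^ 2 → ρ 1 x < r := by
  -- The radius is `1 / 2` because the dyadic scale `s` chosen below only satisfies `s / 2 < r ≤ s`.
  have hO : ψ ⁻¹' N ∩ {x | ρ 1 x < 1 / 2} ∈ 𝓝 (1 : G) := by
    refine inter_mem (hψc h.mem_nhds) ?_
    exact (isOpen_lt hρc continuous_const).mem_nhds (by simp [hρ1])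
  obtain ⟨ε, hε, hεO⟩ := h.basis _ hO
  -- The first condition makes the cubic error at scale `t` at most `2 c t³`; the second keeps the
  -- orbit where the estimates hold.
  obtain ⟨c, hc, hcK, hcε⟩ : ∃ c > 0, 32 * K * c ^ 2 ≤ 1 ∧ 2 * c < ε := by
    refine ⟨min (ε / 4) (1 / (32 * K + 1)), by positivity, ?_, ?_⟩
    · set m := min (ε / 4) (1 / (32 * K + 1))
      have h1 : m ≤ 1 / (32 * K + 1) := min_le_right _ _
      have h0 : 0 < m := by positivity
      rw [le_div_iff₀ (by positivity)] at h1
      have h2 : m ≤ 1 := by nlinarith [mul_nonneg hK h0.le]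
      nlinarith [mul_nonneg hK h0.le]
    · have : min (ε / 4) (1 / (32 * K + 1)) ≤ ε / 4 := min_le_left _ _
      linarith
  refine ⟨c, hc, fun x hx r hr hr1 hax hbx => ?_⟩
  obtain ⟨k, hk1, hk2⟩ := exists_nat_pow_near_of_lt_one hr hr1 (by norm_num : (0 : ℝ) < 1 / 2)
    (by norm_num)
  set s : ℝ := (1 / 2) ^ k with hs
  have hs0 : 0 < s := by positivity
  -- At scale `t = 2 ^ j * s` the factor `1 + t` becomes `1 + 2 t` at the next step. This leaves
  -- room `2 c t²` in the first layer and `4 c t³` in the second, enough for the error `2 c t³`.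
  have key : ∀ j ≤ k, ψ^[j] x ∈ N ∧ a (ψ^[j] x) ≤ c * (2 ^ j * s) * (1 + 2 ^ j * s) ∧
      b (ψ^[j] x) ≤ c * (2 ^ j * s) ^ 2 * (1 + 2 ^ j * s) ∧ 2 ^ j * s ≤ 1 := by
    intro j
    induction j with
    | zero =>
      intro _
      have hs1 : s ≤ 1 := pow_le_one₀ (by norm_num) (by norm_num)
      refine ⟨hx, ?_, ?_, by simpa using hs1⟩
      · simp only [Function.iterate_zero, id_eq, pow_zero, one_mul]
        calc a x ≤ c * r := hax
          _ ≤ c * s * 1 := by rw [mul_one]; gcongr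
          _ ≤ _ := by gcongr; linarith
      · simp only [Function.iterate_zero, id_eq, pow_zero, one_mul]
        calc b x ≤ c * r ^ 2 := hbx
          _ ≤ c * s ^ 2 * 1 := by rw [mul_one]; gcongr
          _ ≤ _ := by gcongr; linarith
    | succ j ih =>
      intro hj
      obtain ⟨hN, haj, hbj, ht⟩ := ih (by omega)
      rw [Function.iterate_succ_apply']
      set y := ψ^[j] x
      set t := 2 ^ j * s with htdef
      have ht0 : 0 < t := by positivity
      have ht' : (2 : ℝ) ^ (j + 1) * s = 2 * t := by rw [pow_succ, htdef]; ring
      have hale : a y ≤ 2 * c * t := haj.trans (by nlinarith [mul_pos hc ht0])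
      have hble : b y ≤ 2 * c * t := hbj.trans (by
        have : t ^ 2 * (1 + t) ≤ 2 * t := by nlinarith
        nlinarith)
      have ht1 : 2 * t ≤ 1 := by
        rw [← ht', hs, one_div, inv_pow, mul_inv_le_iff₀ (by positivity), one_mul]
        exact pow_le_pow_right₀ (by norm_num) hj
      have hcube : K * (a y + b y) ^ 3 ≤ 2 * c * t ^ 3 := by
        have h1 : (a y + b y) ^ 3 ≤ (4 * c * t) ^ 3 :=
          pow_le_pow_left₀ (add_nonneg (h.nonneg_left _) (h.nonneg_right _)) (by linarith) 3
        calc K * (a y + b y) ^ 3 ≤ K * (4 * c * t) ^ 3 := by gcongr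
          _ = (32 * K * c ^ 2) * (2 * c * t ^ 3) := by ring
          _ ≤ 1 * (2 * c * t ^ 3) := by gcongr
          _ = _ := one_mul _
      have hyO := hεO y hN (by nlinarith) (by nlinarith)
      rw [ht']
      refine ⟨hyO.1, ?_, ?_, ht1⟩
      · have h3 : c * t ^ 3 ≤ c * t ^ 2 := by
          have : t ^ 3 ≤ t ^ 2 := pow_le_pow_of_le_one ht0.le ht (by norm_num)
          gcongr
        nlinarith [ha y hN, mul_pos hc ht0]
      · nlinarith [hb y hN, mul_pos hc (pow_pos ht0 3)]
  obtain ⟨hN, hak, hbk, ht⟩ := key k le_rfl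
  have hks : (2 : ℝ) ^ k * s = 1 := by rw [hs, ← mul_pow]; norm_num
  rw [hks] at hak hbk
  have hyO := (hεO _ hN (by linarith) (by linarith)).2
  have hiter : ∀ j, ρ 1 (ψ^[j] x) = 2 ^ j * ρ 1 x := by
    intro j
    induction j with
    | zero => simp
    | succ j ih =>
      rw [Function.iterate_succ_apply']
      have := hψ 1 (ψ^[j] x)
      rw [map_one] at this
      rw [this, ih, pow_succ]; ring
  have h5 : (2 : ℝ) ^ k * ρ 1 x < 1 / 2 := hiter k ▸ hyO
  have h6 : ρ 1 x < (1 / 2) ^ (k + 1) := by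
    calc ρ 1 x = s * (2 ^ k * ρ 1 x) := by rw [← mul_assoc, mul_comm s, hks, one_mul]
      _ < s * (1 / 2) := by gcongr
      _ = _ := by rw [pow_succ]
  exact h6.trans hk1

/-- Under a map which contracts the layers by `1 / 2` and `1 / 4` up to cubic errors, orbits
converge to the identity, at the rates `2⁻ʲ` and `4⁻ʲ` in the two layers. -/
theorem iterate_contracting (h : LayerNorms N a b) (φ : G → G) (hφc : Tendsto φ (𝓝 1) (𝓝 1))
    {K : ℝ} (hK : 0 ≤ K)
    (ha : ∀ x ∈ N, a (φ x) ≤ a x / 2 + K * (a x + b x) ^ 3)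
    (hb : ∀ x ∈ N, b (φ x) ≤ b x / 4 + K * (a x + b x) ^ 3) :
    ∃ ε > 0, ∀ x ∈ N, a x ≤ ε → b x ≤ ε → ∀ j, φ^[j] x ∈ N ∧
      a (φ^[j] x) ≤ 2 * ε * (1 / 2) ^ j ∧ b (φ^[j] x) ≤ 2 * ε * ((1 / 2) ^ j) ^ 2 := by
  obtain ⟨ε₁, hε₁, hεO⟩ := h.basis _ (hφc h.mem_nhds)
  -- The constant 512 makes the cubic error at scale `t` at most `c t³ / 8`, exactly the room left
  -- in the second layer below.
  obtain ⟨c, hc, hcK, hcε⟩ : ∃ c > 0, 512 * K * c ^ 2 ≤ 1 ∧ 2 * c < ε₁ := by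
    refine ⟨min (ε₁ / 4) (1 / (512 * K + 1)), by positivity, ?_, ?_⟩
    · set m := min (ε₁ / 4) (1 / (512 * K + 1))
      have h1 : m ≤ 1 / (512 * K + 1) := min_le_right _ _
      have h0 : 0 < m := by positivity
      rw [le_div_iff₀ (by positivity)] at h1
      have h2 : m ≤ 1 := by nlinarith [mul_nonneg hK h0.le]
      nlinarith [mul_nonneg hK h0.le]
    · have : min (ε₁ / 4) (1 / (512 * K + 1)) ≤ ε₁ / 4 := min_le_left _ _
      linarith
  refine ⟨c, hc, fun x hx hax hbx => ?_⟩
  -- With `t = (1 / 2) ^ j` decreasing, the factor `2 - t` increases from 1 towards 2, and its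
  -- increments absorb the cubic errors.
  have key : ∀ j, φ^[j] x ∈ N ∧ a (φ^[j] x) ≤ c * (1 / 2) ^ j * (2 - (1 / 2) ^ j) ∧
      b (φ^[j] x) ≤ c * ((1 / 2) ^ j) ^ 2 * (2 - (1 / 2) ^ j) := by
    intro j
    induction j with
    | zero => exact ⟨hx, by norm_num; exact hax, by norm_num; exact hbx⟩
    | succ j ih =>
      obtain ⟨hN, haj, hbj⟩ := ih
      rw [Function.iterate_succ_apply']
      set y := φ^[j] x
      have ht' : (1 / 2 : ℝ) ^ (j + 1) = (1 / 2) ^ j / 2 := by rw [pow_succ]; ring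
      rw [ht']
      have ht : (1 / 2 : ℝ) ^ j ≤ 1 := pow_le_one₀ (by norm_num) (by norm_num)
      have ht0 : (0 : ℝ) < (1 / 2) ^ j := by positivity
      set t : ℝ := (1 / 2) ^ j
      have hct := mul_pos hc ht0
      have hale : a y ≤ 2 * c * t := haj.trans (by nlinarith)
      have hble : b y ≤ 2 * c * t := hbj.trans (by
        have : t ^ 2 * (2 - t) ≤ 2 * t := by nlinarith [sq_nonneg t]
        nlinarith)
      have hcube : K * (a y + b y) ^ 3 ≤ c * t ^ 3 / 8 := by
        have h1 : (a y + b y) ^ 3 ≤ (4 * c * t) ^ 3 :=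
          pow_le_pow_left₀ (add_nonneg (h.nonneg_left _) (h.nonneg_right _)) (by linarith) 3
        calc K * (a y + b y) ^ 3 ≤ K * (4 * c * t) ^ 3 := by gcongr
          _ = (512 * K * c ^ 2) * (c * t ^ 3 / 8) := by ring
          _ ≤ 1 * (c * t ^ 3 / 8) := by gcongr
          _ = _ := one_mul _
      have hyO := hεO y hN (by nlinarith) (by nlinarith)
      refine ⟨hyO, ?_, ?_⟩
      · have h3 : c * t ^ 3 ≤ c * t ^ 2 := by
          have : t ^ 3 ≤ t ^ 2 := pow_le_pow_of_le_one ht0.le ht (by norm_num)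
          gcongr
        have h4 : 0 < c * t ^ 2 := by positivity
        nlinarith [ha y hN]
      · have h4 : 0 < c * t ^ 3 := by positivity
        nlinarith [hb y hN]
  intro j
  obtain ⟨h1, h2, h3⟩ := key j
  have ht0 : (0 : ℝ) < (1 / 2) ^ j := by positivity
  refine ⟨h1, h2.trans ?_, h3.trans ?_⟩
  · nlinarith [mul_pos hc ht0]
  · nlinarith [mul_pos hc (pow_pos ht0 2)]

/-- A homomorphism that contracts a neighbourhood of the identity of a connected group contracts
every point. -/
theorem tendsto_iterate_one [IsTopologicalGroup G] [ConnectedSpace G] (φ : G →* G) {O : Set G}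
    (hO : O ∈ 𝓝 (1 : G)) (h : ∀ x ∈ O, Tendsto (fun j => φ^[j] x) atTop (𝓝 1)) (x : G) :
    Tendsto (fun j => φ^[j] x) atTop (𝓝 1) := by
  have hpow : ∀ (j : ℕ) (x y : G), φ^[j] (x * y) = φ^[j] x * φ^[j] y := fun j x y =>
    iterate_map_mul φ j x y
  let H : Subgroup G :=
    { carrier := {x | Tendsto (fun j => φ^[j] x) atTop (𝓝 1)}
      mul_mem' := fun {x y} hx hy => by
        have := Tendsto.mul hx hy
        simpa only [mem_ofPred_eq, hpow, mul_one] using this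
      one_mem' := by
        simp only [mem_ofPred_eq, iterate_map_one]
        exact tendsto_const_nhds
      inv_mem' := fun {x} hx => by
        have := Tendsto.inv hx
        simpa only [mem_ofPred_eq, iterate_map_inv, inv_one] using this }
  -- The contracted points form a subgroup that contains a neighbourhood of the identity; it is
  -- clopen, hence everything by connectedness.
  have hopen : IsOpen (H : Set G) := H.isOpen_of_mem_nhds (g := 1) (mem_of_superset hO h)
  have htop : (H : Set G) = univ :=
    IsClopen.eq_univ ⟨H.isClosed_of_isOpen hopen, hopen⟩ ⟨1, H.one_mem⟩
  exact (htop ▸ mem_univ x : x ∈ (H : Set G))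

/-- Small balls of a distance contracted by `φ` are small neighbourhoods. -/
theorem ball_subset_nhds [LocallyCompactSpace G] {ρ : G → G → ℝ}
    (hρc : Continuous (ρ 1)) (hρ0 : ∀ x y, 0 ≤ ρ x y) (hρ1 : ∀ x y, ρ x y = 0 ↔ x = y)
    (φ : G →* G) (hφc : 𝓝 1 ≤ map φ (𝓝 1)) (hφ : ∀ x y, ρ (φ x) (φ y) = 1 / 2 * ρ x y)
    (hlim : ∀ x, Tendsto (fun j => φ^[j] x) atTop (𝓝 1)) {O : Set G} (hO : O ∈ 𝓝 (1 : G)) :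
    ∃ η > 0, ∀ x, ρ 1 x < η → x ∈ O := by
  obtain ⟨N₁, hN₁, hN₁O, hN₁c⟩ := local_compact_nhds hO
  have hinj : Function.Injective φ := fun x y hxy => by
    have h1 := hφ x y
    rw [(hρ1 _ _).2 hxy] at h1
    exact (hρ1 _ _).1 (by linarith)
  have himg : φ '' N₁ ∩ N₁ ∈ 𝓝 (1 : G) := inter_mem (hφc (image_mem_map hN₁)) hN₁
  obtain ⟨N₂, hN₂, hN₂o, h1N₂⟩ := mem_nhds_iff.1 himg
  obtain ⟨η, hη, hηK⟩ : ∃ η > 0, ∀ y ∈ N₁ \ N₂, η ≤ ρ 1 y := by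
    rcases (N₁ \ N₂).eq_empty_or_nonempty with hem | hne
    · exact ⟨1, one_pos, fun y hy => by simp [hem] at hy⟩
    · obtain ⟨y₀, hy₀, hmin⟩ := (hN₁c.diff hN₂o).exists_isMinOn hne hρc.continuousOn
      refine ⟨ρ 1 y₀, lt_of_le_of_ne (hρ0 _ _) fun h0 => ?_, fun y hy => hmin hy⟩
      have : 1 = y₀ := (hρ1 _ _).1 h0.symm
      exact hy₀.2 (this ▸ h1N₂)
  have hiter : ∀ j x, ρ 1 (φ^[j] x) = (1 / 2) ^ j * ρ 1 x := by
    intro j x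
    induction j with
    | zero => simp
    | succ j ih =>
      rw [Function.iterate_succ_apply']
      have := hφ 1 (φ^[j] x)
      rw [map_one] at this
      rw [this, ih, pow_succ]; ring
  refine ⟨η, hη, fun x hx => ?_⟩
  by_contra hxO
  have hxN₂ : x ∉ N₂ := fun h => hxO (hN₁O (hN₂ h).2)
  classical
  -- Consider the first entrance of the orbit into `N₂ ⊆ φ(N₁)`. By injectivity of `φ` the preceding
  -- point lies in `N₁`, but not in `N₂`, so its distance from the identity is at least `η`; yet
  -- that distance is at most `ρ 1 x < η`.
  have hex : ∃ k, φ^[k] x ∈ N₂ := ((hlim x).eventually (hN₂o.mem_nhds h1N₂)).exists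
  have hk := Nat.find_spec hex
  have hk0 : Nat.find hex ≠ 0 := fun h0 => hxN₂ (by rw [h0] at hk; simpa using hk)
  obtain ⟨k, hk'⟩ := Nat.exists_eq_succ_of_ne_zero hk0
  have hmin : φ^[k] x ∉ N₂ := Nat.find_min hex (by omega)
  rw [hk', Nat.succ_eq_add_one, Function.iterate_succ_apply'] at hk
  obtain ⟨y, hy, hye⟩ := (hN₂ hk).1
  have hmem : φ^[k] x ∈ N₁ := hinj hye ▸ hy
  have h1 := hηK _ ⟨hmem, hmin⟩
  rw [hiter] at h1
  have h2 : (1 / 2 : ℝ) ^ k * ρ 1 x ≤ 1 * ρ 1 x := by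
    gcongr
    · exact hρ0 _ _
    · exact pow_le_one₀ (by norm_num) (by norm_num)
  linarith

/-- The ball of radius `r` is contained in a box of size comparable to `r`. -/
theorem ball_subset_box (h : LayerNorms N a b) {ρ : G → G → ℝ} (hρ0 : ∀ x y, 0 ≤ ρ x y)
    (φ : G →* G) (hφc : 𝓝 1 ≤ map φ (𝓝 1)) (hφ : ∀ x y, ρ (φ x) (φ y) = 1 / 2 * ρ x y)
    (hsmall : ∀ O ∈ 𝓝 (1 : G), ∃ η > 0, ∀ x, ρ 1 x < η → x ∈ O) {ε : ℝ} (hε : 0 < ε)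
    (hiter : ∀ x ∈ N, a x ≤ ε → b x ≤ ε → ∀ j, φ^[j] x ∈ N ∧
      a (φ^[j] x) ≤ 2 * ε * (1 / 2) ^ j ∧ b (φ^[j] x) ≤ 2 * ε * ((1 / 2) ^ j) ^ 2) :
    ∃ C > 0, ∃ r₀ > 0, ∀ x r, r < r₀ → ρ 1 x < r → x ∈ N ∧ a x ≤ C * r ∧ b x ≤ C * r ^ 2 := by
  -- The range of `φ` is included so that small balls can be pulled back by `φ`: a point of the ball
  -- of radius `η 2⁻ᵏ` is the `k`-th iterate of one in the ball of radius `η`.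
  have hO : N ∩ {x | a x ≤ ε} ∩ {x | b x ≤ ε} ∩ range φ ∈ 𝓝 (1 : G) := by
    refine inter_mem (inter_mem (inter_mem h.mem_nhds (h.tendsto_left (Iic_mem_nhds hε)))
      (h.tendsto_right (Iic_mem_nhds hε))) (hφc ?_)
    rw [mem_map]
    simp
  obtain ⟨η, hη, hηO⟩ := hsmall _ hO
  have hpre : ∀ k x, ρ 1 x < η * (1 / 2) ^ k → ∃ y, ρ 1 y < η ∧ φ^[k] y = x := by
    intro k
    induction k with
    | zero => exact fun x hx => ⟨x, by simpa using hx, rfl⟩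
    | succ k ih =>
      intro x hx
      have hle : η * (1 / 2) ^ (k + 1) ≤ η * 1 := by
        gcongr
        exact pow_le_one₀ (by norm_num) (by norm_num)
      obtain ⟨x', rfl⟩ := (hηO x (by linarith)).2
      have h1 := hφ 1 x'
      rw [map_one] at h1
      obtain ⟨y, hy, hye⟩ := ih x' (by rw [h1, pow_succ] at hx; linarith)
      exact ⟨y, hy, by rw [Function.iterate_succ_apply', hye]⟩
  -- The two summands come from inserting `(1 / 2) ^ k ≤ 2 r / η` into the bounds for the first and
  -- second layer.
  refine ⟨4 * ε / η + 8 * ε / η ^ 2, by positivity, η, hη, fun x r hr hx => ?_⟩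
  have hr0 : 0 < r := (hρ0 1 x).trans_lt hx
  obtain ⟨k, hk1, hk2⟩ := exists_nat_pow_near_of_lt_one (x := r / η) (by positivity)
    (by rw [div_le_one hη]; exact hr.le) (by norm_num : (0 : ℝ) < 1 / 2) (by norm_num)
  obtain ⟨y, hy, rfl⟩ := hpre k x (hx.trans_le (by rw [div_le_iff₀ hη] at hk2; linarith))
  obtain ⟨⟨⟨hyN, hya⟩, hyb⟩, -⟩ := hηO y hy
  obtain ⟨h1, h2, h3⟩ := hiter y hyN hya hyb k
  have hk3 : (1 / 2 : ℝ) ^ k ≤ 2 * (r / η) := by rw [pow_succ] at hk1; linarith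
  refine ⟨h1, h2.trans ?_, h3.trans ?_⟩
  · calc 2 * ε * (1 / 2) ^ k ≤ 2 * ε * (2 * (r / η)) := by gcongr
      _ = 4 * ε / η * r := by ring
      _ ≤ _ := by gcongr; linarith [show 0 < 8 * ε / η ^ 2 by positivity]
  · calc 2 * ε * ((1 / 2) ^ k) ^ 2 ≤ 2 * ε * (2 * (r / η)) ^ 2 := by gcongr
      _ = 8 * ε / η ^ 2 * r ^ 2 := by ring
      _ ≤ _ := by gcongr; linarith [show 0 < 4 * ε / η by positivity]

end Dynamics

/-! ### Taylor estimates for odd maps -/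

section Calculus

variable {E F : Type*} [NormedAddCommGroup E] [NormedSpace ℝ E]
  [NormedAddCommGroup F] [NormedSpace ℝ F]

/-- Mean value inequality on the segment for `f` minus its linear part at `x`, whose derivative
there is at most `K ‖y - x‖`. -/
lemma norm_sub_sub_fderiv_le {f : E → F} {s : Set E} (hs : Convex ℝ s)
    (hf : ∀ x ∈ s, DifferentiableAt ℝ f x) {K : ℝ≥0} (hK : LipschitzOnWith K (fderiv ℝ f) s)
    {x y : E} (hx : x ∈ s) (hy : y ∈ s) :
    ‖f y - f x - fderiv ℝ f x (y - x)‖ ≤ K * ‖y - x‖ ^ 2 := by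
  have hseg : segment ℝ x y ⊆ s := hs.segment_subset hx hy
  have := Convex.norm_image_sub_le_of_norm_fderiv_le' (φ := fderiv ℝ f x) (C := K * ‖y - x‖)
    (fun z hz => hf z (hseg hz)) (fun z hz => ?_) (convex_segment x y)
    (left_mem_segment ℝ x y) (right_mem_segment ℝ x y)
  · rwa [mul_assoc, ← sq] at this
  · refine (hK.norm_sub_le (hseg hz) hx).trans ?_
    gcongr
    exact norm_sub_le_of_mem_segment hz

lemma isBigO_pow_succ_of_fderiv {f : E → F} {n : ℕ} (hf : ∀ᶠ x in 𝓝 0, DifferentiableAt ℝ f x)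
    (h0 : f 0 = 0) (h : fderiv ℝ f =O[𝓝 0] fun x => ‖x‖ ^ n) :
    f =O[𝓝 0] fun x => ‖x‖ ^ (n + 1) := by
  obtain ⟨C, hC⟩ := h.bound
  obtain ⟨ε, hε, hball⟩ := Metric.eventually_nhds_iff_ball.1 (hf.and hC)
  refine Asymptotics.IsBigO.of_bound C ?_
  filter_upwards [Metric.ball_mem_nhds (0 : E) hε] with x hx
  have hsub : Metric.closedBall (0 : E) ‖x‖ ⊆ Metric.ball 0 ε :=
    Metric.closedBall_subset_ball (by simpa using hx)
  have hx' : x ∈ Metric.closedBall (0 : E) ‖x‖ := by simp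
  have hC0 : 0 ≤ C * ‖x‖ ^ n := (norm_nonneg _).trans (by simpa using (hball x hx).2)
  have := Convex.norm_image_sub_le_of_norm_fderiv_le (C := C * ‖x‖ ^ n)
    (fun z hz => (hball z (hsub hz)).1) (fun z hz => ?_) (convex_closedBall (0 : E) ‖x‖)
    (Metric.mem_closedBall_self (norm_nonneg x)) hx'
  · rw [h0, sub_zero, sub_zero] at this
    rw [Real.norm_of_nonneg (by positivity), pow_succ, ← mul_assoc]
    exact this
  · rcases le_or_gt 0 C with hC1 | hC1
    · refine (hball z (hsub hz)).2.trans ?_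
      rw [Real.norm_of_nonneg (by positivity)]
      gcongr
      simpa using hz
    · refine (hball z (hsub hz)).2.trans (le_trans ?_ hC0)
      rw [Real.norm_of_nonneg (by positivity)]
      exact mul_nonpos_of_nonpos_of_nonneg hC1.le (by positivity)

/-- A `C³` map that vanishes to second order at `0` and is odd with respect to an involution with
differential `-1` vanishes to third order. -/
lemma isBigO_cube_of_odd {R : E → F} {ι : E → E} (hR : ContDiffAt ℝ 3 R 0)
    (hι : ContDiffAt ℝ 2 ι 0) (hι0 : ι 0 = 0)
    (hι' : fderiv ℝ ι 0 = -ContinuousLinearMap.id ℝ E) (hodd : ∀ᶠ u in 𝓝 0, R (ι u) = -R u)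
    (hR0 : R 0 = 0) (hR' : fderiv ℝ R 0 = 0) : R =O[𝓝 0] fun u => ‖u‖ ^ 3 := by
  have hg : ContDiffAt ℝ 2 (fderiv ℝ R) 0 := hR.fderiv_right (by norm_num)
  have hdι : ContDiffAt ℝ 1 (fderiv ℝ ι) 0 := hι.fderiv_right (by norm_num)
  have hRd : ∀ᶠ u in 𝓝 (0 : E), DifferentiableAt ℝ R u := by
    filter_upwards [hR.eventually (by simp)] with u hu
    exact hu.differentiableAt (by simp)
  have hgd : ∀ᶠ u in 𝓝 (0 : E), DifferentiableAt ℝ (fderiv ℝ R) u := by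
    filter_upwards [hg.eventually (by simp)] with u hu
    exact hu.differentiableAt (by simp)
  have hιd : ∀ᶠ u in 𝓝 (0 : E), DifferentiableAt ℝ ι u := by
    filter_upwards [hι.eventually (by simp)] with u hu
    exact hu.differentiableAt (by simp)
  have hιt : Tendsto ι (𝓝 0) (𝓝 0) := by
    have := hι.continuousAt.tendsto
    rwa [hι0] at this
  have heq : ∀ᶠ u in 𝓝 (0 : E), (fderiv ℝ R (ι u)).comp (fderiv ℝ ι u) = -fderiv ℝ R u := by
    filter_upwards [hιt.eventually hRd, hιd, hRd, hodd.eventually_nhds] with u h1 h2 h3 h4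
    have h5 : (R ∘ ι) =ᶠ[𝓝 u] fun v => -R v := h4
    rw [← fderiv_comp u h1 h2, h5.fderiv_eq, fderiv_fun_neg]
  have hG : HasFDerivAt (fderiv ℝ R) (fderiv ℝ (fderiv ℝ R) 0) 0 :=
    (hg.differentiableAt (by simp)).hasFDerivAt
  have hι1 : HasFDerivAt ι (-ContinuousLinearMap.id ℝ E) 0 :=
    hι' ▸ (hι.differentiableAt (by simp)).hasFDerivAt
  have hGι : HasFDerivAt (fun u => fderiv ℝ R (ι u))
      ((fderiv ℝ (fderiv ℝ R) 0).comp (-ContinuousLinearMap.id ℝ E)) 0 := by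
    refine HasFDerivAt.comp (0 : E) ?_ hι1
    rwa [hι0]
  have hdι1 : HasFDerivAt (fderiv ℝ ι) (fderiv ℝ (fderiv ℝ ι) 0) 0 :=
    (hdι.differentiableAt (by simp)).hasFDerivAt
  have h1 := hGι.clm_comp hdι1
  have h2 : HasFDerivAt (fun u => (fderiv ℝ R (ι u)).comp (fderiv ℝ ι u))
      (-fderiv ℝ (fderiv ℝ R) 0) 0 := hG.neg.congr_of_eventuallyEq heq
  have h3 := h1.unique h2
  -- Differentiating `R'(ι u) ∘ ι'(u) = -R'(u)` at `0` leaves `D²R = -D²R`: the two factors `-1`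
  -- cancel, and the term with the second derivative of `ι` carries `R'(0) = 0`.
  have hD2 : fderiv ℝ (fderiv ℝ R) 0 = 0 := by
    ext v w
    have h4 := congrArg (fun T => T v w) h3
    simp only [hι0, hR', hι'] at h4
    simp only [add_apply, ContinuousLinearMap.comp_apply,
      ContinuousLinearMap.compL_apply, neg_apply,
      ContinuousLinearMap.id_apply, ContinuousLinearMap.flip_apply, map_neg, neg_neg,
      ContinuousLinearMap.zero_comp, zero_add] at h4
    have h5 : (2 : ℝ) • fderiv ℝ (fderiv ℝ R) 0 v w = 0 := by
      rw [two_smul]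
      nth_rewrite 1 [h4]
      simp
    simpa using h5
  have hG2 : fderiv ℝ (fderiv ℝ R) =O[𝓝 0] fun u => ‖u‖ ^ 1 := by
    have h6 := (hg.fderiv_right (m := 1) (by norm_num)).differentiableAt (by simp)
    have h7 := h6.isBigO_sub
    simp only [hD2, sub_zero] at h7
    simpa using h7.norm_right
  exact isBigO_pow_succ_of_fderiv hRd hR0 (isBigO_pow_succ_of_fderiv hgd hR' hG2)

end Calculus

/-! ### Coordinates that are odd under inversion -/

section OddCoordinates

variable {E : Type*} [NormedAddCommGroup E] [NormedSpace ℝ E]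
  {G : Type*} [TopologicalSpace G] [ChartedSpace E G] [Group G]

variable (E G) in
/-- The inverse of the chart at the identity, centred at `0`. -/
def chartParam (u : E) : G := (extChartAt 𝓘(ℝ, E) (1 : G)).symm (extChartAt 𝓘(ℝ, E) (1 : G) 1 + u)

/-- The chart at the identity, centred at the identity. -/
def centredChart (x : G) : E := extChartAt 𝓘(ℝ, E) (1 : G) x - extChartAt 𝓘(ℝ, E) (1 : G) 1

/-- The odd part of the chart at the identity. -/
def oddChart (x : G) : E := (1 / 2 : ℝ) • (centredChart x - centredChart x⁻¹)

@[simp] lemma chartParam_zero : chartParam E G 0 = 1 := by simp [chartParam]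

@[simp] lemma centredChart_one : centredChart (E := E) (1 : G) = 0 := by simp [centredChart]

@[simp] lemma oddChart_one : oddChart (E := E) (1 : G) = 0 := by simp [oddChart]

lemma oddChart_inv (x : G) : oddChart (E := E) x⁻¹ = -oddChart (E := E) x := by
  rw [oddChart, oddChart, inv_inv, ← smul_neg, neg_sub]

lemma tendsto_chartParam : Tendsto (chartParam E G) (𝓝 0) (𝓝 1) := by
  have h1 : Tendsto (fun u : E => extChartAt 𝓘(ℝ, E) (1 : G) 1 + u) (𝓝 0)
      (𝓝 (extChartAt 𝓘(ℝ, E) (1 : G) 1)) := by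
    have : Continuous fun u : E => extChartAt 𝓘(ℝ, E) (1 : G) 1 + u := by fun_prop
    simpa using this.tendsto 0
  have h2 := (continuousAt_extChartAt_symm (I := 𝓘(ℝ, E)) (1 : G)).tendsto.comp h1
  rwa [extChartAt_to_inv] at h2

lemma tendsto_centredChart : Tendsto (centredChart (E := E)) (𝓝 (1 : G)) (𝓝 0) := by
  have := (continuousAt_extChartAt (I := 𝓘(ℝ, E)) (1 : G)).tendsto.sub_const
    (extChartAt 𝓘(ℝ, E) (1 : G) 1)
  rwa [sub_self] at this

lemma eventually_chartParam_centredChart :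
    ∀ᶠ x in 𝓝 (1 : G), chartParam E G (centredChart x) = x := by
  filter_upwards [extChartAt_source_mem_nhds (I := 𝓘(ℝ, E)) (1 : G)] with x hx
  rw [chartParam, centredChart, add_sub_cancel]
  exact (extChartAt 𝓘(ℝ, E) (1 : G)).left_inv hx

lemma eventually_centredChart_chartParam :
    ∀ᶠ u in 𝓝 (0 : E), centredChart (chartParam E G u) = u := by
  have h1 : Tendsto (fun u : E => extChartAt 𝓘(ℝ, E) (1 : G) 1 + u) (𝓝 0)
      (𝓝 (extChartAt 𝓘(ℝ, E) (1 : G) 1)) := by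
    have : Continuous fun u : E => extChartAt 𝓘(ℝ, E) (1 : G) 1 + u := by fun_prop
    simpa using this.tendsto 0
  filter_upwards [h1 (extChartAt_target_mem_nhds (I := 𝓘(ℝ, E)) (1 : G))] with u hu
  rw [chartParam, centredChart, (extChartAt 𝓘(ℝ, E) (1 : G)).right_inv hu, add_sub_cancel_left]

lemma map_chartParam : map (chartParam E G) (𝓝 0) = 𝓝 (1 : G) := by
  refine le_antisymm tendsto_chartParam ?_
  have h : map (chartParam E G ∘ centredChart) (𝓝 (1 : G)) = 𝓝 (1 : G) := by
    rw [Filter.map_congr (m₁ := chartParam E G ∘ centredChart) (m₂ := id) eventually_chartParam_centredChart, map_id]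
  rw [← h, ← map_map]
  exact map_mono (tendsto_centredChart (E := E) (G := G))

lemma eventually_nhds_one_of_chartParam {p : G → Prop}
    (h : ∀ᶠ u in 𝓝 (0 : E), p (chartParam E G u)) : ∀ᶠ x in 𝓝 (1 : G), p x := by
  rw [← map_chartParam (E := E)]
  exact h

variable (E G) in
/-- The inversion of the group read in the centred chart. -/
def chartInv (u : E) : E := centredChart (chartParam E G u)⁻¹

lemma chartInv_zero : chartInv E G 0 = 0 := by simp [chartInv]

lemma contMDiffAt_centredChart :
    ContMDiffAt 𝓘(ℝ, E) 𝓘(ℝ, E) ∞ (centredChart (E := E)) (1 : G) :=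
  (contMDiffAt_extChartAt (I := 𝓘(ℝ, E)) (n := ∞) (x := (1 : G))).sub contMDiffAt_const

variable [LieGroup 𝓘(ℝ, E) ∞ G]

lemma contMDiffAt_chartParam : ContMDiffAt 𝓘(ℝ, E) 𝓘(ℝ, E) ∞ (chartParam E G) 0 := by
  have h1 : ContMDiffAt 𝓘(ℝ, E) 𝓘(ℝ, E) ∞
      (fun u : E => extChartAt 𝓘(ℝ, E) (1 : G) 1 + u) 0 := by
    rw [contMDiffAt_iff_contDiffAt]; fun_prop
  refine ContMDiffAt.comp (I' := 𝓘(ℝ, E)) (0 : E) ?_ h1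
  rw [add_zero]
  exact (contMDiffOn_extChartAt_symm (I := 𝓘(ℝ, E)) (n := ∞) (1 : G)).contMDiffAt
    (extChartAt_target_mem_nhds (1 : G))

lemma contMDiffAt_oddChart : ContMDiffAt 𝓘(ℝ, E) 𝓘(ℝ, E) ∞ (oddChart (E := E)) (1 : G) := by
  have h : ContMDiffAt 𝓘(ℝ, E) 𝓘(ℝ, E) ∞ (fun x : G => centredChart (E := E) x⁻¹) 1 := by
    have h1 : ContMDiffAt 𝓘(ℝ, E) 𝓘(ℝ, E) ∞ (centredChart (E := E)) (1 : G)⁻¹ := by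
      rw [inv_one]; exact contMDiffAt_centredChart
    exact h1.comp (1 : G) (contMDiff_inv 𝓘(ℝ, E) ∞ (G := G)).contMDiffAt
  exact ((contDiff_const_smul (1 / 2 : ℝ)).contMDiff (n := ∞)).contMDiffAt.comp (1 : G)
    (contMDiffAt_centredChart.sub h)

lemma hasMFDerivAt_chartParam :
    HasMFDerivAt 𝓘(ℝ, E) 𝓘(ℝ, E) (chartParam E G) 0 (ContinuousLinearMap.id ℝ E) := by
  obtain ⟨L, hL⟩ : ∃ L : E →L[ℝ] E, HasMFDerivAt 𝓘(ℝ, E) 𝓘(ℝ, E) (chartParam E G) 0 L :=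
    ⟨_, ((contMDiffAt_chartParam (E := E) (G := G)).mdifferentiableAt (by simp)).hasMFDerivAt⟩
  have h1 : HasMFDerivAt 𝓘(ℝ, E) 𝓘(ℝ, E) (extChartAt 𝓘(ℝ, E) (1 : G)) (chartParam E G 0)
      (ContinuousLinearMap.id ℝ E) := by
    have : IsManifold 𝓘(ℝ, E) 1 G := IsManifold.of_le (n := ∞) (by simp)
    rw [chartParam_zero]
    have h := (mdifferentiableAt_extChartAt (I := 𝓘(ℝ, E)) (mem_chart_source E (1 : G))).hasMFDerivAt
    rw [mfderiv_extChartAt_self] at h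
    exact h
  have h2 : HasFDerivAt (extChartAt 𝓘(ℝ, E) (1 : G) ∘ chartParam E G) L 0 :=
    (h1.comp (0 : E) hL).hasFDerivAt
  have h3 : HasFDerivAt (fun u : E => extChartAt 𝓘(ℝ, E) (1 : G) 1 + u)
      (ContinuousLinearMap.id ℝ E) 0 := (hasFDerivAt_id (𝕜 := ℝ) (0 : E)).const_add
        (extChartAt 𝓘(ℝ, E) (1 : G) 1 : E)
  have h4 : extChartAt 𝓘(ℝ, E) (1 : G) ∘ chartParam E G =ᶠ[𝓝 0]
      fun u : E => extChartAt 𝓘(ℝ, E) (1 : G) 1 + u := by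
    filter_upwards [eventually_centredChart_chartParam (E := E) (G := G)] with u hu
    rw [centredChart, sub_eq_iff_eq_add] at hu
    rw [Function.comp_apply, hu, add_comm]
  rwa [h2.unique (h3.congr_of_eventuallyEq h4)] at hL

/-- Functions on the group read in the centred chart. -/
lemma hasFDerivAt_comp_chartParam {F : Type*} [NormedAddCommGroup F] [NormedSpace ℝ F] {f : G → F}
    {f' : E →L[ℝ] F} (hf : HasMFDerivAt 𝓘(ℝ, E) 𝓘(ℝ, F) f 1 f') :
    HasFDerivAt (f ∘ chartParam E G) f' 0 := by
  have hf' : HasMFDerivAt 𝓘(ℝ, E) 𝓘(ℝ, F) f (chartParam E G 0) f' := by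
    rw [chartParam_zero]; exact hf
  exact (hf'.comp (0 : E) hasMFDerivAt_chartParam).hasFDerivAt

lemma contDiffAt_comp_chartParam {F : Type*} [NormedAddCommGroup F] [NormedSpace ℝ F] {f : G → F}
    (hf : ContMDiffAt 𝓘(ℝ, E) 𝓘(ℝ, F) ∞ f 1) : ContDiffAt ℝ ∞ (f ∘ chartParam E G) 0 := by
  rw [← contMDiffAt_iff_contDiffAt]
  refine ContMDiffAt.comp (I' := 𝓘(ℝ, E)) (0 : E) ?_ contMDiffAt_chartParam
  rwa [chartParam_zero]

lemma contDiffAt_chartInv : ContDiffAt ℝ ∞ (chartInv E G) 0 := by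
  have h1 : ContMDiffAt 𝓘(ℝ, E) 𝓘(ℝ, E) ∞ (centredChart (E := E)) (1 : G)⁻¹ := by
    rw [inv_one]; exact contMDiffAt_centredChart
  exact contDiffAt_comp_chartParam
    (h1.comp (1 : G) (contMDiff_inv 𝓘(ℝ, E) ∞ (G := G)).contMDiffAt)

lemma eventually_chartParam_chartInv :
    ∀ᶠ u in 𝓝 (0 : E), chartParam E G (chartInv E G u) = (chartParam E G u)⁻¹ := by
  have : IsTopologicalGroup G := topologicalGroup_of_lieGroup 𝓘(ℝ, E) ∞
  have h : Tendsto (fun u => (chartParam E G u)⁻¹) (𝓝 0) (𝓝 1) := by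
    simpa using (tendsto_chartParam (E := E) (G := G)).inv
  exact h.eventually eventually_chartParam_centredChart

/-- The product has differential `(v, w) ↦ v + w` at the identity, as one sees by fixing either
factor; differentiating `u · u⁻¹ = 1` then gives the result. -/
lemma fderiv_chartInv : fderiv ℝ (chartInv E G) 0 = -ContinuousLinearMap.id ℝ E := by
  have : IsTopologicalGroup G := topologicalGroup_of_lieGroup 𝓘(ℝ, E) ∞
  let m : E × E → E := fun w => centredChart (chartParam E G w.1 * chartParam E G w.2)
  have hm : ContDiffAt ℝ ∞ m (0, 0) := by
    rw [← contMDiffAt_iff_contDiffAt]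
    have h1 : ContMDiffAt 𝓘(ℝ, E × E) 𝓘(ℝ, E) ∞ (fun w : E × E => chartParam E G w.1) (0, 0) :=
      ContMDiffAt.comp (I' := 𝓘(ℝ, E)) ((0, 0) : E × E) (g := chartParam E G)
        contMDiffAt_chartParam (contMDiffAt_iff_contDiffAt.2 contDiffAt_fst)
    have h2 : ContMDiffAt 𝓘(ℝ, E × E) 𝓘(ℝ, E) ∞ (fun w : E × E => chartParam E G w.2) (0, 0) :=
      ContMDiffAt.comp (I' := 𝓘(ℝ, E)) ((0, 0) : E × E) (g := chartParam E G)
        contMDiffAt_chartParam (contMDiffAt_iff_contDiffAt.2 contDiffAt_snd)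
    refine ContMDiffAt.comp (I' := 𝓘(ℝ, E)) ((0, 0) : E × E) (g := centredChart) ?_ (h1.mul h2)
    simpa using contMDiffAt_centredChart
  have hmd : HasFDerivAt m (fderiv ℝ m (0, 0)) (0, 0) :=
    (hm.differentiableAt (by simp)).hasFDerivAt
  have hid : ∀ᶠ u in 𝓝 (0 : E), m (u, 0) = u ∧ m (0, u) = u := by
    filter_upwards [eventually_centredChart_chartParam (E := E) (G := G)] with u hu
    simp [m, hu]
  have hl : ∀ v, fderiv ℝ m (0, 0) (v, 0) = v := by
    intro v
    have h1 : HasFDerivAt (fun u : E => m (u, 0))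
        ((fderiv ℝ m (0, 0)).comp (ContinuousLinearMap.inl ℝ E E)) 0 :=
      HasFDerivAt.comp (0 : E) (f := fun u : E => (u, (0 : E))) hmd
        ((hasFDerivAt_id (0 : E)).prodMk (hasFDerivAt_const (0 : E) (0 : E)))
    have h2 : HasFDerivAt (fun u : E => m (u, 0)) (ContinuousLinearMap.id ℝ E) 0 :=
      (hasFDerivAt_id (0 : E)).congr_of_eventuallyEq (hid.mono fun u hu => hu.1)
    simpa using congrArg (fun T => T v) (h1.unique h2)
  have hr : ∀ v, fderiv ℝ m (0, 0) (0, v) = v := by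
    intro v
    have h1 : HasFDerivAt (fun u : E => m (0, u))
        ((fderiv ℝ m (0, 0)).comp (ContinuousLinearMap.inr ℝ E E)) 0 :=
      HasFDerivAt.comp (0 : E) (f := fun u : E => ((0 : E), u)) hmd
        ((hasFDerivAt_const (0 : E) (0 : E)).prodMk (hasFDerivAt_id (0 : E)))
    have h2 : HasFDerivAt (fun u : E => m (0, u)) (ContinuousLinearMap.id ℝ E) 0 :=
      (hasFDerivAt_id (0 : E)).congr_of_eventuallyEq (hid.mono fun u hu => hu.2)
    simpa using congrArg (fun T => T v) (h1.unique h2)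
  have hι : HasFDerivAt (chartInv E G) (fderiv ℝ (chartInv E G) 0) 0 :=
    (contDiffAt_chartInv.differentiableAt (by simp)).hasFDerivAt
  have hmι : HasFDerivAt (fun u : E => m (u, chartInv E G u))
      ((fderiv ℝ m (0, 0)).comp
        ((ContinuousLinearMap.id ℝ E).prod (fderiv ℝ (chartInv E G) 0))) 0 := by
    have hmd' : HasFDerivAt m (fderiv ℝ m (0, 0)) ((0 : E), chartInv E G 0) := by
      rwa [chartInv_zero]
    exact HasFDerivAt.comp (0 : E) (f := fun u : E => (u, chartInv E G u)) hmd'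
      ((hasFDerivAt_id (0 : E)).prodMk hι)
  have hzero : HasFDerivAt (fun u : E => m (u, chartInv E G u)) (0 : E →L[ℝ] E) 0 := by
    refine (hasFDerivAt_const (0 : E) (0 : E)).congr_of_eventuallyEq ?_
    filter_upwards [eventually_chartParam_chartInv (E := E) (G := G)] with u hu
    simp [m, hu]
  ext v
  have h3 := congrArg (fun T => T v) (hmι.unique hzero)
  have h4 : fderiv ℝ m (0, 0) (v, fderiv ℝ (chartInv E G) 0 v) = 0 := by simpa using h3
  have h5 : (v, fderiv ℝ (chartInv E G) 0 v) = (v, 0) + (0, fderiv ℝ (chartInv E G) 0 v) := by simp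
  rw [h5, map_add, hl, hr] at h4
  simpa using (neg_eq_of_add_eq_zero_right h4).symm

lemma hasFDerivAt_oddChart_comp :
    HasFDerivAt (oddChart ∘ chartParam E G) (ContinuousLinearMap.id ℝ E) 0 := by
  have h1 : HasFDerivAt (centredChart ∘ chartParam E G) (ContinuousLinearMap.id ℝ E) 0 :=
    (hasFDerivAt_id (0 : E)).congr_of_eventuallyEq eventually_centredChart_chartParam
  have h2 : HasFDerivAt (chartInv E G) (-ContinuousLinearMap.id ℝ E) 0 :=
    fderiv_chartInv (E := E) (G := G) ▸
      (contDiffAt_chartInv.differentiableAt (by simp)).hasFDerivAt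
  have h3 := (h1.sub h2).const_smul (1 / 2 : ℝ)
  have h4 : (1 / 2 : ℝ) • (ContinuousLinearMap.id ℝ E - -ContinuousLinearMap.id ℝ E) =
      ContinuousLinearMap.id ℝ E := by
    rw [sub_neg_eq_add, ← two_smul ℝ, smul_smul]; norm_num
  rwa [h4] at h3

lemma hasMFDerivAt_oddChart :
    HasMFDerivAt 𝓘(ℝ, E) 𝓘(ℝ, E) (oddChart (E := E)) (1 : G) (ContinuousLinearMap.id ℝ E) := by
  have h1 : HasMFDerivAt 𝓘(ℝ, E) 𝓘(ℝ, E) (oddChart (E := E)) (1 : G)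
      (mfderiv 𝓘(ℝ, E) 𝓘(ℝ, E) (oddChart (E := E)) (1 : G)) :=
    (contMDiffAt_oddChart.mdifferentiableAt (by simp)).hasMFDerivAt
  have h2 := (hasFDerivAt_comp_chartParam h1).unique hasFDerivAt_oddChart_comp
  rwa [h2] at h1

/-- Near the identity, the odd chart controls the chart. -/
lemma eventually_norm_le_oddChart :
    ∀ᶠ u in 𝓝 (0 : E), ‖u‖ ≤ 2 * ‖oddChart (E := E) (chartParam E G u)‖ := by
  have h := (hasFDerivAt_oddChart_comp (E := E) (G := G)).isLittleO
  filter_upwards [h.bound (show (0 : ℝ) < 1 / 2 by norm_num)] with u hu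
  simp only [Function.comp_apply, chartParam_zero, oddChart_one, sub_zero,
    ContinuousLinearMap.id_apply] at hu
  have := norm_le_norm_add_norm_sub' u (oddChart (E := E) (chartParam E G u))
  rw [norm_sub_rev] at this
  linarith

/-- In the odd chart, a smooth endomorphism is linear up to third order. -/
theorem oddChart_hom_cubic (φ : G →* G) (hφ : ContMDiff 𝓘(ℝ, E) 𝓘(ℝ, E) ∞ φ) (D : E →L[ℝ] E)
    (hD : ∀ X : E, (mfderiv 𝓘(ℝ, E) 𝓘(ℝ, E) φ (1 : G) X : E) = D X) :
    ∃ K, 0 ≤ K ∧ ∀ᶠ x in 𝓝 (1 : G),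
      ‖oddChart (E := E) (φ x) - D (oddChart x)‖ ≤ K * ‖oddChart (E := E) x‖ ^ 3 := by
  let R₀ : G → E := fun x => oddChart (φ x) - D (oddChart x)
  have hφ1 : HasMFDerivAt 𝓘(ℝ, E) 𝓘(ℝ, E) φ (1 : G) D := by
    have h := (hφ.mdifferentiable (by simp) (1 : G)).hasMFDerivAt
    have : mfderiv 𝓘(ℝ, E) 𝓘(ℝ, E) φ (1 : G) = D := by ext X; exact hD X
    rwa [this] at h
  have hodd : HasMFDerivAt 𝓘(ℝ, E) 𝓘(ℝ, E) (oddChart (E := E)) (φ 1)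
      (ContinuousLinearMap.id ℝ E) := by
    rw [map_one]; exact hasMFDerivAt_oddChart
  have h1 : HasFDerivAt (fun u => oddChart (E := E) (φ (chartParam E G u))) D 0 :=
    hasFDerivAt_comp_chartParam (hodd.comp (1 : G) hφ1)
  have h2 : HasFDerivAt (fun u => D (oddChart (E := E) (chartParam E G u))) D 0 :=
    D.hasFDerivAt.comp (0 : E) hasFDerivAt_oddChart_comp
  have hc1 : ContDiffAt ℝ ∞ (fun u => oddChart (E := E) (φ (chartParam E G u))) 0 := by
    have h3 : ContMDiffAt 𝓘(ℝ, E) 𝓘(ℝ, E) ∞ (oddChart (E := E)) (φ 1) := by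
      rw [map_one]; exact contMDiffAt_oddChart
    exact contDiffAt_comp_chartParam (h3.comp (1 : G) hφ.contMDiffAt)
  have hc2 : ContDiffAt ℝ ∞ (fun u => D (oddChart (E := E) (chartParam E G u))) 0 :=
    D.contDiff.contDiffAt.comp (0 : E) (contDiffAt_comp_chartParam contMDiffAt_oddChart)
  -- The remainder is odd because `φ`, `D` and the chart all respect inversion, and its differential
  -- vanishes because the odd chart has differential the identity.
  have hcube := isBigO_cube_of_odd (R := R₀ ∘ chartParam E G) (ι := chartInv E G)
    (contDiffAt_infty.1 (hc1.sub hc2) 3)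
    (contDiffAt_infty.1 contDiffAt_chartInv 2)
    chartInv_zero fderiv_chartInv ?_ (by simp [R₀]) ?_
  · obtain ⟨K, hK0, hK⟩ := hcube.exists_nonneg
    refine ⟨K * 8, by positivity, eventually_nhds_one_of_chartParam (E := E) ?_⟩
    filter_upwards [hK.bound, eventually_norm_le_oddChart (E := E) (G := G)] with u hu hu'
    refine hu.trans ?_
    rw [Real.norm_of_nonneg (by positivity), mul_assoc]
    gcongr
    calc ‖u‖ ^ 3 ≤ (2 * ‖oddChart (E := E) (chartParam E G u)‖) ^ 3 := by gcongr
      _ = _ := by ring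
  · filter_upwards [eventually_chartParam_chartInv (E := E) (G := G)] with u hu
    simp only [Function.comp_apply, hu, R₀, map_inv, oddChart_inv, map_neg]
    abel
  · have := (h1.sub h2).fderiv
    rwa [sub_self] at this

/-- A smooth endomorphism with invertible differential is open at the identity. -/
theorem nhds_one_le_map [CompleteSpace E] (φ : G →* G) (hφ : ContMDiff 𝓘(ℝ, E) 𝓘(ℝ, E) ∞ φ)
    (hsurj : Function.Surjective fun X : E => (mfderiv 𝓘(ℝ, E) 𝓘(ℝ, E) φ (1 : G) X : E)) :
    𝓝 1 ≤ map φ (𝓝 1) := by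
  have h3 : ContMDiffAt 𝓘(ℝ, E) 𝓘(ℝ, E) ∞ (centredChart (E := E)) (φ 1) := by
    rw [map_one]; exact contMDiffAt_centredChart
  have hc1 : ContDiffAt ℝ ∞ ((centredChart (E := E) ∘ φ) ∘ chartParam E G) 0 :=
    contDiffAt_comp_chartParam (h3.comp (1 : G) hφ.contMDiffAt)
  have hch : HasMFDerivAt 𝓘(ℝ, E) 𝓘(ℝ, E) (centredChart (E := E)) (φ 1)
      (ContinuousLinearMap.id ℝ E) := by
    have h1 : HasMFDerivAt 𝓘(ℝ, E) 𝓘(ℝ, E) (centredChart (E := E)) (1 : G)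
        (mfderiv 𝓘(ℝ, E) 𝓘(ℝ, E) (centredChart (E := E)) (1 : G)) :=
      (contMDiffAt_centredChart.mdifferentiableAt (by simp)).hasMFDerivAt
    have h2 := (hasFDerivAt_comp_chartParam h1).unique
      ((hasFDerivAt_id (0 : E)).congr_of_eventuallyEq eventually_centredChart_chartParam)
    rw [h2] at h1
    rw [map_one]
    exact h1
  have hφ1 := (hφ.mdifferentiable (by simp) (1 : G)).hasMFDerivAt
  have hd := hasFDerivAt_comp_chartParam (hch.comp (1 : G) hφ1)
  have hs := hc1.hasStrictFDerivAt' hd (by simp)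
  -- Surjectivity of the strict derivative gives openness at the identity.
  have hmap := hs.map_nhds_eq_of_surj (LinearMap.range_eq_top.2 hsurj)
  have h0 : ((centredChart (E := E) ∘ φ) ∘ chartParam E G) 0 = 0 := by simp
  rw [h0] at hmap
  have hev : chartParam E G ∘ ((centredChart (E := E) ∘ φ) ∘ chartParam E G) =ᶠ[𝓝 0]
      φ ∘ chartParam E G := by
    have ht : Tendsto (φ ∘ chartParam E G) (𝓝 0) (𝓝 1) := by
      have := (hφ.continuous.tendsto 1).comp (tendsto_chartParam (E := E) (G := G))
      rwa [map_one] at this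
    exact ht.eventually eventually_chartParam_centredChart
  rw [← map_chartParam (E := E), map_map, ← Filter.map_congr hev, ← map_map, hmap]

end OddCoordinates

/-! ### The ball-box estimate -/

section BallBox

variable {E : Type*} [NormedAddCommGroup E] [NormedSpace ℝ E]
  {G : Type*} [TopologicalSpace G] [ChartedSpace E G] [Group G]

/-- The target of the chart is a neighbourhood in `E` with only one point, which is impossible in a
nontrivial normed space. -/
lemma subsingleton_of_subsingleton_group [Subsingleton G] : Subsingleton E := by
  by_contra hE
  rw [not_subsingleton_iff_nontrivial] at hE
  have h1 : {extChartAt 𝓘(ℝ, E) (1 : G) 1} ∈ 𝓝 (extChartAt 𝓘(ℝ, E) (1 : G) 1) := by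
    filter_upwards [extChartAt_target_mem_nhds (I := 𝓘(ℝ, E)) (1 : G)] with u hu
    rw [mem_singleton_iff, ← (extChartAt 𝓘(ℝ, E) (1 : G)).right_inv hu]
    congr 1
    exact Subsingleton.elim _ _
  have h2 := Module.punctured_nhds_neBot ℝ E (extChartAt 𝓘(ℝ, E) (1 : G) 1)
  rw [← mem_interior_iff_mem_nhds, interior_singleton] at h1
  exact h1

variable {V₁ V₂ : Submodule ℝ (GroupLieAlgebra 𝓘(ℝ, E) G)} {ρ : G → G → ℝ}

lemma IsHomogeneousDist.nonneg (hρ : IsHomogeneousDist V₁ V₂ ρ) (x y : G) : 0 ≤ ρ x y := by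
  have h1 := hρ.triangle x y x
  rw [(hρ.eq_zero_iff x x).2 rfl, hρ.symm y x] at h1
  linarith

/-- The existence of a homogeneous distance implies the existence of the dilations. -/
lemma IsHomogeneousDist.isDilation_dilation (hρ : IsHomogeneousDist V₁ V₂ ρ) {r : ℝ} (hr : 0 < r) :
    IsDilation V₁ V₂ r (BlowUp.dilation V₁ V₂ r) := by
  by_cases h : ∃ φ : G →* G, IsDilation V₁ V₂ r φ
  · rw [BlowUp.dilation, dif_pos h]
    exact h.choose_spec
  -- If no dilation exists, `dilation` takes its default value, the trivial homomorphism.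
  -- Homogeneity then gives `r * ρ x y = 0`, so the group is a point; but there the trivial
  -- homomorphism is a dilation.
  · have hsub : Subsingleton G := by
      refine ⟨fun x y => ?_⟩
      have h1 := hρ.dilation r hr x y
      rw [BlowUp.dilation, dif_neg h, MonoidHom.one_apply, MonoidHom.one_apply,
        (hρ.eq_zero_iff 1 1).2 rfl] at h1
      exact (hρ.eq_zero_iff x y).1 (by nlinarith)
    have hE : Subsingleton E := subsingleton_of_subsingleton_group (G := G)
    refine absurd ⟨1, contMDiff_const, fun X _ => hE.elim _ _, fun X _ => hE.elim _ _⟩ h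

variable (V₁ V₂) in
/-- A pair of projections associated with a decomposition of the Lie algebra. -/
structure LayerProjections (π₁ π₂ : E →L[ℝ] E) : Prop where
  mem_left : ∀ X : E, (π₁ X : E) ∈ V₁
  mem_right : ∀ X : E, (π₂ X : E) ∈ V₂
  add_eq : ∀ X : E, π₁ X + π₂ X = X
  left_eq_zero : ∀ X : E, π₁ X = 0 ↔ X ∈ V₂
  right_eq_zero : ∀ X : E, π₂ X = 0 ↔ X ∈ V₁

lemma exists_layerProjections [FiniteDimensional ℝ E] (hV : IsCompl V₁ V₂) :
    ∃ π₁ π₂ : E →L[ℝ] E, LayerProjections V₁ V₂ π₁ π₂ := by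
  let V₁' : Submodule ℝ E := V₁
  let V₂' : Submodule ℝ E := V₂
  have hV' : IsCompl V₁' V₂' := hV
  refine ⟨LinearMap.toContinuousLinearMap (V₁'.projection V₂' hV'),
    LinearMap.toContinuousLinearMap (V₂'.projection V₁' hV'.symm), ?_, ?_, ?_, ?_, ?_⟩
  · exact fun X => Submodule.projection_apply_mem hV' X
  · exact fun X => Submodule.projection_apply_mem hV'.symm X
  · exact fun X => Submodule.projection_add_projection_eq_self hV' X
  · exact fun X => Submodule.projection_apply_eq_zero_iff hV'
  · exact fun X => Submodule.projection_apply_eq_zero_iff hV'.symm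

namespace LayerProjections

variable {π₁ π₂ : E →L[ℝ] E}

lemma right_left (h : LayerProjections V₁ V₂ π₁ π₂) (X : E) : π₂ (π₁ X) = 0 :=
  (h.right_eq_zero _).2 (h.mem_left X)

lemma left_right (h : LayerProjections V₁ V₂ π₁ π₂) (X : E) : π₁ (π₂ X) = 0 :=
  (h.left_eq_zero _).2 (h.mem_right X)

lemma left_left (h : LayerProjections V₁ V₂ π₁ π₂) (X : E) : π₁ (π₁ X) = π₁ X := by
  have := h.add_eq (π₁ X)
  rwa [h.right_left, add_zero] at this

lemma right_right (h : LayerProjections V₁ V₂ π₁ π₂) (X : E) : π₂ (π₂ X) = π₂ X := by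
  have := h.add_eq (π₂ X)
  rwa [h.left_right, zero_add] at this

lemma norm_le (h : LayerProjections V₁ V₂ π₁ π₂) (X : E) : ‖X‖ ≤ ‖π₁ X‖ + ‖π₂ X‖ := by
  conv_lhs => rw [← h.add_eq X]
  exact norm_add_le _ _

lemma mfderiv_dilation (h : LayerProjections V₁ V₂ π₁ π₂) {r : ℝ} {φ : G →* G}
    (hφ : IsDilation V₁ V₂ r φ) (X : E) :
    (mfderiv 𝓘(ℝ, E) 𝓘(ℝ, E) φ (1 : G) X : E) = (r • π₁ + r ^ 2 • π₂) X := by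
  obtain ⟨L, hL⟩ : ∃ L : E →L[ℝ] E, ∀ X : E, (mfderiv 𝓘(ℝ, E) 𝓘(ℝ, E) φ (1 : G) X : E) = L X :=
    ⟨mfderiv 𝓘(ℝ, E) 𝓘(ℝ, E) φ (1 : G), fun X => rfl⟩
  have h1 : L (π₁ X) = r • π₁ X := (hL _).symm.trans (hφ.2.1 _ (h.mem_left X))
  have h2 : L (π₂ X) = r ^ 2 • π₂ X := (hL _).symm.trans (hφ.2.2 _ (h.mem_right X))
  rw [hL]
  conv_lhs => rw [← h.add_eq X, map_add, h1, h2]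
  rfl

variable [LieGroup 𝓘(ℝ, E) ∞ G]

/-- The layers of the linear part decouple, so the cubic error of `oddChart_hom_cubic` is simply
projected. The form is the one that `box_subset_ball` and `iterate_contracting` require, for `r = 2`
and `r = 1 / 2`. -/
lemma dilation_cubic (h : LayerProjections V₁ V₂ π₁ π₂) {r : ℝ} {φ : G →* G} (hr : 0 < r)
    (hφ : IsDilation V₁ V₂ r φ) :
    ∃ K, 0 ≤ K ∧ ∀ᶠ x in 𝓝 (1 : G),
      ‖π₁ (oddChart (φ x))‖ ≤ r * ‖π₁ (oddChart x)‖ +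
        K * (‖π₁ (oddChart x)‖ + ‖π₂ (oddChart x)‖) ^ 3 ∧
      ‖π₂ (oddChart (φ x))‖ ≤ r ^ 2 * ‖π₂ (oddChart x)‖ +
        K * (‖π₁ (oddChart x)‖ + ‖π₂ (oddChart x)‖) ^ 3 := by
  obtain ⟨K, hK, hev⟩ := oddChart_hom_cubic φ hφ.1 _ (h.mfderiv_dilation hφ)
  refine ⟨(‖π₁‖ + ‖π₂‖) * K, by positivity, ?_⟩
  filter_upwards [hev] with x hx
  set u : E := oddChart x
  set v : E := oddChart (φ x)
  set w : E := v - (r • π₁ + r ^ 2 • π₂) u with hw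
  have hw' : ‖w‖ ≤ K * (‖π₁ u‖ + ‖π₂ u‖) ^ 3 := by
    refine hx.trans ?_
    gcongr
    exact h.norm_le u
  have hv : v = (r • π₁ u + r ^ 2 • π₂ u) + w := by
    rw [hw]; simp
  have h1 : π₁ v = r • π₁ u + π₁ w := by
    rw [hv, map_add, map_add, map_smul, map_smul, h.left_left, h.left_right, smul_zero, add_zero]
  have h2 : π₂ v = r ^ 2 • π₂ u + π₂ w := by
    rw [hv, map_add, map_add, map_smul, map_smul, h.right_left, h.right_right, smul_zero, zero_add]
  constructor
  · rw [h1]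
    refine (norm_add_le _ _).trans ?_
    rw [norm_smul, Real.norm_of_nonneg hr.le, mul_assoc]
    gcongr
    calc ‖π₁ w‖ ≤ ‖π₁‖ * ‖w‖ := π₁.le_opNorm w
      _ ≤ _ := by
        gcongr
        linarith [norm_nonneg π₂]
  · rw [h2]
    refine (norm_add_le _ _).trans ?_
    rw [norm_smul, Real.norm_of_nonneg (by positivity), mul_assoc]
    gcongr
    calc ‖π₂ w‖ ≤ ‖π₂‖ * ‖w‖ := π₂.le_opNorm w
      _ ≤ _ := by
        gcongr
        linarith [norm_nonneg π₁]

lemma layerNorms (h : LayerProjections V₁ V₂ π₁ π₂) {N : Set G} (hN : N ∈ 𝓝 1)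
    (hN' : ∀ x ∈ N, chartParam E G (centredChart x) = x ∧
      ‖centredChart (E := E) x‖ ≤ 2 * ‖oddChart (E := E) x‖) :
    LayerNorms N (fun x => ‖π₁ (oddChart x)‖) (fun x => ‖π₂ (oddChart x)‖) where
  mem_nhds := hN
  nonneg_left _ := norm_nonneg _
  nonneg_right _ := norm_nonneg _
  tendsto_left := by
    have h1 := (contMDiffAt_oddChart (E := E) (G := G)).continuousAt.tendsto
    have h2 := ((π₁.continuous.norm).tendsto (oddChart (1 : G))).comp h1
    simpa using! h2
  tendsto_right := by
    have h1 := (contMDiffAt_oddChart (E := E) (G := G)).continuousAt.tendsto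
    have h2 := ((π₂.continuous.norm).tendsto (oddChart (1 : G))).comp h1
    simpa using! h2
  basis O hO := by
    obtain ⟨ε, hε, hball⟩ := Metric.mem_nhds_iff.1 (tendsto_chartParam (E := E) hO)
    refine ⟨ε / 4, by positivity, fun x hx ha hb => ?_⟩
    rw [← (hN' x hx).1]
    refine hball ?_
    rw [mem_ball_zero_iff]
    have := (hN' x hx).2
    have := h.norm_le (oddChart x)
    linarith

/-- In the odd chart, balls of a homogeneous distance are comparable to boxes. -/
theorem ball_box [FiniteDimensional ℝ E] [ConnectedSpace G] (h : LayerProjections V₁ V₂ π₁ π₂)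
    (hρ : IsHomogeneousDist V₁ V₂ ρ) :
    (∀ O ∈ 𝓝 (1 : G), ∃ η > 0, ∀ x, ρ 1 x < η → x ∈ O) ∧
    (∃ C > 0, ∃ r₀ > 0, ∀ x r, r < r₀ → ρ 1 x < r →
      ‖π₁ (oddChart x)‖ ≤ C * r ∧ ‖π₂ (oddChart x)‖ ≤ C * r ^ 2) ∧
    (∃ c > 0, ∀ᶠ x in 𝓝 (1 : G), ∀ r : ℝ, 0 < r → r ≤ 1 →
      ‖π₁ (oddChart x)‖ ≤ c * r → ‖π₂ (oddChart x)‖ ≤ c * r ^ 2 → ρ 1 x < r) := by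
  have : IsTopologicalGroup G := topologicalGroup_of_lieGroup 𝓘(ℝ, E) ∞
  have : LocallyCompactSpace G := Manifold.locallyCompact_of_finiteDimensional 𝓘(ℝ, E)
  have hρc : Continuous (ρ 1) := hρ.continuous.comp (f := fun x : G => ((1 : G), x)) (by fun_prop)
  have hψ := hρ.isDilation_dilation (r := 2) (by norm_num)
  have hφ := hρ.isDilation_dilation (r := 1 / 2) (by norm_num)
  have hψρ := hρ.dilation 2 (by norm_num)
  have hφρ := hρ.dilation (1 / 2) (by norm_num)
  set ψ := BlowUp.dilation V₁ V₂ 2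
  set φ := BlowUp.dilation V₁ V₂ (1 / 2)
  obtain ⟨K₁, hK₁, hev₁⟩ := h.dilation_cubic (by norm_num) hψ
  obtain ⟨K₂, hK₂, hev₂⟩ := h.dilation_cubic (by norm_num) hφ
  have hev₃ : ∀ᶠ x in 𝓝 (1 : G), ‖centredChart (E := E) x‖ ≤ 2 * ‖oddChart (E := E) x‖ := by
    refine eventually_nhds_one_of_chartParam (E := E) ?_
    filter_upwards [eventually_centredChart_chartParam (E := E) (G := G),
      eventually_norm_le_oddChart (E := E) (G := G)] with u hu hu'
    rwa [hu]
  obtain ⟨N, hN, hall⟩ := ((hev₁.and hev₂).and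
    ((eventually_chartParam_centredChart (E := E) (G := G)).and hev₃)).exists_mem
  have hL := h.layerNorms hN fun x hx => (hall x hx).2
  have hψt : Tendsto ψ (𝓝 1) (𝓝 1) := by
    have := hψ.1.continuous.tendsto 1
    rwa [map_one] at this
  have hφt : Tendsto φ (𝓝 1) (𝓝 1) := by
    have := hφ.1.continuous.tendsto 1
    rwa [map_one] at this
  obtain ⟨c, hc, hbox⟩ := box_subset_ball hL hρc ((hρ.eq_zero_iff 1 1).2 rfl) ψ hψt hψρ hK₁
    (fun x hx => (hall x hx).1.1.1) (fun x hx => by have := (hall x hx).1.1.2; norm_num at this; exact this)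
  obtain ⟨ε, hε, hiter⟩ := iterate_contracting hL φ hφt hK₂
    (fun x hx => by have := (hall x hx).1.2.1; rwa [one_div_mul_eq_div] at this)
    (fun x hx => by
      have := (hall x hx).1.2.2
      rw [show ((1 : ℝ) / 2) ^ 2 * _ = _ / 4 by ring] at this
      exact this)
  have hφo : 𝓝 1 ≤ map φ (𝓝 1) := by
    have e1 : ∀ X : E, π₁ ((2 : ℝ) • π₁ X + (4 : ℝ) • π₂ X) = (2 : ℝ) • π₁ X := fun X => by
      rw [map_add, map_smul, map_smul, h.left_left, h.left_right, smul_zero, add_zero]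
    have e2 : ∀ X : E, π₂ ((2 : ℝ) • π₁ X + (4 : ℝ) • π₂ X) = (4 : ℝ) • π₂ X := fun X => by
      rw [map_add, map_smul, map_smul, h.right_left, h.right_right, smul_zero, zero_add]
    have e3 : ∀ X : E, (1 / 2 : ℝ) • π₁ ((2 : ℝ) • π₁ X + (4 : ℝ) • π₂ X) +
        (1 / 2 : ℝ) ^ 2 • π₂ ((2 : ℝ) • π₁ X + (4 : ℝ) • π₂ X) = X := fun X => by
      rw [e1, e2, smul_smul, smul_smul]
      norm_num
      exact h.add_eq X
    -- The preimage of `X` under the differential of the dilation by `1 / 2` is its image under the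
    -- dilation by 2.
    refine nhds_one_le_map φ hφ.1 fun X => ⟨(2 : ℝ) • π₁ X + (4 : ℝ) • π₂ X, ?_⟩
    exact (h.mfderiv_dilation hφ _).trans (e3 X)
  have hA : N ∩ {x | ‖π₁ (oddChart x)‖ ≤ ε} ∩ {x | ‖π₂ (oddChart x)‖ ≤ ε} ∈ 𝓝 (1 : G) :=
    inter_mem (inter_mem hN (hL.tendsto_left (Iic_mem_nhds hε)))
      (hL.tendsto_right (Iic_mem_nhds hε))
  have hlim : ∀ x, Tendsto (fun j => φ^[j] x) atTop (𝓝 1) := by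
    refine tendsto_iterate_one φ hA fun x hx => ?_
    have ht : Tendsto (fun j : ℕ => 2 * ε * (1 / 2 : ℝ) ^ j) atTop (𝓝 0) := by
      have := (tendsto_pow_atTop_nhds_zero_of_lt_one (by norm_num : (0 : ℝ) ≤ 1 / 2)
        (by norm_num)).const_mul (2 * ε)
      rwa [mul_zero] at this
    intro O hO
    obtain ⟨ε', hε', hO'⟩ := hL.basis O hO
    change ∀ᶠ j in atTop, φ^[j] x ∈ O
    filter_upwards [ht.eventually (Iio_mem_nhds hε')] with j hj
    obtain ⟨h1, h2, h3⟩ := hiter x hx.1.1 hx.1.2 hx.2 j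
    refine hO' _ h1 (h2.trans_lt hj) (h3.trans_lt (lt_of_le_of_lt ?_ hj))
    have h4 : (1 / 2 : ℝ) ^ j ≤ 1 := pow_le_one₀ (by norm_num) (by norm_num)
    have h5 : (0 : ℝ) ≤ (1 / 2) ^ j := by positivity
    gcongr
    nlinarith
  have hsmall : ∀ O ∈ 𝓝 (1 : G), ∃ η > 0, ∀ x, ρ 1 x < η → x ∈ O := fun O hO =>
    ball_subset_nhds hρc hρ.nonneg hρ.eq_zero_iff φ hφo hφρ hlim hO
  obtain ⟨C, hC, r₀, hr₀, hball⟩ := ball_subset_box hL hρ.nonneg φ hφo hφρ hsmall hε hiter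
  refine ⟨hsmall, ⟨C, hC, r₀, hr₀, fun x r hr hx => (hball x r hr hx).2⟩, c, hc, ?_⟩
  filter_upwards [hN] with x hx using hbox x hx

end LayerProjections

end BallBox

/-! ### Submanifolds as graphs -/

section LocalGraph

variable {E : Type*} [NormedAddCommGroup E] [NormedSpace ℝ E]

/-- A description of the zero set of `f` in `V` as the graph of `Γ` over the open set `T`, with
respect to the linear projection `P`. The map `J a` parametrizes the kernel of the differential
of `f` at `a`. -/
structure IsLocalGraph {k p : ℕ} (f : E → EuclideanSpace ℝ (Fin k))
    (P : E →L[ℝ] EuclideanSpace ℝ (Fin p)) (V : Set E) (T : Set (EuclideanSpace ℝ (Fin p)))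
    (Γ : EuclideanSpace ℝ (Fin p) → E) (J : E → EuclideanSpace ℝ (Fin p) →L[ℝ] E) (C : ℝ) :
    Prop where
  isOpen_source : IsOpen V
  isOpen_target : IsOpen T
  differentiableAt : ∀ a ∈ V, DifferentiableAt ℝ f a
  mem_source : ∀ ξ ∈ T, Γ ξ ∈ V
  zero : ∀ ξ ∈ T, f (Γ ξ) = 0
  proj_graph : ∀ ξ ∈ T, P (Γ ξ) = ξ
  mem_target : ∀ a ∈ V, f a = 0 → P a ∈ T
  graph_proj : ∀ a ∈ V, f a = 0 → Γ (P a) = a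
  contDiffOn : ContDiffOn ℝ 1 Γ T
  hasFDerivAt : ∀ ξ ∈ T, HasFDerivAt Γ (J (Γ ξ)) ξ
  proj_deriv : ∀ a ∈ V, ∀ v, P (J a v) = v
  mem_ker_iff : ∀ a ∈ V, ∀ w, fderiv ℝ f a w = 0 ↔ J a (P w) = w
  norm_le : ∀ a ∈ V, ‖J a‖ ≤ C
  quadratic : ∀ a ∈ V, ∀ b ∈ V, f a = 0 → f b = 0 →
    ‖b - a - J a (P b - P a)‖ ≤ C * ‖b - a‖ ^ 2

/-- Used to pass to a small ball in which all the local estimates hold at once. -/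
lemma IsLocalGraph.mono {k p : ℕ} {f : E → EuclideanSpace ℝ (Fin k)}
    {P : E →L[ℝ] EuclideanSpace ℝ (Fin p)} {V V' : Set E} {T : Set (EuclideanSpace ℝ (Fin p))}
    {Γ : EuclideanSpace ℝ (Fin p) → E} {J : E → EuclideanSpace ℝ (Fin p) →L[ℝ] E} {C : ℝ}
    (h : IsLocalGraph f P V T Γ J C) (hV' : IsOpen V') (hsub : V' ⊆ V) :
    IsLocalGraph f P V' (T ∩ Γ ⁻¹' V') Γ J C where
  isOpen_source := hV'
  isOpen_target := h.contDiffOn.continuousOn.isOpen_inter_preimage h.isOpen_target hV'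
  differentiableAt a ha := h.differentiableAt a (hsub ha)
  mem_source ξ hξ := hξ.2
  zero ξ hξ := h.zero ξ hξ.1
  proj_graph ξ hξ := h.proj_graph ξ hξ.1
  mem_target a ha ha0 := ⟨h.mem_target a (hsub ha) ha0, by
    rw [mem_preimage, h.graph_proj a (hsub ha) ha0]; exact ha⟩
  graph_proj a ha := h.graph_proj a (hsub ha)
  contDiffOn := h.contDiffOn.mono inter_subset_left
  hasFDerivAt ξ hξ := h.hasFDerivAt ξ hξ.1
  proj_deriv a ha := h.proj_deriv a (hsub ha)
  mem_ker_iff a ha := h.mem_ker_iff a (hsub ha)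
  norm_le a ha := h.norm_le a (hsub ha)
  quadratic a ha b hb := h.quadratic a (hsub ha) b (hsub hb)

/-- `P` is a linear retraction onto `ker D`, followed by an identification of `ker D` with ℝᵖ; it is
injective where `D` vanishes, and the dimensions agree. -/
lemma exists_proj_prod_bijective [FiniteDimensional ℝ E] {k p : ℕ}
    (D : E →L[ℝ] EuclideanSpace ℝ (Fin k)) (hD : Function.Surjective D)
    (hpk : p + k = Module.finrank ℝ E) :
    ∃ (P : E →L[ℝ] EuclideanSpace ℝ (Fin p))
      (e : E ≃L[ℝ] EuclideanSpace ℝ (Fin k) × EuclideanSpace ℝ (Fin p)),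
      (e : E →L[ℝ] EuclideanSpace ℝ (Fin k) × EuclideanSpace ℝ (Fin p)) = D.prod P := by
  have h1 := LinearMap.finrank_range_add_finrank_ker (D : E →ₗ[ℝ] EuclideanSpace ℝ (Fin k))
  have h2 : LinearMap.range (D : E →ₗ[ℝ] EuclideanSpace ℝ (Fin k)) = ⊤ :=
    LinearMap.range_eq_top.2 hD
  rw [h2, finrank_top, finrank_euclideanSpace_fin] at h1
  have h3 : Module.finrank ℝ (LinearMap.ker (D : E →ₗ[ℝ] EuclideanSpace ℝ (Fin k))) =
      Module.finrank ℝ (EuclideanSpace ℝ (Fin p)) := by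
    rw [finrank_euclideanSpace_fin]; omega
  let L := LinearEquiv.ofFinrankEq _ _ h3
  obtain ⟨ℓ, hℓ⟩ := LinearMap.exists_leftInverse_of_injective
    (LinearMap.ker (D : E →ₗ[ℝ] EuclideanSpace ℝ (Fin k))).subtype (Submodule.ker_subtype _)
  let P : E →L[ℝ] EuclideanSpace ℝ (Fin p) :=
    LinearMap.toContinuousLinearMap (L.toLinearMap ∘ₗ ℓ)
  have hinj : Function.Injective (D.prod P).toLinearMap := by
    rw [← LinearMap.ker_eq_bot, LinearMap.ker_eq_bot']
    intro w hw
    have hw1 : D w = 0 := congrArg Prod.fst hw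
    have hw2 : L (ℓ w) = 0 := congrArg Prod.snd hw
    have hw3 : ℓ w = 0 := L.map_eq_zero_iff.1 hw2
    have hw4 := LinearMap.congr_fun hℓ ⟨w, hw1⟩
    simp only [LinearMap.comp_apply, Submodule.subtype_apply, LinearMap.id_apply] at hw4
    rw [hw3] at hw4
    exact (congrArg Subtype.val hw4).symm
  have hfin : Module.finrank ℝ E =
      Module.finrank ℝ (EuclideanSpace ℝ (Fin k) × EuclideanSpace ℝ (Fin p)) := by
    rw [Module.finrank_prod, finrank_euclideanSpace_fin, finrank_euclideanSpace_fin]; omega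
  refine ⟨P, (LinearMap.linearEquivOfInjective _ hinj hfin).toContinuousLinearEquiv, ?_⟩
  ext w <;> rfl

/-- Near each of its points, a submanifold of class `C^{1,1}` is a graph. -/
theorem exists_isLocalGraph [FiniteDimensional ℝ E] {k p : ℕ} {U : Set E}
    {f : E → EuclideanSpace ℝ (Fin k)} {L : ℝ≥0} (hpk : p + k = Module.finrank ℝ E)
    (hU : IsOpen U) {a₀ : E} (ha₀ : a₀ ∈ U) (hf : DifferentiableOn ℝ f U)
    (hL : LipschitzOnWith L (fderiv ℝ f) U) (hsurj : Function.Surjective (fderiv ℝ f a₀)) :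
    ∃ P V T Γ J C, IsLocalGraph (p := p) f P V T Γ J C ∧ a₀ ∈ V ∧ V ⊆ U ∧ ContinuousAt J a₀ := by
  obtain ⟨P, e₀, he₀⟩ := exists_proj_prod_bijective (fderiv ℝ f a₀) hsurj hpk
  have hfc : ContDiffOn ℝ 1 f U := by
    have : (1 : WithTop ℕ∞) = 0 + 1 := by norm_num
    rw [this, contDiffOn_succ_iff_fderiv_of_isOpen hU]
    exact ⟨hf, by simp, contDiffOn_zero.2 hL.continuousOn⟩
  -- Flattening map: the level set becomes the slice `0 × ℝᵖ`, and `Γ` is the inverse of `Ψ` on that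
  -- slice.
  let Ψ : E → EuclideanSpace ℝ (Fin k) × EuclideanSpace ℝ (Fin p) := fun a => (f a, P a)
  let Ψ' : E → E →L[ℝ] EuclideanSpace ℝ (Fin k) × EuclideanSpace ℝ (Fin p) :=
    fun a => (fderiv ℝ f a).prod P
  have hΨ : ∀ a ∈ U, HasFDerivAt Ψ (Ψ' a) a := fun a ha =>
    ((hf.differentiableAt (hU.mem_nhds ha)).hasFDerivAt).prodMk P.hasFDerivAt
  have hΨc : ∀ a ∈ U, ContDiffAt ℝ 1 Ψ a := fun a ha =>
    (hfc.contDiffAt (hU.mem_nhds ha)).prodMk P.contDiff.contDiffAt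
  have hΨ'c : ContinuousAt Ψ' a₀ := by
    have h1 : ContinuousAt (fderiv ℝ f) a₀ := hL.continuousOn.continuousAt (hU.mem_nhds ha₀)
    have h2 : Continuous fun A : E →L[ℝ] EuclideanSpace ℝ (Fin k) => A.prod P := by
      exact (ContinuousLinearMap.prodL ℝ).continuous.comp
        (f := fun A : E →L[ℝ] EuclideanSpace ℝ (Fin k) => (A, P)) (by fun_prop)
    exact ContinuousAt.comp (g := fun A : E →L[ℝ] EuclideanSpace ℝ (Fin k) => A.prod P)
      h2.continuousAt h1
  have hstrict : HasStrictFDerivAt Ψ (e₀ : E →L[ℝ] _) a₀ := by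
    rw [he₀]
    exact (hΨc a₀ ha₀).hasStrictFDerivAt' (hΨ a₀ ha₀) (by simp)
  have hinv : ContinuousAt (fun a => (Ψ' a).inverse) a₀ := by
    have h1 : ContinuousAt ContinuousLinearMap.inverse (Ψ' a₀) := by
      change ContinuousAt _ ((fderiv ℝ f a₀).prod P)
      rw [← he₀]
      exact (contDiffAt_map_inverse (n := 0) e₀).continuousAt
    exact ContinuousAt.comp (g := ContinuousLinearMap.inverse) h1 hΨ'c
  have hequiv : ∀ᶠ a in 𝓝 a₀, ∃ e : E ≃L[ℝ] EuclideanSpace ℝ (Fin k) × EuclideanSpace ℝ (Fin p),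
      (e : E →L[ℝ] EuclideanSpace ℝ (Fin k) × EuclideanSpace ℝ (Fin p)) = Ψ' a := by
    have h1 := ContinuousLinearEquiv.nhds e₀
    rw [he₀] at h1
    exact hΨ'c h1
  set M : ℝ := ‖(Ψ' a₀).inverse‖ + 1 with hM
  have hbound : ∀ᶠ a in 𝓝 a₀, ‖(Ψ' a).inverse‖ < M :=
    hinv.norm.eventually (gt_mem_nhds (lt_add_one _))
  obtain ⟨ε, hε, hball⟩ := Metric.eventually_nhds_iff_ball.1
    ((hequiv.and hbound).and (hU.eventually_mem ha₀))
  let H := (hstrict.toOpenPartialHomeomorph Ψ).restrOpen (Metric.ball a₀ ε) Metric.isOpen_ball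
  have hHsrc : ∀ a ∈ H.source, a ∈ Metric.ball a₀ ε := fun a ha => ha.2
  have hH : ∀ a, H a = Ψ a := fun a => rfl
  -- `inverse` is `0` off the invertible maps; the ball fixed above is where `Ψ'` is invertible,
  -- with inverse bounded by `M`.
  let J : E → EuclideanSpace ℝ (Fin p) →L[ℝ] E := fun a =>
    (Ψ' a).inverse.comp (ContinuousLinearMap.inr ℝ _ _)
  have hM0 : 0 < M := by positivity
  have hJe : ∀ a (e : E ≃L[ℝ] EuclideanSpace ℝ (Fin k) × EuclideanSpace ℝ (Fin p)),
      (e : E →L[ℝ] EuclideanSpace ℝ (Fin k) × EuclideanSpace ℝ (Fin p)) = Ψ' a → ∀ v, J a v = e.symm (0, v) := by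
    intro a e he v
    change (Ψ' a).inverse (0, v) = _
    rw [← he, ContinuousLinearMap.inverse_equiv]
    rfl
  have hev : ∀ a (e : E ≃L[ℝ] EuclideanSpace ℝ (Fin k) × EuclideanSpace ℝ (Fin p)),
      (e : E →L[ℝ] EuclideanSpace ℝ (Fin k) × EuclideanSpace ℝ (Fin p)) = Ψ' a →
      ∀ w, e w = (fderiv ℝ f a w, P w) := fun a e he w => congrArg (fun A => A w) he
  have hT : ∀ ξ : EuclideanSpace ℝ (Fin p), ((0 : EuclideanSpace ℝ (Fin k)), ξ) ∈ H.target →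
      f (H.symm (0, ξ)) = 0 ∧ P (H.symm (0, ξ)) = ξ := by
    intro ξ hξ
    have h1 : Ψ (H.symm (0, ξ)) = (0, ξ) := H.right_inv hξ
    exact ⟨congrArg Prod.fst h1, congrArg Prod.snd h1⟩
  refine ⟨P, H.source, {ξ | ((0 : EuclideanSpace ℝ (Fin k)), ξ) ∈ H.target},
    fun ξ => H.symm (0, ξ), J, M * (1 + L), ?_, ?_, ?_, ?_⟩
  · refine
    { isOpen_source := H.open_source
      isOpen_target := H.open_target.preimage (by fun_prop)
      differentiableAt := fun a ha => hf.differentiableAt (hU.mem_nhds (hball a (hHsrc a ha)).2)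
      mem_source := fun ξ hξ => H.map_target hξ
      zero := fun ξ hξ => (hT ξ hξ).1
      proj_graph := fun ξ hξ => (hT ξ hξ).2
      mem_target := fun a ha ha0 => ?_
      graph_proj := fun a ha ha0 => ?_
      contDiffOn := fun ξ hξ => ?_
      hasFDerivAt := fun ξ hξ => ?_
      proj_deriv := fun a ha v => ?_
      mem_ker_iff := fun a ha w => ?_
      norm_le := fun a ha => ?_
      quadratic := fun a ha b hb ha0 hb0 => ?_ }
    · have := H.map_source ha
      rw [hH] at this
      simpa [Ψ, ha0] using this
    · have := H.left_inv ha
      rw [hH] at this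
      simpa [Ψ, ha0] using this
    · obtain ⟨⟨⟨e, he⟩, -⟩, hmU⟩ := hball _ (hHsrc _ (H.map_target hξ))
      have h1 : ContDiffAt ℝ 1 H.symm ((0 : EuclideanSpace ℝ (Fin k)), ξ) :=
        H.contDiffAt_symm (f₀' := e) hξ (he ▸ hΨ _ hmU) (hΨc _ hmU)
      have h2 : ContDiffAt ℝ 1 (fun ξ : EuclideanSpace ℝ (Fin p) =>
          ((0 : EuclideanSpace ℝ (Fin k)), ξ)) ξ := by fun_prop
      exact (ContDiffAt.comp ξ h1 h2).contDiffWithinAt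
    · obtain ⟨⟨⟨e, he⟩, -⟩, hmU⟩ := hball _ (hHsrc _ (H.map_target hξ))
      have h1 : HasFDerivAt H.symm (e.symm : _ →L[ℝ] E) ((0 : EuclideanSpace ℝ (Fin k)), ξ) :=
        H.hasFDerivAt_symm hξ (he ▸ hΨ _ hmU)
      have h2 : HasFDerivAt (fun ξ : EuclideanSpace ℝ (Fin p) =>
          ((0 : EuclideanSpace ℝ (Fin k)), ξ)) (ContinuousLinearMap.inr ℝ _ _) ξ :=
        (hasFDerivAt_const _ _).prodMk (hasFDerivAt_id ξ)
      have h3 := HasFDerivAt.comp ξ h1 h2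
      change HasFDerivAt _ (J (H.symm (0, ξ))) ξ
      have h4 : J (H.symm (0, ξ)) =
          (e.symm : EuclideanSpace ℝ (Fin k) × EuclideanSpace ℝ (Fin p) →L[ℝ] E).comp
            (ContinuousLinearMap.inr ℝ _ _) :=
        ContinuousLinearMap.ext fun v => hJe _ e he v
      rw [h4]
      exact h3
    · obtain ⟨⟨⟨e, he⟩, -⟩, -⟩ := hball a (hHsrc a ha)
      rw [hJe a e he]
      have h1 := e.apply_symm_apply (0, v)
      rw [hev a e he] at h1
      exact congrArg Prod.snd h1
    · obtain ⟨⟨⟨e, he⟩, -⟩, -⟩ := hball a (hHsrc a ha)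
      rw [hJe a e he, ContinuousLinearEquiv.symm_apply_eq]
      rw [hev a e he, Prod.mk.injEq]
      exact ⟨fun h => ⟨h.symm, rfl⟩, fun h => h.1.symm⟩
    · have h1 := (hball a (hHsrc a ha)).1.2
      refine ContinuousLinearMap.opNorm_le_bound _ (by positivity) fun v => ?_
      have h2 : ‖((0 : EuclideanSpace ℝ (Fin k)), v)‖ = ‖v‖ := by simp
      calc ‖(Ψ' a).inverse (0, v)‖ ≤ ‖(Ψ' a).inverse‖ * ‖((0 : EuclideanSpace ℝ (Fin k)), v)‖ :=
            ContinuousLinearMap.le_opNorm _ _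
        _ ≤ M * ‖v‖ := by rw [h2]; gcongr
        _ ≤ M * (1 + L) * ‖v‖ := by
          gcongr
          nlinarith [L.coe_nonneg]
    · obtain ⟨⟨⟨e, he⟩, h1⟩, -⟩ := hball a (hHsrc a ha)
      have hsubU : Metric.ball a₀ ε ⊆ U := fun z hz => (hball z hz).2
      have hq := norm_sub_sub_fderiv_le (convex_ball a₀ ε)
        (fun z hz => hf.differentiableAt (hU.mem_nhds (hsubU hz))) (hL.mono hsubU)
        (hHsrc a ha) (hHsrc b hb)
      rw [ha0, hb0, sub_zero, zero_sub, norm_neg] at hq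
      -- The defect is the inverse of `Ψ'(a)` applied to `(f'(a)(b - a), 0)`. Since `f` vanishes at
      -- both points, the Lipschitz differential bounds this by `L ‖b - a‖²`; `Γ` need only be C¹.
      have h2 : b - a - J a (P b - P a) = e.symm (fderiv ℝ f a (b - a), 0) := by
        rw [hJe a e he, eq_comm, ContinuousLinearEquiv.symm_apply_eq, map_sub e,
          e.apply_symm_apply, hev a e he]
        simp
      have h4 : ‖(e.symm : EuclideanSpace ℝ (Fin k) × EuclideanSpace ℝ (Fin p) →L[ℝ] E)‖ ≤ M := by
        rw [← he, ContinuousLinearMap.inverse_equiv] at h1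
        exact h1.le
      have h5 : ‖(fderiv ℝ f a (b - a), (0 : EuclideanSpace ℝ (Fin p)))‖ =
        ‖fderiv ℝ f a (b - a)‖ := by simp
      rw [h2]
      calc _ ≤ ‖(e.symm : EuclideanSpace ℝ (Fin k) × EuclideanSpace ℝ (Fin p) →L[ℝ] E)‖ *
            ‖(fderiv ℝ f a (b - a), (0 : EuclideanSpace ℝ (Fin p)))‖ :=
            (e.symm : EuclideanSpace ℝ (Fin k) × EuclideanSpace ℝ (Fin p) →L[ℝ] E).le_opNorm _
        _ ≤ M * (L * ‖b - a‖ ^ 2) := by rw [h5]; gcongr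
        _ ≤ M * (1 + L) * ‖b - a‖ ^ 2 := by
          rw [mul_assoc]; gcongr; linarith
  · exact ⟨hstrict.mem_toOpenPartialHomeomorph_source, Metric.mem_ball_self hε⟩
  · exact fun a ha => (hball a (hHsrc a ha)).2
  · exact hinv.clm_comp continuousAt_const

end LocalGraph

/-! ### Surface measure and volume of projections -/

section SurfaceMeasure

open scoped Bundle

variable {E : Type*} [NormedAddCommGroup E] [NormedSpace ℝ E]
  {M : Type*} [TopologicalSpace M] [ChartedSpace E M]

/-- The differential at `y` of the chart at `x`, as an endomorphism of the model space. -/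
def chartDeriv (E : Type*) [NormedAddCommGroup E] [NormedSpace ℝ E] {M : Type*}
    [TopologicalSpace M] [ChartedSpace E M] (x y : M) : E →L[ℝ] E :=
  mfderiv 𝓘(ℝ, E) 𝓘(ℝ, E) (extChartAt 𝓘(ℝ, E) x) y

variable [IsManifold 𝓘(ℝ, E) ∞ M]

lemma hasMFDerivAt_extChartAt_chartDeriv {x y : M} (hy : y ∈ (extChartAt 𝓘(ℝ, E) x).source) :
    HasMFDerivAt 𝓘(ℝ, E) 𝓘(ℝ, E) (extChartAt 𝓘(ℝ, E) x) y (chartDeriv E x y) := by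
  have : IsManifold 𝓘(ℝ, E) 1 M := IsManifold.of_le (n := ∞) (by simp)
  rw [extChartAt_source] at hy
  exact (mdifferentiableAt_extChartAt hy).hasMFDerivAt

lemma chartDeriv_bijective {x y : M} (hy : y ∈ (extChartAt 𝓘(ℝ, E) x).source) :
    Function.Bijective (chartDeriv E x y) := by
  have : IsManifold 𝓘(ℝ, E) 1 M := IsManifold.of_le (n := ∞) (by simp)
  obtain ⟨e, he⟩ := isInvertible_mfderiv_extChartAt (I := 𝓘(ℝ, E)) hy
  rw [chartDeriv, ← he]
  exact e.bijective

/-- A Riemannian metric is locally comparable with the Euclidean metric of a chart. -/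
lemma exists_metric_comparison (g : RiemMetric E M) (x : M) :
    ∃ C > 0, ∀ᶠ y in 𝓝 x, ∀ v : TangentSpace 𝓘(ℝ, E) y,
      ‖chartDeriv E x y v‖ ^ 2 ≤ C ^ 2 * g.inner y v v ∧
      g.inner y v v ≤ C ^ 2 * ‖chartDeriv E x y v‖ ^ 2 := by
  have : IsManifold 𝓘(ℝ, E) 1 M := IsManifold.of_le (n := ∞) (by simp)
  let _ : Bundle.RiemannianBundle (fun x : M => TangentSpace 𝓘(ℝ, E) x) :=
    ⟨g.toRiemannianMetric⟩
  have : IsContinuousRiemannianBundle E (fun x : M => TangentSpace 𝓘(ℝ, E) x) :=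
    ⟨⟨fun b => g.inner b, g.contMDiff.continuous, fun _ _ _ => rfl⟩⟩
  obtain ⟨C₁, hC₁, h₁⟩ := eventually_norm_mfderiv_extChartAt_lt 𝓘(ℝ, E) x
  obtain ⟨C₂, hC₂, h₂⟩ := eventually_norm_mfderivWithin_symm_extChartAt_comp_lt 𝓘(ℝ, E) x
  have hnorm : ∀ (y : M) (v : TangentSpace 𝓘(ℝ, E) y), g.inner y v v = ‖v‖ ^ 2 := by
    intro y v
    rw [← real_inner_self_eq_norm_sq]
    rfl
  refine ⟨C₁ + C₂, by positivity, ?_⟩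
  filter_upwards [h₁, h₂, extChartAt_source_mem_nhds (I := 𝓘(ℝ, E)) x] with y hy₁ hy₂ hys v
  obtain ⟨A, hA⟩ : ∃ A : TangentSpace 𝓘(ℝ, E) y →L[ℝ] E,
    A = mfderiv 𝓘(ℝ, E) 𝓘(ℝ, E) (extChartAt 𝓘(ℝ, E) x) y := ⟨_, rfl⟩
  have hA1 : ‖A‖ < C₁ := hA ▸ hy₁
  have e1 : ‖chartDeriv E x y v‖ ≤ C₁ * ‖v‖ := by
    have := A.le_of_opNorm_le hA1.le v
    rw [hA] at this
    exact this
  have e3 := mfderivWithin_extChartAt_symm_comp_mfderiv_extChartAt' (I := 𝓘(ℝ, E)) hys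
  have e2 : ‖v‖ ≤ C₂ * ‖chartDeriv E x y v‖ := by
    -- The point recovered from its coordinates equals `y` only propositionally, so the norm of the
    -- fibre has to be transported.
    have hcast : ∀ y', y' = y → ∀ w : E,
        @norm (TangentSpace 𝓘(ℝ, E) y') _ w = @norm (TangentSpace 𝓘(ℝ, E) y) _ w := by
      rintro y' rfl w; rfl
    obtain ⟨B, hB⟩ : ∃ B : E →L[ℝ] TangentSpace 𝓘(ℝ, E)
        ((extChartAt 𝓘(ℝ, E) x).symm (extChartAt 𝓘(ℝ, E) x y)),
      B = mfderivWithin 𝓘(ℝ, E) 𝓘(ℝ, E) (extChartAt 𝓘(ℝ, E) x).symm (range 𝓘(ℝ, E))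
        (extChartAt 𝓘(ℝ, E) x y) := ⟨_, rfl⟩
    have hB1 : ‖B‖ < C₂ := hB ▸ hy₂
    have h5 := B.le_of_opNorm_le hB1.le (chartDeriv E x y v)
    have h6 : (B (chartDeriv E x y v) : E) = v := by
      rw [hB]
      exact congrArg (fun T => T v) e3
    have h7 := congrArg (fun w : E => @norm (TangentSpace 𝓘(ℝ, E)
        ((extChartAt 𝓘(ℝ, E) x).symm (extChartAt 𝓘(ℝ, E) x y))) _ w) h6
    exact ((hcast _ ((extChartAt 𝓘(ℝ, E) x).left_inv hys) v).symm.trans h7.symm).le.trans h5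
  have hC : 0 ≤ ‖v‖ := norm_nonneg v
  rw [hnorm]
  constructor
  · rw [← mul_pow]
    gcongr
    refine e1.trans ?_
    gcongr
    linarith
  · rw [← mul_pow]
    gcongr
    refine e2.trans ?_
    gcongr
    linarith

end SurfaceMeasure

section SurfaceMeasure

variable {E : Type*} [NormedAddCommGroup E] [NormedSpace ℝ E]
  {M : Type*} [TopologicalSpace M] [ChartedSpace E M]

lemma IsLocalParam.hasMFDerivAt {p : ℕ} {S : Set M} {W : Set (EuclideanSpace ℝ (Fin p))}
    {Φ : EuclideanSpace ℝ (Fin p) → M} (h : IsLocalParam E S W Φ)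
    {ξ : EuclideanSpace ℝ (Fin p)} (hξ : ξ ∈ W) :
    HasMFDerivAt 𝓘(ℝ, EuclideanSpace ℝ (Fin p)) 𝓘(ℝ, E) Φ ξ
      (mfderiv 𝓘(ℝ, EuclideanSpace ℝ (Fin p)) 𝓘(ℝ, E) Φ ξ) :=
  ((h.2.1.contMDiffAt (h.1.mem_nhds hξ)).mdifferentiableAt (by simp)).hasMFDerivAt

variable [IsManifold 𝓘(ℝ, E) ∞ M]

/-- Positivity of the form at `v + w` and `v - w`; it bounds all Gram entries by the diagonal ones.
-/
lemma abs_metric_le (g : RiemMetric E M) (y : M) (v w : TangentSpace 𝓘(ℝ, E) y) :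
    |g.inner y v w| ≤ (g.inner y v v + g.inner y w w) / 2 := by
  have hnonneg : ∀ u : TangentSpace 𝓘(ℝ, E) y, 0 ≤ g.inner y u u := by
    intro u
    by_cases hu : u = 0
    · rw [hu, map_zero]
    · exact (g.pos y u hu).le
  have h1 := hnonneg (v + w)
  have h2 := hnonneg (v - w)
  have hs := g.symm y v w
  simp only [map_add, map_sub, add_apply, sub_apply] at h1 h2
  rw [abs_le]
  constructor <;> linarith

/-- The Jacobian determinant of a chart followed by a linear projection is controlled by the
area density. -/
lemma ofReal_abs_det_le_areaDensity (g : RiemMetric E M) {p : ℕ} {x : M}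
    (P : E →L[ℝ] EuclideanSpace ℝ (Fin p)) {C : ℝ} (hC : 0 < C)
    (Φ : EuclideanSpace ℝ (Fin p) → M) (ξ : EuclideanSpace ℝ (Fin p))
    (D : EuclideanSpace ℝ (Fin p) →L[ℝ] E)
    (hD : D = mfderiv 𝓘(ℝ, EuclideanSpace ℝ (Fin p)) 𝓘(ℝ, E) Φ ξ)
    (hg : ∀ v : TangentSpace 𝓘(ℝ, E) (Φ ξ),
      ‖P (chartDeriv E x (Φ ξ) v)‖ ^ 2 ≤ C ^ 2 * g.inner (Φ ξ) v v) :
    ENNReal.ofReal |(P ∘L chartDeriv E x (Φ ξ) ∘L D).det| ≤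
      ENNReal.ofReal (C ^ p) * areaDensity g Φ ξ := by
  rw [areaDensity, ← ENNReal.ofReal_mul (by positivity)]
  refine ENNReal.ofReal_le_ofReal ?_
  have h := abs_det_comp_le_sqrt_det_gram (V := E) (fun v w => g.inner (Φ ξ) v w)
    (fun u v w => by
      exact congrArg (fun T => T w) ((g.inner (Φ ξ)).map_add u v))
    (fun a u v => by
      exact congrArg (fun T => T v) ((g.inner (Φ ξ)).map_smul a u))
    (fun u v => g.symm (Φ ξ) u v) D.toLinearMap (P ∘L chartDeriv E x (Φ ξ)).toLinearMap hC hg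
  subst hD
  exact h

/-- Any patch covering `A ∩ S`, followed by the chart and `P`, is a map between open parts of ℝᵖ
whose Jacobian is at most `C ^ p` times the area density. The area inequality applies without
injectivity of the composite, so the bound survives the infimum over patches. -/
lemma volume_image_le_patchArea (g : RiemMetric E M) (p : ℕ) (S : Set M) {x : M} {O : Set M}
    (hO : IsOpen O) (hOx : O ⊆ (extChartAt 𝓘(ℝ, E) x).source)
    (P : E →L[ℝ] EuclideanSpace ℝ (Fin p)) {C : ℝ} (hC : 0 < C)
    (hg : ∀ y ∈ O, ∀ v : TangentSpace 𝓘(ℝ, E) y,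
      ‖P (chartDeriv E x y v)‖ ^ 2 ≤ C ^ 2 * g.inner y v v) (A : Set M) :
    volume ((fun y => P (extChartAt 𝓘(ℝ, E) x y)) '' (A ∩ (O ∩ S))) ≤
      ENNReal.ofReal (C ^ p) * patchArea g p S A := by
  have hC0 : ENNReal.ofReal (C ^ p) ≠ 0 := by
    rw [Ne, ENNReal.ofReal_eq_zero, not_le]; positivity
  rw [mul_comm, ← ENNReal.div_le_iff hC0 ENNReal.ofReal_ne_top]
  refine le_iInf fun W => le_iInf fun Φ => le_iInf fun K => le_iInf fun hΦ => le_iInf fun hK =>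
    le_iInf fun hKW => le_iInf fun hcov => ?_
  rw [ENNReal.div_le_iff hC0 ENNReal.ofReal_ne_top, mul_comm]
  have hopen : IsOpen (W ∩ Φ ⁻¹' O) := hΦ.2.1.continuousOn.isOpen_inter_preimage hΦ.1 hO
  let K' := K ∩ (W ∩ Φ ⁻¹' O)
  have hK' : MeasurableSet K' := hK.inter hopen.measurableSet
  obtain ⟨D, hD⟩ : ∃ D : EuclideanSpace ℝ (Fin p) →
      EuclideanSpace ℝ (Fin p) →L[ℝ] E, ∀ ξ, D ξ =
        mfderiv 𝓘(ℝ, EuclideanSpace ℝ (Fin p)) 𝓘(ℝ, E) Φ ξ := ⟨_, fun _ => rfl⟩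
  have hder : ∀ ξ ∈ K', HasFDerivWithinAt (fun ξ => P (extChartAt 𝓘(ℝ, E) x (Φ ξ)))
      (P ∘L chartDeriv E x (Φ ξ) ∘L D ξ) K' ξ := by
    intro ξ hξ
    have h1 := hΦ.hasMFDerivAt hξ.2.1
    rw [← hD] at h1
    have h2 : HasFDerivAt (extChartAt 𝓘(ℝ, E) x ∘ Φ) (chartDeriv E x (Φ ξ) ∘L D ξ) ξ :=
      ((hasMFDerivAt_extChartAt_chartDeriv (hOx hξ.2.2)).comp ξ h1).hasFDerivAt
    exact (P.hasFDerivAt.comp ξ h2).hasFDerivWithinAt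
  calc volume ((fun y => P (extChartAt 𝓘(ℝ, E) x y)) '' (A ∩ (O ∩ S)))
      ≤ volume ((fun ξ => P (extChartAt 𝓘(ℝ, E) x (Φ ξ))) '' K') := by
        refine measure_mono ?_
        rintro _ ⟨y, ⟨hyA, hyO, hyS⟩, rfl⟩
        obtain ⟨ξ, hξ, rfl⟩ := hcov ⟨hyA, hyS⟩
        exact ⟨ξ, ⟨hξ, hKW hξ, hyO⟩, rfl⟩
    _ ≤ ∫⁻ ξ in K', ENNReal.ofReal |(P ∘L chartDeriv E x (Φ ξ) ∘L D ξ).det| :=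
        addHaar_image_le_lintegral_abs_det_fderiv volume hK' hder
    _ ≤ ∫⁻ ξ in K', ENNReal.ofReal (C ^ p) * areaDensity g Φ ξ :=
        setLIntegral_mono' hK' fun ξ hξ =>
          ofReal_abs_det_le_areaDensity g P hC Φ ξ (D ξ) (hD ξ) (hg _ hξ.2.2)
    _ = ENNReal.ofReal (C ^ p) * ∫⁻ ξ in K', areaDensity g Φ ξ :=
        lintegral_const_mul' _ _ ENNReal.ofReal_ne_top
    _ ≤ ENNReal.ofReal (C ^ p) * ∫⁻ ξ in K, areaDensity g Φ ξ := by
        gcongr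
        exact inter_subset_left

variable [Nonempty M] [MeasurableSpace M] [BorelSpace M]

/-- The surface measure dominates the volume of the projections. -/
theorem volume_image_le_surfaceMeasure (g : RiemMetric E M) (p : ℕ) (S : Set M) {x : M} {O : Set M}
    (hO : IsOpen O) (hOx : O ⊆ (extChartAt 𝓘(ℝ, E) x).source)
    (P : E →L[ℝ] EuclideanSpace ℝ (Fin p)) {C : ℝ} (hC : 0 < C)
    (hg : ∀ y ∈ O, ∀ v : TangentSpace 𝓘(ℝ, E) y,
      ‖P (chartDeriv E x y v)‖ ^ 2 ≤ C ^ 2 * g.inner y v v) (A : Set M) :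
    volume ((fun y => P (extChartAt 𝓘(ℝ, E) x y)) '' (A ∩ (O ∩ S))) ≤
      ENNReal.ofReal (C ^ p) * surfaceMeasure g p S A := by
  have hC0 : ENNReal.ofReal (C ^ p) ≠ 0 := by
    rw [Ne, ENNReal.ofReal_eq_zero, not_le]; positivity
  -- The rescaled volume of the projection is itself an outer measure, and `surfaceOuterMeasure` is
  -- the largest one below `patchArea`.
  let m : OuterMeasure M := (ENNReal.ofReal (C ^ p))⁻¹ • OuterMeasure.restrict (O ∩ S)
    (OuterMeasure.comap (fun y => P (extChartAt 𝓘(ℝ, E) x y))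
      (volume : Measure (EuclideanSpace ℝ (Fin p))).toOuterMeasure)
  have hm : ∀ A, m A = volume ((fun y => P (extChartAt 𝓘(ℝ, E) x y)) '' (A ∩ (O ∩ S))) /
      ENNReal.ofReal (C ^ p) := by
    intro A
    simp [m, ENNReal.div_eq_inv_mul]
  have h1 : m ≤ surfaceOuterMeasure g p S := by
    refine OuterMeasure.le_ofFunction.2 fun A => ?_
    rw [hm, ENNReal.div_le_iff hC0 ENNReal.ofReal_ne_top, mul_comm]
    exact volume_image_le_patchArea g p S hO hOx P hC hg A
  have h2 : m A ≤ surfaceMeasure g p S A := (h1 A).trans (le_toMeasure_apply _ _ _)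
  rwa [hm, ENNReal.div_le_iff hC0 ENNReal.ofReal_ne_top, mul_comm] at h2

lemma surfaceMeasure_le_patchArea (g : RiemMetric E M) (p : ℕ) (S : Set M) {A : Set M}
    (hA : MeasurableSet A) : surfaceMeasure g p S A ≤ patchArea g p S A := by
  rw [surfaceMeasure, toMeasure_apply _ _ hA]
  exact OuterMeasure.ofFunction_le A

/-- The surface measure of the part of `S` contained in a graph patch is controlled by the volume
of its projection. -/
theorem exists_surfaceMeasure_le (g : RiemMetric E M) {k p : ℕ} (S : Set M) {x : M}
    {f : E → EuclideanSpace ℝ (Fin k)} {P : E →L[ℝ] EuclideanSpace ℝ (Fin p)} {V : Set E}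
    {T : Set (EuclideanSpace ℝ (Fin p))} {Γ : EuclideanSpace ℝ (Fin p) → E}
    {J : E → EuclideanSpace ℝ (Fin p) →L[ℝ] E} {C₀ C : ℝ} (h : IsLocalGraph f P V T Γ J C₀)
    (hV : V ⊆ (extChartAt 𝓘(ℝ, E) x).target)
    (hS : ∀ a ∈ V, ((extChartAt 𝓘(ℝ, E) x).symm a ∈ S ↔ f a = 0))
    (hg : ∀ a ∈ V, ∀ v : TangentSpace 𝓘(ℝ, E) ((extChartAt 𝓘(ℝ, E) x).symm a),
      g.inner _ v v ≤ C ^ 2 * ‖chartDeriv E x ((extChartAt 𝓘(ℝ, E) x).symm a) v‖ ^ 2) :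
    ∃ D > 0, ∀ A, MeasurableSet A → ∀ K ⊆ T, MeasurableSet K →
      A ∩ S ⊆ (fun ξ => (extChartAt 𝓘(ℝ, E) x).symm (Γ ξ)) '' K →
      surfaceMeasure g p S A ≤ ENNReal.ofReal D * volume K := by
  set Φ : EuclideanSpace ℝ (Fin p) → M := fun ξ => (extChartAt 𝓘(ℝ, E) x).symm (Γ ξ) with hΦdef
  have hκΦ : ∀ ξ ∈ T, extChartAt 𝓘(ℝ, E) x (Φ ξ) = Γ ξ := fun ξ hξ =>
    (extChartAt 𝓘(ℝ, E) x).right_inv (hV (h.mem_source ξ hξ))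
  have hΦmem : ∀ ξ ∈ T, Φ ξ ∈ (extChartAt 𝓘(ℝ, E) x).source := fun ξ hξ =>
    (extChartAt 𝓘(ℝ, E) x).map_target (hV (h.mem_source ξ hξ))
  have hsm : ContMDiffOn 𝓘(ℝ, EuclideanSpace ℝ (Fin p)) 𝓘(ℝ, E) 1 Φ T := by
    have h1 : ContMDiffOn 𝓘(ℝ, E) 𝓘(ℝ, E) 1 (extChartAt 𝓘(ℝ, E) x).symm
        (extChartAt 𝓘(ℝ, E) x).target :=
      (contMDiffOn_extChartAt_symm (I := 𝓘(ℝ, E)) (n := ∞) x).of_le (by simp)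
    exact h1.comp h.contDiffOn.contMDiffOn fun ξ hξ => hV (h.mem_source ξ hξ)
  have hder : ∀ ξ ∈ T, ∀ D : EuclideanSpace ℝ (Fin p) →L[ℝ] E,
      D = mfderiv 𝓘(ℝ, EuclideanSpace ℝ (Fin p)) 𝓘(ℝ, E) Φ ξ →
      ∀ v, chartDeriv E x (Φ ξ) (D v) = J (Γ ξ) v := by
    rintro ξ hξ D hD v
    have h1 : HasMFDerivAt 𝓘(ℝ, EuclideanSpace ℝ (Fin p)) 𝓘(ℝ, E) Φ ξ D := by
      rw [hD]
      exact ((hsm.contMDiffAt (h.isOpen_target.mem_nhds hξ)).mdifferentiableAt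
        (by simp)).hasMFDerivAt
    have h2 : HasFDerivAt (extChartAt 𝓘(ℝ, E) x ∘ Φ) (chartDeriv E x (Φ ξ) ∘L D) ξ :=
      ((hasMFDerivAt_extChartAt_chartDeriv (hΦmem ξ hξ)).comp ξ h1).hasFDerivAt
    have h3 : HasFDerivAt (extChartAt 𝓘(ℝ, E) x ∘ Φ) (J (Γ ξ)) ξ :=
      (h.hasFDerivAt ξ hξ).congr_of_eventuallyEq
        ((h.isOpen_target.eventually_mem hξ).mono fun η hη => hκΦ η hη)
    exact congrArg (fun T => T v) (h2.unique h3)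
  have hparam : IsLocalParam E S T Φ := by
    refine ⟨h.isOpen_target, hsm, ?_, ?_, ?_⟩
    · intro ξ hξ η hη hξη
      have h1 : Γ ξ = Γ η := by rw [← hκΦ ξ hξ, ← hκΦ η hη, hξη]
      rw [← h.proj_graph ξ hξ, ← h.proj_graph η hη, h1]
    · intro ξ hξ
      exact (hS _ (h.mem_source ξ hξ)).2 (h.zero ξ hξ)
    · intro ξ hξ v w hvw
      have h1 : J (Γ ξ) v = J (Γ ξ) w := by
        rw [← hder ξ hξ _ rfl v, ← hder ξ hξ _ rfl w]
        exact congrArg (chartDeriv E x (Φ ξ)) hvw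
      have h2 := congrArg P h1
      exact ((h.proj_deriv _ (h.mem_source ξ hξ) v).symm.trans h2).trans
        (h.proj_deriv _ (h.mem_source ξ hξ) w)
  -- Bound for a `p × p` determinant with entries at most `C ^ 2 * C₀ ^ 2`.
  let D₀ : ℝ := p.factorial • (C ^ 2 * C₀ ^ 2) ^ p
  have hD₀ : 0 ≤ D₀ := by positivity
  have harea : ∀ ξ ∈ T, areaDensity g Φ ξ ≤ ENNReal.ofReal (√D₀ + 1) := by
    intro ξ hξ
    obtain ⟨D, hD⟩ : ∃ D : EuclideanSpace ℝ (Fin p) →L[ℝ] E, D =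
        mfderiv 𝓘(ℝ, EuclideanSpace ℝ (Fin p)) 𝓘(ℝ, E) Φ ξ := ⟨_, rfl⟩
    obtain ⟨B, hB⟩ : ∃ B : E → E → ℝ, ∀ v w, B v w = g.inner (Φ ξ) v w := ⟨_, fun _ _ => rfl⟩
    have hdiag : ∀ i, B (D (EuclideanSpace.single i 1)) (D (EuclideanSpace.single i 1)) ≤
        C ^ 2 * C₀ ^ 2 := by
      intro i
      rw [hB]
      refine (hg _ (h.mem_source ξ hξ) _).trans ?_
      refine mul_le_mul_of_nonneg_left ?_ (by positivity)
      refine pow_le_pow_left₀ (norm_nonneg _) ?_ 2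
      refine (congrArg norm (hder ξ hξ D hD (EuclideanSpace.single i 1))).le.trans ?_
      refine ((J (Γ ξ)).le_of_opNorm_le (h.norm_le _ (h.mem_source ξ hξ)) _).trans ?_
      simp
    have hcs : ∀ v w, |B v w| ≤ (B v v + B w w) / 2 := by
      intro v w
      rw [hB, hB, hB]
      exact abs_metric_le g (Φ ξ) v w
    have hdet := Matrix.det_le (abv := AbsoluteValue.abs) (A := Matrix.of fun i j : Fin p =>
      B (D (EuclideanSpace.single i 1)) (D (EuclideanSpace.single j 1))) (x := C ^ 2 * C₀ ^ 2)
      (by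
        intro i j
        refine (hcs _ _).trans ?_
        linarith [hdiag i, hdiag j])
    rw [Fintype.card_fin] at hdet
    have hmat : (Matrix.of fun i j : Fin p =>
        B (D (EuclideanSpace.single i 1)) (D (EuclideanSpace.single j 1))) =
        Matrix.of fun i j : Fin p => g.inner (Φ ξ)
      (mfderiv 𝓘(ℝ, EuclideanSpace ℝ (Fin p)) 𝓘(ℝ, E) Φ ξ (EuclideanSpace.single i (1 : ℝ)))
      (mfderiv 𝓘(ℝ, EuclideanSpace ℝ (Fin p)) 𝓘(ℝ, E) Φ ξ (EuclideanSpace.single j (1 : ℝ))) := by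
      subst hD
      ext i j
      exact hB _ _
    rw [areaDensity, ← hmat]
    refine ENNReal.ofReal_le_ofReal ?_
    refine (Real.sqrt_le_sqrt ((le_abs_self _).trans hdet)).trans ?_
    exact (lt_add_one _).le
  refine ⟨√D₀ + 1, by positivity, fun A hA K hKT hK hcov => ?_⟩
  refine (surfaceMeasure_le_patchArea g p S hA).trans ?_
  have hpatch : patchArea g p S A ≤ ∫⁻ ξ in K, areaDensity g Φ ξ :=
    iInf_le_of_le T <| iInf_le_of_le Φ <| iInf_le_of_le K <| iInf_le_of_le hparam <|
      iInf_le_of_le hK <| iInf_le_of_le hKT <| iInf_le_of_le hcov le_rfl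
  refine hpatch.trans ?_
  calc ∫⁻ ξ in K, areaDensity g Φ ξ ≤ ∫⁻ ξ in K, ENNReal.ofReal (√D₀ + 1) :=
        setLIntegral_mono' hK fun ξ hξ => harea ξ (hKT hξ)
    _ = _ := by simp

end SurfaceMeasure

/-! ### Relative position of two points -/

section RelativePosition

variable {E : Type*} [NormedAddCommGroup E] [NormedSpace ℝ E]
  {G : Type*} [TopologicalSpace G] [ChartedSpace E G] [Group G]

/-- The odd coordinates of `y⁻¹ * z`, where `y` and `z` are given by their coordinates in the chart
at `x`. -/
def relCoord (x : G) (w : E × E) : E :=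
  oddChart (((extChartAt 𝓘(ℝ, E) x).symm w.1)⁻¹ * (extChartAt 𝓘(ℝ, E) x).symm w.2)

/-- The differential of `relCoord x` at the diagonal in the second variable. -/
def relDeriv (x : G) (a : E) : E →L[ℝ] E :=
  fderiv ℝ (relCoord x) (a, a) ∘L ContinuousLinearMap.inr ℝ E E

@[simp] lemma relCoord_self (x : G) (a : E) : relCoord x (a, a) = 0 := by simp [relCoord]

variable [LieGroup 𝓘(ℝ, E) ∞ G]

lemma contDiffAt_relCoord (x : G) :
    ContDiffAt ℝ ∞ (relCoord (E := E) x)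
      (extChartAt 𝓘(ℝ, E) x x, extChartAt 𝓘(ℝ, E) x x) := by
  set a := extChartAt 𝓘(ℝ, E) x x with ha
  rw [← contMDiffAt_iff_contDiffAt]
  have hs : ContMDiffAt 𝓘(ℝ, E) 𝓘(ℝ, E) ∞ (extChartAt 𝓘(ℝ, E) x).symm a :=
    (contMDiffOn_extChartAt_symm (I := 𝓘(ℝ, E)) (n := ∞) x).contMDiffAt
      (extChartAt_target_mem_nhds x)
  have h1 : ContMDiffAt 𝓘(ℝ, E × E) 𝓘(ℝ, E) ∞
      (fun w : E × E => (extChartAt 𝓘(ℝ, E) x).symm w.1) (a, a) :=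
    ContMDiffAt.comp (I' := 𝓘(ℝ, E)) ((a, a) : E × E) (g := (extChartAt 𝓘(ℝ, E) x).symm)
      hs (contMDiffAt_iff_contDiffAt.2 contDiffAt_fst)
  have h2 : ContMDiffAt 𝓘(ℝ, E × E) 𝓘(ℝ, E) ∞
      (fun w : E × E => (extChartAt 𝓘(ℝ, E) x).symm w.2) (a, a) :=
    ContMDiffAt.comp (I' := 𝓘(ℝ, E)) ((a, a) : E × E) (g := (extChartAt 𝓘(ℝ, E) x).symm)
      hs (contMDiffAt_iff_contDiffAt.2 contDiffAt_snd)
  refine ContMDiffAt.comp (I' := 𝓘(ℝ, E)) ((a, a) : E × E) (g := oddChart) ?_ (h1.inv.mul h2)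
  simpa using contMDiffAt_oddChart

/-- The differential of the relative position inverts the left trivialization of the tangent
bundle. -/
lemma relDeriv_chartDeriv {x z : G} (hz : z ∈ (extChartAt 𝓘(ℝ, E) x).source)
    (hd : DifferentiableAt ℝ (relCoord (E := E) x)
      (extChartAt 𝓘(ℝ, E) x z, extChartAt 𝓘(ℝ, E) x z)) (X : E) :
    relDeriv x (extChartAt 𝓘(ℝ, E) x z)
      (chartDeriv E x z (mulInvariantVectorField (I := 𝓘(ℝ, E)) (G := G) X z)) = X := by
  have : IsTopologicalGroup G := topologicalGroup_of_lieGroup 𝓘(ℝ, E) ∞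
  set a := extChartAt 𝓘(ℝ, E) x z with ha
  obtain ⟨D, hD, hDX⟩ : ∃ D : E →L[ℝ] E, HasMFDerivAt 𝓘(ℝ, E) 𝓘(ℝ, E) (fun y : G => z * y) 1 D ∧
      mulInvariantVectorField (I := 𝓘(ℝ, E)) (G := G) X z = D X :=
    ⟨_, ((contMDiff_mul_left (I := 𝓘(ℝ, E)) (n := ∞) (a := z)).mdifferentiable
      (by simp) (1 : G)).hasMFDerivAt, rfl⟩
  have h1 : HasMFDerivAt 𝓘(ℝ, E) 𝓘(ℝ, E) (extChartAt 𝓘(ℝ, E) x) (z * 1) (chartDeriv E x z) := by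
    rw [mul_one]; exact hasMFDerivAt_extChartAt_chartDeriv hz
  have h2 : HasFDerivAt (fun b => relCoord x (a, b)) (relDeriv x a) a :=
    HasFDerivAt.comp a (f := fun b : E => (a, b)) hd.hasFDerivAt
      ((hasFDerivAt_const a a).prodMk (hasFDerivAt_id a))
  have h3 : HasMFDerivAt 𝓘(ℝ, E) 𝓘(ℝ, E) (fun b => relCoord x (a, b))
      (extChartAt 𝓘(ℝ, E) x (z * 1)) (relDeriv (E := E) x a) := by
    rw [mul_one]; exact h2.hasMFDerivAt
  have h4 := h3.comp (1 : G) (h1.comp (1 : G) hD)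
  -- Left translation cancels: the composite is `y ↦ oddChart (z⁻¹ (z y)) = oddChart y` near the
  -- identity, with differential the identity there.
  have h5 : HasMFDerivAt 𝓘(ℝ, E) 𝓘(ℝ, E)
      ((fun b => relCoord x (a, b)) ∘ extChartAt 𝓘(ℝ, E) x ∘ fun y : G => z * y) (1 : G)
      (ContinuousLinearMap.id ℝ E) := by
    refine hasMFDerivAt_oddChart.congr_of_eventuallyEq ?_
    have ht : Tendsto (fun y : G => z * y) (𝓝 1) (𝓝 z) := by
      have : Continuous fun y : G => z * y := by fun_prop
      simpa using this.tendsto 1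
    filter_upwards [ht.eventually (extChartAt_source_mem_nhds' (I := 𝓘(ℝ, E)) hz)] with y hy
    change oddChart (((extChartAt 𝓘(ℝ, E) x).symm a)⁻¹ *
      (extChartAt 𝓘(ℝ, E) x).symm (extChartAt 𝓘(ℝ, E) x (z * y))) = oddChart (E := E) y
    rw [ha, (extChartAt 𝓘(ℝ, E) x).left_inv hz, (extChartAt 𝓘(ℝ, E) x).left_inv hy,
      inv_mul_cancel_left]
  have h6 := hasMFDerivAt_unique h4 h5
  rw [hDX]
  exact congrArg (fun T : E →L[ℝ] E => T X) h6

end RelativePosition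

/-! ### Tangent spaces and degree in a local graph -/

section TangentSpaces

variable {E : Type*} [NormedAddCommGroup E] [NormedSpace ℝ E]
  {M : Type*} [TopologicalSpace M] [ChartedSpace E M] [IsManifold 𝓘(ℝ, E) ∞ M]

/-- The tangent space of a level set, read in a chart, is the kernel of the differential. -/
lemma mem_tangentSpaceAt_iff {k p : ℕ} {S : Set M} {x z : M}
    {f : E → EuclideanSpace ℝ (Fin k)} {P : E →L[ℝ] EuclideanSpace ℝ (Fin p)} {V : Set E}
    {T : Set (EuclideanSpace ℝ (Fin p))} {Γ : EuclideanSpace ℝ (Fin p) → E}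
    {J : E → EuclideanSpace ℝ (Fin p) →L[ℝ] E} {C : ℝ} (h : IsLocalGraph f P V T Γ J C)
    (hV : V ⊆ (extChartAt 𝓘(ℝ, E) x).target)
    (hS : ∀ a ∈ V, ((extChartAt 𝓘(ℝ, E) x).symm a ∈ S ↔ f a = 0))
    (hz : z ∈ (extChartAt 𝓘(ℝ, E) x).source) (hzV : extChartAt 𝓘(ℝ, E) x z ∈ V) (hzS : z ∈ S)
    (v : E) :
    (v : TangentSpace 𝓘(ℝ, E) z) ∈ tangentSpaceAt (E := E) S z ↔
      fderiv ℝ f (extChartAt 𝓘(ℝ, E) x z) (chartDeriv E x z v) = 0 := by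
  set a := extChartAt 𝓘(ℝ, E) x z with ha
  have hsymm : (extChartAt 𝓘(ℝ, E) x).symm a = z := (extChartAt 𝓘(ℝ, E) x).left_inv hz
  have hfa : f a = 0 := (hS a hzV).1 (by rwa [hsymm])
  constructor
  · intro hv
    let N : Submodule ℝ (TangentSpace 𝓘(ℝ, E) z) :=
      LinearMap.ker ((fderiv ℝ f a ∘L chartDeriv E x z : E →L[ℝ] EuclideanSpace ℝ (Fin k)) :
        E →ₗ[ℝ] EuclideanSpace ℝ (Fin k))
    suffices hle : tangentSpaceAt (E := E) S z ≤ N from hle hv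
    refine Submodule.span_le.2 ?_
    rintro u ⟨γ, hγ0, hγS, hγd, hγu⟩
    obtain ⟨D, hD, hDu⟩ : ∃ D : ℝ →L[ℝ] E, HasMFDerivAt 𝓘(ℝ, ℝ) 𝓘(ℝ, E) γ 0 D ∧ D 1 = u :=
      ⟨_, hγd.hasMFDerivAt, hγu⟩
    have h1 : HasMFDerivAt 𝓘(ℝ, E) 𝓘(ℝ, E) (extChartAt 𝓘(ℝ, E) x) (γ 0) (chartDeriv E x z) := by
      rw [hγ0]; exact hasMFDerivAt_extChartAt_chartDeriv hz
    have h2 : HasFDerivAt (extChartAt 𝓘(ℝ, E) x ∘ γ) (chartDeriv E x z ∘L D) 0 :=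
      (h1.comp (0 : ℝ) hD).hasFDerivAt
    have hγa : (extChartAt 𝓘(ℝ, E) x ∘ γ) 0 = a := by simp [hγ0, ha]
    have hfd : HasFDerivAt f (fderiv ℝ f a) ((extChartAt 𝓘(ℝ, E) x ∘ γ) 0) := by
      rw [hγa]; exact (h.differentiableAt a hzV).hasFDerivAt
    have h3 := hfd.comp (0 : ℝ) h2
    have h4 : HasFDerivAt (f ∘ extChartAt 𝓘(ℝ, E) x ∘ γ)
        (0 : ℝ →L[ℝ] EuclideanSpace ℝ (Fin k)) 0 := by
      refine (hasFDerivAt_const (0 : EuclideanSpace ℝ (Fin k)) (0 : ℝ)).congr_of_eventuallyEq ?_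
      have h5 : ∀ᶠ t in 𝓝 (0 : ℝ), (extChartAt 𝓘(ℝ, E) x ∘ γ) t ∈ V := by
        refine h2.continuousAt.eventually_mem ?_
        rw [hγa]
        exact h.isOpen_source.mem_nhds hzV
      have h6 : ∀ᶠ t in 𝓝 (0 : ℝ), γ t ∈ (extChartAt 𝓘(ℝ, E) x).source := by
        refine hD.continuousAt.eventually_mem ?_
        rw [hγ0]
        exact extChartAt_source_mem_nhds' hz
      filter_upwards [h5, h6, hγS] with t ht ht' htS
      refine (hS _ ht).1 ?_
      rwa [Function.comp_apply, (extChartAt 𝓘(ℝ, E) x).left_inv ht']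
    have h7 := congrArg (fun T => T 1) (h3.unique h4)
    change fderiv ℝ f a (chartDeriv E x z (D 1)) = 0 at h7
    rw [hDu] at h7
    exact h7
  · intro hv
    refine Submodule.subset_span ?_
    set w := chartDeriv E x z v with hw
    have hJw : J a (P w) = w := (h.mem_ker_iff a hzV w).1 hv
    have hPa : P a ∈ T := h.mem_target a hzV hfa
    have hΓa : Γ (P a) = a := h.graph_proj a hzV hfa
    have hl : HasFDerivAt (fun t : ℝ => P a + t • P w)
        ((ContinuousLinearMap.id ℝ ℝ).smulRight (P w)) 0 :=
      ((ContinuousLinearMap.id ℝ ℝ).smulRight (P w)).hasFDerivAt.const_add (P a)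
    have hl0 : P a + (0 : ℝ) • P w = P a := by simp
    have hΓd : HasFDerivAt Γ (J a) (P a + (0 : ℝ) • P w) := by
      have := h.hasFDerivAt _ hPa
      rw [hl0]
      rwa [hΓa] at this
    -- The line through `P a` with direction `P w`, lifted by `Γ`, is a curve in the level set with
    -- velocity `J a (P w) = w`; so every kernel vector is a velocity, with no need of the span.
    have hc : HasFDerivAt (fun t : ℝ => Γ (P a + t • P w))
        (J a ∘L (ContinuousLinearMap.id ℝ ℝ).smulRight (P w)) 0 := hΓd.comp (0 : ℝ) hl
    have hT : ∀ᶠ t in 𝓝 (0 : ℝ), P a + t • P w ∈ T := by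
      refine hl.continuousAt.eventually_mem ?_
      rw [hl0]
      exact h.isOpen_target.mem_nhds hPa
    have hc0 : Γ (P a + (0 : ℝ) • P w) = a := by rw [hl0, hΓa]
    let γ : ℝ → M := (extChartAt 𝓘(ℝ, E) x).symm ∘ fun t : ℝ => Γ (P a + t • P w)
    have hγ0 : γ 0 = z := by simp only [γ, Function.comp_apply, hc0, hsymm]
    have hsd : MDifferentiableAt 𝓘(ℝ, E) 𝓘(ℝ, E) (extChartAt 𝓘(ℝ, E) x).symm
        (Γ (P a + (0 : ℝ) • P w)) := by
      rw [hc0]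
      exact ((contMDiffOn_extChartAt_symm (I := 𝓘(ℝ, E)) (n := ∞) x).contMDiffAt
        ((isOpen_extChartAt_target x).mem_nhds (hV hzV))).mdifferentiableAt (by simp)
    have hγd : MDifferentiableAt 𝓘(ℝ, ℝ) 𝓘(ℝ, E) γ 0 :=
      hsd.comp (0 : ℝ) hc.hasMFDerivAt.mdifferentiableAt
    refine ⟨γ, hγ0, ?_, hγd, ?_⟩
    · filter_upwards [hT] with t ht
      exact (hS _ (h.mem_source _ ht)).2 (h.zero _ ht)
    · obtain ⟨D, hD, hD1⟩ : ∃ D : ℝ →L[ℝ] E, HasMFDerivAt 𝓘(ℝ, ℝ) 𝓘(ℝ, E) γ 0 D ∧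
        (mfderiv 𝓘(ℝ, ℝ) 𝓘(ℝ, E) γ 0 (1 : ℝ) : E) = D 1 := ⟨_, hγd.hasMFDerivAt, rfl⟩
      refine hD1.trans ((chartDeriv_bijective hz).1 ?_)
      have h1 : HasMFDerivAt 𝓘(ℝ, E) 𝓘(ℝ, E) (extChartAt 𝓘(ℝ, E) x) (γ 0)
          (chartDeriv E x z) := by
        rw [hγ0]; exact hasMFDerivAt_extChartAt_chartDeriv hz
      have h2 : HasFDerivAt (extChartAt 𝓘(ℝ, E) x ∘ γ) (chartDeriv E x z ∘L D) 0 :=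
        (h1.comp (0 : ℝ) hD).hasFDerivAt
      have h3 := hc.congr_of_eventuallyEq (f₁ := extChartAt 𝓘(ℝ, E) x ∘ γ) <| by
        filter_upwards [hT] with t ht
        exact (extChartAt 𝓘(ℝ, E) x).right_inv (hV (h.mem_source _ ht))
      have h4 := congrArg (fun T => T 1) (h2.unique h3)
      simpa [hJw] using h4

end TangentSpaces

section LeftTangent

variable {E : Type*} [NormedAddCommGroup E] [NormedSpace ℝ E] [FiniteDimensional ℝ E]
  {G : Type*} [TopologicalSpace G] [ChartedSpace E G] [Group G] [LieGroup 𝓘(ℝ, E) ∞ G]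
  {k p : ℕ} {S : Set G} {x z : G}
  {f : E → EuclideanSpace ℝ (Fin k)} {P : E →L[ℝ] EuclideanSpace ℝ (Fin p)} {V : Set E}
  {T : Set (EuclideanSpace ℝ (Fin p))} {Γ : EuclideanSpace ℝ (Fin p) → E}
  {J : E → EuclideanSpace ℝ (Fin p) →L[ℝ] E} {C : ℝ}

/-- `relDeriv_chartDeriv` gives a right inverse, and the dimension is finite. -/
lemma relDeriv_bijective (hz : z ∈ (extChartAt 𝓘(ℝ, E) x).source)
    (hd : DifferentiableAt ℝ (relCoord (E := E) x)
      (extChartAt 𝓘(ℝ, E) x z, extChartAt 𝓘(ℝ, E) x z)) :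
    Function.Bijective (relDeriv (E := E) x (extChartAt 𝓘(ℝ, E) x z)) := by
  have hs : Function.Surjective (relDeriv (E := E) x (extChartAt 𝓘(ℝ, E) x z)).toLinearMap :=
    fun X => ⟨_, relDeriv_chartDeriv hz hd X⟩
  exact ⟨LinearMap.injective_iff_surjective.2 hs, hs⟩

/-- The left translated tangent space, read in a local graph. -/
lemma mem_leftTangent_iff (h : IsLocalGraph f P V T Γ J C)
    (hV : V ⊆ (extChartAt 𝓘(ℝ, E) x).target)
    (hS : ∀ a ∈ V, ((extChartAt 𝓘(ℝ, E) x).symm a ∈ S ↔ f a = 0))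
    (hz : z ∈ (extChartAt 𝓘(ℝ, E) x).source) (hzV : extChartAt 𝓘(ℝ, E) x z ∈ V) (hzS : z ∈ S)
    (hd : DifferentiableAt ℝ (relCoord (E := E) x)
      (extChartAt 𝓘(ℝ, E) x z, extChartAt 𝓘(ℝ, E) x z)) (X : E) :
    (X : GroupLieAlgebra 𝓘(ℝ, E) G) ∈ leftTangent (E := E) S z ↔
      ∃ v, relDeriv x (extChartAt 𝓘(ℝ, E) x z) (J (extChartAt 𝓘(ℝ, E) x z) v) = X := by
  obtain ⟨D, hD⟩ : ∃ D : E, D = mulInvariantVectorField (I := 𝓘(ℝ, E)) (G := G) X z := ⟨_, rfl⟩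
  have hX : relDeriv x (extChartAt 𝓘(ℝ, E) x z) (chartDeriv E x z D) = X := by
    rw [hD]; exact relDeriv_chartDeriv hz hd X
  have h1 : (X : GroupLieAlgebra 𝓘(ℝ, E) G) ∈ leftTangent (E := E) S z ↔
      fderiv ℝ f (extChartAt 𝓘(ℝ, E) x z) (chartDeriv E x z D) = 0 := by
    rw [hD]
    exact mem_tangentSpaceAt_iff h hV hS hz hzV hzS _
  rw [h1, h.mem_ker_iff _ hzV]
  constructor
  · intro hJ
    exact ⟨_, by rw [hJ, hX]⟩
  · rintro ⟨v, hv⟩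
    have h2 : J (extChartAt 𝓘(ℝ, E) x z) v = chartDeriv E x z D :=
      (relDeriv_bijective hz hd).1 (hv.trans hX.symm)
    rw [← h2, h.proj_deriv _ hzV]

/-- The pointwise degree is the dimension plus the rank of the second layer component of the left
translated tangent space. -/
theorem degreeAt_eq {V₁ V₂ : Submodule ℝ (GroupLieAlgebra 𝓘(ℝ, E) G)} (hV₁₂ : IsCompl V₁ V₂)
    {q : ℕ} (W : GradedBasis V₁ V₂ q) {π₁ π₂ : E →L[ℝ] E}
    (hπ : LayerProjections V₁ V₂ π₁ π₂) (h : IsLocalGraph f P V T Γ J C)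
    (hV : V ⊆ (extChartAt 𝓘(ℝ, E) x).target)
    (hS : ∀ a ∈ V, ((extChartAt 𝓘(ℝ, E) x).symm a ∈ S ↔ f a = 0))
    (hz : z ∈ (extChartAt 𝓘(ℝ, E) x).source) (hzV : extChartAt 𝓘(ℝ, E) x z ∈ V) (hzS : z ∈ S)
    (hd : DifferentiableAt ℝ (relCoord (E := E) x)
      (extChartAt 𝓘(ℝ, E) x z, extChartAt 𝓘(ℝ, E) x z)) :
    degreeAt W S z = p + Module.finrank ℝ (LinearMap.range
      (π₂ ∘L relDeriv x (extChartAt 𝓘(ℝ, E) x z) ∘L J (extChartAt 𝓘(ℝ, E) x z)).toLinearMap) := by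
  have : FiniteDimensional ℝ (GroupLieAlgebra 𝓘(ℝ, E) G) :=
    inferInstanceAs (FiniteDimensional ℝ E)
  let A : EuclideanSpace ℝ (Fin p) →ₗ[ℝ] GroupLieAlgebra 𝓘(ℝ, E) G :=
    (relDeriv x (extChartAt 𝓘(ℝ, E) x z) ∘L J (extChartAt 𝓘(ℝ, E) x z)).toLinearMap
  let Q : GroupLieAlgebra 𝓘(ℝ, E) G →ₗ[ℝ] E := π₂.toLinearMap
  have hker : LinearMap.ker Q = V₁ := by
    ext X
    exact hπ.right_eq_zero X
  have hrange : leftTangent (E := E) S z = LinearMap.range A := by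
    ext X
    exact mem_leftTangent_iff h hV hS hz hzV hzS hd X
  have hinj : Function.Injective A := by
    intro v w hvw
    have h1 := congrArg P ((relDeriv_bijective hz hd).1 hvw)
    exact ((h.proj_deriv _ hzV v).symm.trans h1).trans (h.proj_deriv _ hzV w)
  have hp : Module.finrank ℝ (leftTangent (E := E) S z) = p := by
    rw [hrange, LinearMap.finrank_range_of_inj hinj, finrank_euclideanSpace_fin]
  have hdeg : degreeAt W S z = Module.finrank ℝ (leftTangent (E := E) S z) +
      Module.finrank ℝ ((leftTangent (E := E) S z).map Q) :=
    pvectorDegree_iotaMulti hV₁₂ W Q hker _ _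
  rw [hdeg, hp, hrange, ← LinearMap.range_comp]
  rfl

end LeftTangent

/-! ### Uniform linearization along the submanifold -/

section LocalModel

/-- Injectivity on a finite dimensional space is a quantitative lower bound, and half of it survives
a small perturbation of the operator. -/
lemma eventually_lower_bound {X E F : Type*} [TopologicalSpace X] [NormedAddCommGroup E]
    [NormedSpace ℝ E] [NormedAddCommGroup F] [NormedSpace ℝ F] {B : X → E →L[ℝ] F} {a₀ : X}
    (hB : ContinuousAt B a₀) (N : Submodule ℝ E) [FiniteDimensional ℝ N]
    (hN : ∀ w ∈ N, B a₀ w = 0 → w = 0) :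
    ∃ c > 0, ∀ᶠ a in 𝓝 a₀, ∀ w ∈ N, c * ‖w‖ ≤ ‖B a w‖ := by
  obtain ⟨K, hK, hanti⟩ := LinearMap.exists_antilipschitzWith
    (B a₀ ∘L N.subtypeL : N →L[ℝ] F).toLinearMap (by
      rw [LinearMap.ker_eq_bot']
      intro w hw
      exact Subtype.ext (hN w w.2 hw))
  have hK' : (0 : ℝ) < K := hK
  have hlow : ∀ w ∈ N, (K : ℝ)⁻¹ * ‖w‖ ≤ ‖B a₀ w‖ := by
    intro w hw
    rw [inv_mul_le_iff₀ hK']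
    exact ZeroHomClass.bound_of_antilipschitz _ hanti ⟨w, hw⟩
  refine ⟨(K : ℝ)⁻¹ / 2, by positivity, ?_⟩
  filter_upwards [Metric.tendsto_nhds.1 hB ((K : ℝ)⁻¹ / 2) (by positivity)] with a ha w hw
  rw [dist_eq_norm] at ha
  have h1 : ‖B a w - B a₀ w‖ ≤ (K : ℝ)⁻¹ / 2 * ‖w‖ := by
    rw [← sub_apply]
    exact (B a - B a₀).le_of_opNorm_le ha.le w
  have h2 := hlow w hw
  have h3 := norm_sub_norm_le (B a₀ w) (B a w)
  rw [norm_sub_rev] at h3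
  linarith

lemma eventually_norm_le {X F : Type*} [TopologicalSpace X] [SeminormedAddCommGroup F]
    {B : X → F} {a₀ : X} (hB : ContinuousAt B a₀) : ∀ᶠ a in 𝓝 a₀, ‖B a‖ ≤ ‖B a₀‖ + 1 :=
  (hB.norm.eventually_lt_const (lt_add_one _)).mono fun _ h => h.le

variable {E : Type*} [NormedAddCommGroup E] [NormedSpace ℝ E]
  {k p : ℕ} {f : E → EuclideanSpace ℝ (Fin k)} {P : E →L[ℝ] EuclideanSpace ℝ (Fin p)} {V : Set E}
  {T : Set (EuclideanSpace ℝ (Fin p))} {Γ : EuclideanSpace ℝ (Fin p) → E}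
  {J : E → EuclideanSpace ℝ (Fin p) →L[ℝ] E} {C₀ : ℝ}

/-- Taylor expansion in the second variable at the diagonal, with a constant independent of the base
point. -/
lemma eventually_quadratic {F : Type*} [NormedAddCommGroup F] [NormedSpace ℝ F] {R : E × E → F}
    {a₀ : E} (hR : ContDiffAt ℝ ∞ R (a₀, a₀)) (hR0 : ∀ a, R (a, a) = 0) :
    ∃ K : ℝ, 0 ≤ K ∧ ∃ δ > 0, ∀ a ∈ Metric.ball a₀ δ,
      DifferentiableAt ℝ R (a, a) ∧ ∀ b ∈ Metric.ball a₀ δ,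
        ‖R (a, b) - (fderiv ℝ R (a, a) ∘L ContinuousLinearMap.inr ℝ E E) (b - a)‖ ≤
          K * ‖b - a‖ ^ 2 := by
  obtain ⟨K, t, ht, hK⟩ := (ContDiffAt.fderiv_right (m := 1) (contDiffAt_infty.1 hR 2)
    (by norm_num)).exists_lipschitzOnWith
  have hd : ∀ᶠ w in 𝓝 (a₀, a₀), DifferentiableAt ℝ R w :=
    ((contDiffAt_infty.1 hR 1).eventually (by simp)).mono fun w hw => hw.differentiableAt (by simp)
  obtain ⟨δ, hδ, hball⟩ := Metric.eventually_nhds_iff_ball.1 (hd.and ht)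
  have hmem : ∀ a ∈ Metric.ball a₀ δ, ∀ b ∈ Metric.ball a₀ δ,
      (a, b) ∈ Metric.ball (a₀, a₀) δ := fun a ha b hb => by
    rw [← ball_prod_same]; exact ⟨ha, hb⟩
  refine ⟨K, K.2, δ, hδ, fun a ha => ⟨(hball _ (hmem a ha a ha)).1, fun b hb => ?_⟩⟩
  have h := norm_sub_sub_fderiv_le (convex_ball (a₀, a₀) δ) (fun w hw => (hball w hw).1)
    (hK.mono fun w hw => (hball w hw).2) (hmem a ha a ha) (hmem a ha b hb)
  simpa [hR0, Prod.norm_def] using h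

variable [FiniteDimensional ℝ E]

/-- Near a point of a level set, a smooth relative position map is given to first order by its
linearization along the level set, with a quadratic error. -/
lemma exists_local_model {a₀ : E} (h : IsLocalGraph f P V T Γ J C₀) (ha₀ : a₀ ∈ V)
    (hJ : ContinuousAt J a₀) {R : E × E → E} (hR : ContDiffAt ℝ ∞ R (a₀, a₀))
    (hR0 : ∀ a, R (a, a) = 0) {Λ : E → E →L[ℝ] E}
    (hΛ : ∀ a, Λ a = fderiv ℝ R (a, a) ∘L ContinuousLinearMap.inr ℝ E E)
    (hinj : Function.Injective (Λ a₀)) (π : E →L[ℝ] E) :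
    ∃ C > 0, ∀ᶠ δ in 𝓝[>] (0 : ℝ), Metric.ball a₀ δ ⊆ V ∧ ∀ a ∈ Metric.ball a₀ δ,
      DifferentiableAt ℝ R (a, a) ∧ ‖Λ a ∘L J a‖ ≤ C ∧
      (Module.finrank ℝ (LinearMap.range (π ∘L Λ a ∘L J a).toLinearMap) =
        Module.finrank ℝ (LinearMap.range (π ∘L Λ a₀ ∘L J a₀).toLinearMap) →
        ∀ w ∈ (LinearMap.ker (π ∘L Λ a ∘L J a).toLinearMap)ᗮ,
          C⁻¹ * ‖w‖ ≤ ‖(π ∘L Λ a ∘L J a) w‖) ∧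
      (f a = 0 → ∀ b ∈ Metric.ball a₀ δ, f b = 0 →
        ‖R (a, b) - Λ a (J a (P b - P a))‖ ≤ C * ‖P b - P a‖ ^ 2 ∧
        ‖P b - P a‖ ≤ C * ‖R (a, b)‖) := by
  have hC₀ : 0 ≤ C₀ := (norm_nonneg _).trans (h.norm_le a₀ ha₀)
  obtain ⟨K, hK, δ₁, hδ₁, hquad⟩ := eventually_quadratic hR hR0
  have hΛc : ContinuousAt Λ a₀ := by
    have h1 : ContinuousAt (fderiv ℝ R) (a₀, a₀) :=
      (ContDiffAt.fderiv_right (m := 1) (contDiffAt_infty.1 hR 2) (by norm_num)).continuousAt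
    have h2 : ContinuousAt (fun a : E => fderiv ℝ R (a, a)) a₀ :=
      ContinuousAt.comp (f := fun a : E => (a, a)) h1 (by fun_prop)
    have h3 : Λ = fun a => fderiv ℝ R (a, a) ∘L ContinuousLinearMap.inr ℝ E E := funext hΛ
    rw [h3]
    exact h2.clm_comp continuousAt_const
  have hTc : ContinuousAt (fun a => Λ a ∘L J a) a₀ := hΛc.clm_comp hJ
  have hAc : ContinuousAt (fun a => π ∘L Λ a ∘L J a) a₀ := continuousAt_const.clm_comp hTc
  obtain ⟨c₁, hc₁, hlow₁⟩ := eventually_lower_bound hΛc ⊤ fun w _ hw =>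
    hinj (hw.trans (map_zero _).symm)
  obtain ⟨c₂, hc₂, hlow₂⟩ := eventually_lower_bound hAc
    (LinearMap.ker (π ∘L Λ a₀ ∘L J a₀).toLinearMap)ᗮ fun w hw hw0 => by
      have : w ∈ (LinearMap.ker (π ∘L Λ a₀ ∘L J a₀).toLinearMap) ⊓
        (LinearMap.ker (π ∘L Λ a₀ ∘L J a₀).toLinearMap)ᗮ := ⟨hw0, hw⟩
      rwa [Submodule.inf_orthogonal_eq_bot] at this
  set l := ‖Λ a₀‖ + 1 with hl
  have hl0 : 0 ≤ l := by positivity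
  obtain ⟨δ₂, hδ₂, hev⟩ := Metric.eventually_nhds_iff_ball.1
    ((h.isOpen_source.eventually_mem ha₀).and (hlow₁.and (hlow₂.and
      ((eventually_norm_le hΛc).and (eventually_norm_le hTc)))))
  set Q := (K + l * C₀) * (2 * C₀) ^ 2 with hQ
  have hQ0 : 0 ≤ Q := by positivity
  -- One summand for each conclusion: the operator norm, the lower bound on the complement of the
  -- kernel, the quadratic error, and the control of `P b - P a`.
  set C := (‖Λ a₀ ∘L J a₀‖ + 1) + c₂⁻¹ + Q + ‖P‖ * (2 / c₁) with hC
  have hc₂' : 0 < c₂⁻¹ := by positivity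
  have hP0 : 0 ≤ ‖P‖ * (2 / c₁) := by positivity
  have hT0 : 0 ≤ ‖Λ a₀ ∘L J a₀‖ := norm_nonneg _
  have hCpos : 0 < C := by linarith
  -- Points of the ball are less than `2 δ` apart; the last two smallness conditions let the
  -- quadratic terms be absorbed into half of the linear ones.
  have hsmall : ∀ᶠ δ in 𝓝[>] (0 : ℝ), δ < δ₁ ∧ δ < δ₂ ∧ C₀ * (2 * δ) < 1 / 2 ∧
      K * (2 * δ) < c₁ / 2 := by
    have h1 : Tendsto (fun δ : ℝ => C₀ * (2 * δ)) (𝓝[>] 0) (𝓝 0) := by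
      have : Continuous fun δ : ℝ => C₀ * (2 * δ) := by fun_prop
      simpa using (this.tendsto 0).mono_left nhdsWithin_le_nhds
    have h2 : Tendsto (fun δ : ℝ => K * (2 * δ)) (𝓝[>] 0) (𝓝 0) := by
      have : Continuous fun δ : ℝ => K * (2 * δ) := by fun_prop
      simpa using (this.tendsto 0).mono_left nhdsWithin_le_nhds
    have h3 : Tendsto (fun δ : ℝ => δ) (𝓝[>] 0) (𝓝 0) :=
      tendsto_id.mono_left nhdsWithin_le_nhds
    exact (h3.eventually_lt_const hδ₁).and ((h3.eventually_lt_const hδ₂).and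
      ((h1.eventually_lt_const (by norm_num)).and (h2.eventually_lt_const (by positivity))))
  refine ⟨C, hCpos, ?_⟩
  filter_upwards [hsmall] with δ ⟨hδδ₁, hδδ₂, hδC, hδK⟩
  have hsub₁ := Metric.ball_subset_ball (x := a₀) hδδ₁.le
  have hsub₂ := Metric.ball_subset_ball (x := a₀) hδδ₂.le
  refine ⟨fun a ha => (hev a (hsub₂ ha)).1, fun a ha => ?_⟩
  obtain ⟨haV, ha1, ha2, haΛ, haT⟩ := hev a (hsub₂ ha)
  obtain ⟨had, haq⟩ := hquad a (hsub₁ ha)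
  refine ⟨had, haT.trans (by linarith), fun hrank w hw => ?_, fun hfa b hb hfb => ?_⟩
  -- `ha2` bounds the operator at `a` on the complement of the kernel at `a₀`; equality of ranks
  -- moves the bound to the complement of the kernel at `a` itself.
  · have h1 := lower_bound_on_ker_orthogonal (π ∘L Λ a ∘L J a) hc₂ _ ha2
      (hrank.trans (finrank_ker_orthogonal _).symm) w hw
    refine le_trans ?_ h1
    gcongr
    refine inv_le_of_inv_le₀ hc₂ ?_
    linarith
  · obtain ⟨hbV, -⟩ := hev b (hsub₂ hb)
    have hq := haq b (hsub₁ hb)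
    rw [← hΛ] at hq
    have hg := h.quadratic a haV b hbV hfa hfb
    set v := P b - P a with hv
    have hd : ‖b - a‖ ≤ 2 * δ := by
      rw [← dist_eq_norm]
      have := dist_triangle_right b a a₀
      have h1 := Metric.mem_ball.1 ha
      have h2 := Metric.mem_ball.1 hb
      linarith
    have hn := norm_nonneg (b - a)
    have hba : ‖b - a‖ ≤ 2 * C₀ * ‖v‖ := by
      have h1 : ‖b - a‖ ≤ ‖b - a - J a v‖ + ‖J a v‖ := by
        simpa using norm_add_le (b - a - J a v) (J a v)
      have h2 := (J a).le_of_opNorm_le (h.norm_le a haV) v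
      have h3 : C₀ * ‖b - a‖ ^ 2 ≤ 1 / 2 * ‖b - a‖ := by
        rw [sq, ← mul_assoc]
        gcongr
        exact (mul_le_mul_of_nonneg_left hd hC₀).trans hδC.le
      linarith
    constructor
    · have h1 : ‖R (a, b) - Λ a (J a v)‖ ≤ ‖R (a, b) - Λ a (b - a)‖ +
          ‖Λ a (b - a - J a v)‖ := by
        rw [map_sub (Λ a) (b - a) (J a v)]
        simpa using norm_add_le (R (a, b) - Λ a (b - a)) (Λ a (b - a) - Λ a (J a v))
      have h2 : ‖Λ a (b - a - J a v)‖ ≤ l * (C₀ * ‖b - a‖ ^ 2) :=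
        ((Λ a).le_of_opNorm_le haΛ _).trans (by gcongr)
      calc ‖R (a, b) - Λ a (J a v)‖ ≤ (K + l * C₀) * ‖b - a‖ ^ 2 := by linarith
        _ ≤ (K + l * C₀) * (2 * C₀ * ‖v‖) ^ 2 := by gcongr
        _ = Q * ‖v‖ ^ 2 := by ring
        _ ≤ C * ‖v‖ ^ 2 := by gcongr; linarith
    · have h1 := ha1 (b - a) Submodule.mem_top
      have h2 : ‖Λ a (b - a)‖ ≤ ‖R (a, b)‖ + ‖R (a, b) - Λ a (b - a)‖ := by
        have := norm_sub_le (R (a, b)) (R (a, b) - Λ a (b - a))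
        simpa using this
      have h3 : K * ‖b - a‖ ^ 2 ≤ c₁ / 2 * ‖b - a‖ := by
        rw [sq, ← mul_assoc]
        gcongr
        exact (mul_le_mul_of_nonneg_left hd hK).trans hδK.le
      have h4 : ‖b - a‖ ≤ 2 / c₁ * ‖R (a, b)‖ := by
        rw [div_mul_eq_mul_div, le_div_iff₀ hc₁]
        linarith
      have h5 : ‖v‖ ≤ ‖P‖ * ‖b - a‖ := by
        rw [hv, ← map_sub]; exact P.le_opNorm _
      calc ‖v‖ ≤ ‖P‖ * (2 / c₁ * ‖R (a, b)‖) := h5.trans (by gcongr)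
        _ = (‖P‖ * (2 / c₁)) * ‖R (a, b)‖ := by ring
        _ ≤ C * ‖R (a, b)‖ := by gcongr; linarith

end LocalModel

/-! ### From layers of the relative position to anisotropic boxes -/

section Coordinates

variable {E F : Type*} [NormedAddCommGroup E] [NormedSpace ℝ E] [NormedAddCommGroup F]
  [NormedSpace ℝ F] {π₁ π₂ : E →L[ℝ] E}

/-- Here `|v| ≲ |X| ≲ r`, so `X` and `T v` differ by `O(r²)`, the size allowed in the second layer.
This gives the outer box. -/
lemma aniso_norm_le (hπ : ∀ X, ‖X‖ ≤ ‖π₁ X‖ + ‖π₂ X‖) {C C' r : ℝ} (hC : 0 < C) (hC' : 0 < C')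
    (hr : 0 < r) (hr1 : r ≤ 1) {X : E} {v : F} {T : F →L[ℝ] E} (h1 : ‖X - T v‖ ≤ C' * ‖v‖ ^ 2)
    (h2 : ‖v‖ ≤ C' * ‖X‖) (h3 : ‖π₁ X‖ ≤ C * r) (h4 : ‖π₂ X‖ ≤ C * r ^ 2) :
    ‖v‖ ≤ (2 * C * C' + C + ‖π₂‖ * C' * (2 * C * C') ^ 2) * r ∧
    ‖π₂ (T v)‖ ≤ (2 * C * C' + C + ‖π₂‖ * C' * (2 * C * C') ^ 2) * r ^ 2 := by
  have hrr : r ^ 2 ≤ r := by nlinarith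
  have hX : ‖X‖ ≤ 2 * C * r := by
    have := hπ X
    nlinarith
  have hv : ‖v‖ ≤ 2 * C * C' * r := by nlinarith
  have hq : 0 ≤ ‖π₂‖ * C' * (2 * C * C') ^ 2 := by positivity
  have hq' : 0 ≤ 2 * C * C' := by positivity
  constructor
  · refine hv.trans ?_
    gcongr
    linarith
  · have h5 : ‖π₂ (T v)‖ ≤ ‖π₂ X‖ + ‖π₂ (X - T v)‖ := by
      rw [map_sub]
      have := norm_sub_le (π₂ X) (π₂ X - π₂ (T v))
      simpa using this
    have h6 : ‖π₂ (X - T v)‖ ≤ ‖π₂‖ * (C' * (2 * C * C' * r) ^ 2) := by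
      refine (π₂.le_opNorm _).trans ?_
      gcongr
      refine h1.trans ?_
      gcongr
    have h7 : 0 ≤ 2 * C * C' * r ^ 2 := by positivity
    calc ‖π₂ (T v)‖ ≤ C * r ^ 2 + ‖π₂‖ * (C' * (2 * C * C' * r) ^ 2) := by linarith
      _ ≤ (2 * C * C' + C + ‖π₂‖ * C' * (2 * C * C') ^ 2) * r ^ 2 := by linarith

/-- Since `ε² ≤ ε`, the quadratic error is at most `C ε r²`, so every contribution carries a factor
`ε` and can be made smaller than `c`. This gives the inner box. -/
lemma norm_layers_le {C c ε r : ℝ} (hC : 0 < C) (hε0 : 0 < ε) (hε1 : ε ≤ 1)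
    (hε : ε * (1 + 2 * ‖π₁‖ * C + ‖π₂‖ * C) ≤ c)
    (hr : 0 < r) (hr1 : r ≤ 1) {X : E} {v : F} {T : F →L[ℝ] E} (hT : ‖T‖ ≤ C)
    (h1 : ‖X - T v‖ ≤ C * ‖v‖ ^ 2) (h2 : ‖v‖ ≤ ε * r) (h3 : ‖π₂ (T v)‖ ≤ ε * r ^ 2) :
    ‖π₁ X‖ ≤ c * r ∧ ‖π₂ X‖ ≤ c * r ^ 2 := by
  have hrr : r ^ 2 ≤ r := by nlinarith
  have hεε : ε ^ 2 ≤ ε := by nlinarith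
  have hπ₁ := norm_nonneg π₁
  have hπ₂ := norm_nonneg π₂
  have h4 : ‖X - T v‖ ≤ C * (ε * r ^ 2) := by
    refine h1.trans ?_
    gcongr
    calc ‖v‖ ^ 2 ≤ (ε * r) ^ 2 := by gcongr
      _ = ε ^ 2 * r ^ 2 := by ring
      _ ≤ ε * r ^ 2 := by gcongr
  have hXdec : T v + (X - T v) = X := by abel
  have hmono : ∀ t, 0 ≤ t → t * ε * (2 * ‖π₁‖ * C) ≤ t * c ∧ t * ε * (1 + ‖π₂‖ * C) ≤ t * c := by
    intro t ht
    have h5 : 0 ≤ ε * (2 * ‖π₁‖ * C) := by positivity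
    have h6 : 0 ≤ ε * (1 + ‖π₂‖ * C) := by positivity
    constructor
    · rw [mul_assoc]
      gcongr
      linarith
    · rw [mul_assoc]
      gcongr
      linarith
  constructor
  · have h5 : ‖X‖ ≤ 2 * C * (ε * r) := by
      have h6 := norm_add_le (T v) (X - T v)
      rw [hXdec] at h6
      have h7 : ‖T v‖ ≤ C * (ε * r) := (T.le_of_opNorm_le hT v).trans (by gcongr)
      have h8 : C * (ε * r ^ 2) ≤ C * (ε * r) := by gcongr
      linarith
    calc ‖π₁ X‖ ≤ ‖π₁‖ * (2 * C * (ε * r)) := (π₁.le_opNorm X).trans (by gcongr)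
      _ = r * ε * (2 * ‖π₁‖ * C) := by ring
      _ ≤ r * c := (hmono r hr.le).1
      _ = c * r := mul_comm _ _
  · have h6 := norm_add_le (π₂ (T v)) (π₂ (X - T v))
    rw [← map_add, hXdec] at h6
    have h7 : ‖π₂ (X - T v)‖ ≤ ‖π₂‖ * (C * (ε * r ^ 2)) :=
      (π₂.le_opNorm _).trans (by gcongr)
    calc ‖π₂ X‖ ≤ ε * r ^ 2 + ‖π₂‖ * (C * (ε * r ^ 2)) := by linarith
      _ = r ^ 2 * ε * (1 + ‖π₂‖ * C) := by ring
      _ ≤ r ^ 2 * c := (hmono _ (by positivity)).2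
      _ = c * r ^ 2 := mul_comm _ _

end Coordinates

section Filters

lemma eventually_forall_ball {X : Type*} [PseudoMetricSpace X] {a₀ : X} {q : X → Prop}
    (h : ∀ᶠ a in 𝓝 a₀, q a) : ∀ᶠ δ in 𝓝[>] (0 : ℝ), ∀ a ∈ Metric.ball a₀ δ, q a := by
  obtain ⟨ε, hε, hq⟩ := Metric.eventually_nhds_iff_ball.1 h
  filter_upwards [Ioo_mem_nhdsGT hε] with δ hδ a ha
  exact hq a (Metric.ball_subset_ball hδ.2.le ha)

lemma eventually_forall_ball_prod {X : Type*} [PseudoMetricSpace X] {a₀ : X} {q : X → X → Prop}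
    (h : ∀ᶠ w : X × X in 𝓝 (a₀, a₀), q w.1 w.2) :
    ∀ᶠ δ in 𝓝[>] (0 : ℝ), ∀ a ∈ Metric.ball a₀ δ, ∀ b ∈ Metric.ball a₀ δ, q a b := by
  filter_upwards [eventually_forall_ball h] with δ hδ a ha b hb
  exact hδ (a, b) (by rw [← ball_prod_same]; exact ⟨ha, hb⟩)

end Filters

end BlowUp

end

/-! ### Proof of the theorem -/

open BlowUp

theorem theorem1p1
    {E : Type*} [NormedAddCommGroup E] [NormedSpace ℝ E] [FiniteDimensional ℝ E]
    {G : Type*} [TopologicalSpace G] [ChartedSpace E G] [Group G]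
    [LieGroup 𝓘(ℝ, E) ∞ G] [ConnectedSpace G] [SimplyConnectedSpace G]
    [MeasurableSpace G] [BorelSpace G]
    (V₁ V₂ : Submodule ℝ (GroupLieAlgebra 𝓘(ℝ, E) G))
    (hV : BlowUp.IsTwoStepGrading V₁ V₂)
    {q : ℕ} (W : BlowUp.GradedBasis V₁ V₂ q)
    (ρ : G → G → ℝ) (hρ : BlowUp.IsHomogeneousDist V₁ V₂ ρ)
    (g : BlowUp.RiemMetric E G)
    (p : ℕ) (S : Set G) (hS : BlowUp.IsC11Submanifold E p S)
    (x : G) (hx : x ∈ S) :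
    ∃ U ∈ 𝓝 x, ∃ c₁ c₂ r₀ : ℝ, 0 < c₁ ∧ 0 < c₂ ∧ 0 < r₀ ∧
      ∀ z ∈ S ∩ U, BlowUp.degreeAt W S z = BlowUp.degreeAt W S x →
        ∀ r : ℝ, 0 < r → r < r₀ →
          ENNReal.ofReal (c₁ * r ^ BlowUp.degreeAt W S x)
              ≤ BlowUp.surfaceMeasure g p S (S ∩ BlowUp.openBall ρ z r) ∧
          BlowUp.surfaceMeasure g p S (S ∩ BlowUp.openBall ρ z r)
              ≤ ENNReal.ofReal (c₂ * r ^ BlowUp.degreeAt W S x) := by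
  have hgroup : IsTopologicalGroup G := topologicalGroup_of_lieGroup 𝓘(ℝ, E) ∞
  obtain ⟨k, U, f, L, hpk, hU, hxU, hUt, hf, hL, hsurj, hSU⟩ := hS x hx
  set a₀ := extChartAt 𝓘(ℝ, E) x x with ha₀
  obtain ⟨π₁, π₂, hπ⟩ := exists_layerProjections (E := E) (G := G) hV.isCompl
  obtain ⟨hnhds, ⟨C₁, hC₁, r₁, hr₁, hbox⟩, c₁, hc₁, hball⟩ := hπ.ball_box hρ
  obtain ⟨P, V₀, T₀, Γ, J, C₀, h₀, ha₀V, hV₀U, hJ⟩ :=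
    exists_isLocalGraph hpk hU hxU hf hL (hsurj _ hxU)
  obtain ⟨Cg, hCg, hg⟩ := exists_metric_comparison g x
  have hxs : x ∈ (extChartAt 𝓘(ℝ, E) x).source := mem_extChartAt_source x
  have hd₀ : DifferentiableAt ℝ (relCoord (E := E) x) (a₀, a₀) :=
    (contDiffAt_relCoord (E := E) x).differentiableAt (by simp)
  obtain ⟨C₂, hC₂, hmodel⟩ := exists_local_model h₀ ha₀V hJ (contDiffAt_relCoord (E := E) x)
    (relCoord_self x) (Λ := relDeriv x) (fun _ => rfl) (relDeriv_bijective hxs hd₀).1 π₂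
  have hsymm : ContinuousAt (extChartAt 𝓘(ℝ, E) x).symm a₀ := continuousAt_extChartAt_symm x
  have hsymm₀ : (extChartAt 𝓘(ℝ, E) x).symm a₀ = x := extChartAt_to_inv x
  have hst : Tendsto (extChartAt 𝓘(ℝ, E) x).symm (𝓝 a₀) (𝓝 x) := by
    have := hsymm.tendsto
    rwa [hsymm₀] at this
  have hg' : ∀ᶠ a in 𝓝 a₀, ∀ v : TangentSpace 𝓘(ℝ, E) ((extChartAt 𝓘(ℝ, E) x).symm a),
      ‖chartDeriv E x ((extChartAt 𝓘(ℝ, E) x).symm a) v‖ ^ 2 ≤ Cg ^ 2 * g.inner _ v v ∧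
      g.inner _ v v ≤ Cg ^ 2 * ‖chartDeriv E x ((extChartAt 𝓘(ℝ, E) x).symm a) v‖ ^ 2 :=
    hst.eventually hg
  have hball' : ∀ᶠ w : E × E in 𝓝 (a₀, a₀), ∀ r : ℝ, 0 < r → r ≤ 1 →
      ‖π₁ (relCoord x w)‖ ≤ c₁ * r → ‖π₂ (relCoord x w)‖ ≤ c₁ * r ^ 2 →
      ρ 1 (((extChartAt 𝓘(ℝ, E) x).symm w.1)⁻¹ * (extChartAt 𝓘(ℝ, E) x).symm w.2) < r := by
    have ht : Tendsto (fun w : E × E => ((extChartAt 𝓘(ℝ, E) x).symm w.1)⁻¹ *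
        (extChartAt 𝓘(ℝ, E) x).symm w.2) (𝓝 (a₀, a₀)) (𝓝 1) := by
      have h1 : Tendsto (fun w : E × E => (extChartAt 𝓘(ℝ, E) x).symm w.1) (𝓝 (a₀, a₀)) (𝓝 x) :=
        hst.comp (continuous_fst.tendsto (a₀, a₀))
      have h2 : Tendsto (fun w : E × E => (extChartAt 𝓘(ℝ, E) x).symm w.2) (𝓝 (a₀, a₀)) (𝓝 x) :=
        hst.comp (continuous_snd.tendsto (a₀, a₀))
      simpa using h1.inv.mul h2
    exact ht.eventually hball
  obtain ⟨δ, ⟨hδV, hδ⟩, hδg, hδρ, hδ0⟩ := (hmodel.and ((eventually_forall_ball hg').and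
    ((eventually_forall_ball_prod (q := fun a b => ∀ r : ℝ, 0 < r → r ≤ 1 →
      ‖π₁ (relCoord x (a, b))‖ ≤ c₁ * r → ‖π₂ (relCoord x (a, b))‖ ≤ c₁ * r ^ 2 →
      ρ 1 (((extChartAt 𝓘(ℝ, E) x).symm a)⁻¹ * (extChartAt 𝓘(ℝ, E) x).symm b) < r) hball').and
      self_mem_nhdsWithin))).exists
  set V := Metric.ball a₀ δ with hVdef
  have h := h₀.mono Metric.isOpen_ball hδV
  set T := T₀ ∩ Γ ⁻¹' V with hT
  have ha₀V' : a₀ ∈ V := Metric.mem_ball_self hδ0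
  have hVt : V ⊆ (extChartAt 𝓘(ℝ, E) x).target := hδV.trans (hV₀U.trans hUt)
  have hSV : ∀ a ∈ V, ((extChartAt 𝓘(ℝ, E) x).symm a ∈ S ↔ f a = 0) :=
    fun a ha => hSU a (hV₀U (hδV ha))
  let O : Set G := (extChartAt 𝓘(ℝ, E) x).source ∩ extChartAt 𝓘(ℝ, E) x ⁻¹' V
  have hO : IsOpen O := isOpen_extChartAt_preimage' x Metric.isOpen_ball
  have hxO : x ∈ O := ⟨hxs, ha₀V'⟩
  have hzero : ∀ z ∈ S ∩ O, f (extChartAt 𝓘(ℝ, E) x z) = 0 := by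
    rintro z ⟨hzS, hzs, hzV⟩
    refine (hSV _ hzV).1 ?_
    rwa [(extChartAt 𝓘(ℝ, E) x).left_inv hzs]
  set A : E → EuclideanSpace ℝ (Fin p) →L[ℝ] E := fun a => π₂ ∘L relDeriv x a ∘L J a with hA
  have hdeg : ∀ z ∈ S ∩ O, degreeAt W S z =
      p + Module.finrank ℝ (LinearMap.range (A (extChartAt 𝓘(ℝ, E) x z)).toLinearMap) :=
    fun z hz => degreeAt_eq hV.isCompl W hπ h hVt hSV hz.2.1 hz.2.2 hz.1 (hδ _ hz.2.2).1
  have hrel : ∀ z ∈ O, ∀ y ∈ O, relCoord x (extChartAt 𝓘(ℝ, E) x z, extChartAt 𝓘(ℝ, E) x y) =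
      oddChart (E := E) (z⁻¹ * y) := by
    intro z hz y hy
    rw [relCoord, (extChartAt 𝓘(ℝ, E) x).left_inv hz.1, (extChartAt 𝓘(ℝ, E) x).left_inv hy.1]
  have hρ1 : ∀ z y, ρ 1 (z⁻¹ * y) = ρ z y := fun z y => by
    rw [← hρ.mul_left z, mul_one, mul_inv_cancel_left]
  have hmul : Tendsto (fun w : G × G => w.1 * w.2) (𝓝 x ×ˢ 𝓝 1) (𝓝 x) := by
    have hc : Continuous fun w : G × G => w.1 * w.2 := continuous_mul
    rw [← nhds_prod_eq]
    simpa using hc.tendsto (x, 1)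
  -- Balls of radius below `η` centred in `U₁` stay in `O`: from `z ∈ U₁` and `z⁻¹ y ∈ N₁` follows
  -- `y ∈ O`.
  obtain ⟨U₁, hU₁, N₁, hN₁, hUN⟩ := Filter.mem_prod_iff.1 (hmul (hO.mem_nhds hxO))
  obtain ⟨η, hη, hηN⟩ := hnhds N₁ hN₁
  have hPa₀ : P a₀ ∈ T := h.mem_target a₀ ha₀V' (hzero x ⟨hx, hxO⟩)
  obtain ⟨δ', hδ', hδT⟩ := Metric.isOpen_iff.1 h.isOpen_target _ hPa₀
  have hPc : ContinuousAt (fun z : G => P (extChartAt 𝓘(ℝ, E) x z)) x :=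
    ContinuousAt.comp (g := P) P.continuous.continuousAt (continuousAt_extChartAt x)
  have hPU : ∀ᶠ z in 𝓝 x, P (extChartAt 𝓘(ℝ, E) x z) ∈ Metric.ball (P a₀) (δ' / 2) :=
    hPc.eventually_mem (Metric.ball_mem_nhds _ (half_pos hδ'))
  obtain ⟨D, hD, hupper⟩ := exists_surfaceMeasure_le g S h hVt hSV fun a ha v => (hδg a ha v).2
  set Q : ℝ := ((‖P‖ + 1) * Cg) with hQ
  have hQ0 : 0 < Q := by positivity
  have hPg : ∀ y ∈ O, ∀ v : TangentSpace 𝓘(ℝ, E) y,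
      ‖P (chartDeriv E x y v)‖ ^ 2 ≤ Q ^ 2 * g.inner y v v := by
    intro y hy v
    have h1 := hδg _ hy.2
    rw [(extChartAt 𝓘(ℝ, E) x).left_inv hy.1] at h1
    have h2 : ‖P (chartDeriv E x y v)‖ ≤ (‖P‖ + 1) * ‖chartDeriv E x y v‖ :=
      P.le_of_opNorm_le (by linarith) _
    calc ‖P (chartDeriv E x y v)‖ ^ 2 ≤ ((‖P‖ + 1) * ‖chartDeriv E x y v‖) ^ 2 := by gcongr
      _ = (‖P‖ + 1) ^ 2 * ‖chartDeriv E x y v‖ ^ 2 := mul_pow _ _ _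
      _ ≤ (‖P‖ + 1) ^ 2 * (Cg ^ 2 * g.inner y v v) := by gcongr; exact (h1 v).1
      _ = Q ^ 2 * g.inner y v v := by rw [hQ]; ring
  set s : ℝ := 1 + 2 * ‖π₁‖ * C₂ + ‖π₂‖ * C₂ with hs
  have hs0 : 0 < s := by positivity
  -- The bounds serve to keep the box around `P a` inside `T`, to have `ε² ≤ ε`, and to apply
  -- `norm_layers_le`.
  set ε : ℝ := min (δ' / 2) (min 1 (c₁ / s)) / 2 with hεdef
  have hε0 : 0 < ε := by positivity
  have hε2 : ε < min (δ' / 2) (min 1 (c₁ / s)) := half_lt_self (by positivity)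
  have hεδ : ε < δ' / 2 := hε2.trans_le (min_le_left _ _)
  have hε1 : ε ≤ 1 := (hε2.trans_le ((min_le_right _ _).trans (min_le_left _ _))).le
  have hεs : ε * s ≤ c₁ := by
    rw [← le_div_iff₀ hs0]
    exact (hε2.trans_le ((min_le_right _ _).trans (min_le_right _ _))).le
  -- Both `2 b` and `‖π₂‖ C₂ b` are at most `ε`, as `le_volume_aniso` requires.
  set b : ℝ := ε / (2 + ‖π₂‖ * C₂) with hb
  have hb0 : 0 < b := by positivity
  have hbmul : (2 + ‖π₂‖ * C₂) * b = ε := by rw [hb]; field_simp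
  have hπC : 0 ≤ ‖π₂‖ * C₂ * b := by positivity
  set R : ℝ := 2 * C₁ * C₂ + C₁ + ‖π₂‖ * C₂ * (2 * C₁ * C₂) ^ 2 with hR
  set v₁ : ℝ≥0∞ := volume (Metric.closedBall (0 : EuclideanSpace ℝ (Fin p)) b) with hv₁
  set v₂ : ℝ≥0∞ := volume (Metric.closedBall (0 : EuclideanSpace ℝ (Fin p)) (R + R / C₂⁻¹))
    with hv₂
  have hv₁0 : 0 < v₁.toReal := ENNReal.toReal_pos (Metric.measure_closedBall_pos _ _ hb0).ne'
    measure_closedBall_lt_top.ne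
  have hv₁t : v₁ ≠ ⊤ := measure_closedBall_lt_top.ne
  have hv₂t : v₂ ≠ ⊤ := measure_closedBall_lt_top.ne
  refine ⟨U₁ ∩ O ∩ {z | P (extChartAt 𝓘(ℝ, E) x z) ∈ Metric.ball (P a₀) (δ' / 2)},
    inter_mem (inter_mem hU₁ (hO.mem_nhds hxO)) hPU, v₁.toReal / Q ^ p, D * v₂.toReal + 1,
    min 1 (min r₁ η), by positivity, by positivity, by positivity, ?_⟩
  rintro z ⟨hzS, ⟨hzU, hzO⟩, hzP⟩ hzdeg r hr hrr
  have hr1 : r ≤ 1 := (hrr.trans_le (min_le_left _ _)).le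
  have hrr₁ : r < r₁ := hrr.trans_le ((min_le_right _ _).trans (min_le_left _ _))
  have hrη : r < η := hrr.trans_le ((min_le_right _ _).trans (min_le_right _ _))
  set a := extChartAt 𝓘(ℝ, E) x z with ha
  have haV : a ∈ V := hzO.2
  have hfa : f a = 0 := hzero z ⟨hzS, hzO⟩
  obtain ⟨-, hTa, hAa, hab⟩ := hδ a haV
  have hdz := hdeg z ⟨hzS, hzO⟩
  -- Equal degrees mean equal ranks, the condition under which the lower bound `hAa` holds with a
  -- constant independent of `z`.
  have hrank : Module.finrank ℝ (LinearMap.range (A a).toLinearMap) =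
      Module.finrank ℝ (LinearMap.range (A a₀).toLinearMap) := by
    have hdx := hdeg x ⟨hx, hxO⟩
    rw [hdx, hdz] at hzdeg
    exact Nat.add_left_cancel hzdeg
  rw [← hzdeg, hdz]
  set d := p + Module.finrank ℝ (LinearMap.range (A a).toLinearMap) with hd
  have hAn : ‖A a‖ ≤ ‖π₂‖ * C₂ :=
    (ContinuousLinearMap.opNorm_comp_le _ _).trans (by gcongr)
  have htrans : ∀ Y : Set (EuclideanSpace ℝ (Fin p)),
      volume ((fun ξ => -P a + ξ) ⁻¹' Y) = volume Y := fun Y => measure_preimage_add volume _ Y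
  constructor
  -- Lower bound: the inner box translated to `P a` lies in the projection of the ball.
  · have hsub : (fun ξ => -P a + ξ) ⁻¹' {v | ‖v‖ ≤ ε * r ∧ ‖A a v‖ ≤ ε * r ^ 2} ⊆
        (fun y => P (extChartAt 𝓘(ℝ, E) x y)) '' (S ∩ openBall ρ z r ∩ (O ∩ S)) := by
      intro ξ hξ
      obtain ⟨hξ1, hξ2⟩ : ‖ξ - P a‖ ≤ ε * r ∧ ‖A a (ξ - P a)‖ ≤ ε * r ^ 2 := by
        rw [← neg_add_eq_sub]; exact hξ
      have hξT : ξ ∈ T := by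
        refine hδT ?_
        have hzP' : dist (P a) (P a₀) < δ' / 2 := hzP
        rw [Metric.mem_ball]
        have h1 := dist_triangle ξ (P a) (P a₀)
        rw [dist_eq_norm ξ (P a)] at h1
        have h2 : ε * r ≤ ε := mul_le_of_le_one_right hε0.le hr1
        linarith
      have hbV : Γ ξ ∈ V := h.mem_source ξ hξT
      have hfb : f (Γ ξ) = 0 := h.zero ξ hξT
      have hPb : P (Γ ξ) = ξ := h.proj_graph ξ hξT
      obtain ⟨h1, -⟩ := hab hfa (Γ ξ) hbV hfb
      rw [hPb] at h1
      obtain ⟨h2, h3⟩ := norm_layers_le (π₁ := π₁) (T := relDeriv x a ∘L J a) hC₂ hε0 hε1 hεs hr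
        hr1 hTa h1 hξ1 hξ2
      have h4 := hδρ a haV (Γ ξ) hbV r hr hr1 h2 h3
      rw [(extChartAt 𝓘(ℝ, E) x).left_inv hzO.1, hρ1] at h4
      have hyS : (extChartAt 𝓘(ℝ, E) x).symm (Γ ξ) ∈ S := (hSV _ hbV).2 hfb
      have hκ : extChartAt 𝓘(ℝ, E) x ((extChartAt 𝓘(ℝ, E) x).symm (Γ ξ)) = Γ ξ :=
        (extChartAt 𝓘(ℝ, E) x).right_inv (hVt hbV)
      refine ⟨(extChartAt 𝓘(ℝ, E) x).symm (Γ ξ), ⟨⟨hyS, h4⟩,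
        ⟨(extChartAt 𝓘(ℝ, E) x).map_target (hVt hbV), ?_⟩, hyS⟩, ?_⟩
      · rw [mem_preimage, hκ]; exact hbV
      · simp only [hκ, hPb]
    have hmain : ENNReal.ofReal (r ^ d) * v₁ ≤
        ENNReal.ofReal (Q ^ p) * surfaceMeasure g p S (S ∩ openBall ρ z r) :=
      calc ENNReal.ofReal (r ^ d) * v₁ ≤ volume {v | ‖v‖ ≤ ε * r ∧ ‖A a v‖ ≤ ε * r ^ 2} :=
            le_volume_aniso (A a) hAn (by linarith) (by linarith) hr hr1
        _ = _ := (htrans _).symm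
        _ ≤ _ := measure_mono hsub
        _ ≤ _ := volume_image_le_surfaceMeasure g p S hO inter_subset_left P hQ0 hPg _
    rw [div_mul_eq_mul_div, ENNReal.ofReal_div_of_pos (by positivity), mul_comm v₁.toReal,
      ENNReal.ofReal_mul (by positivity), ENNReal.ofReal_toReal hv₁t]
    exact ENNReal.div_le_of_le_mul' hmain
  · have hballO : ∀ y ∈ openBall ρ z r, y ∈ O := by
      intro y hy
      have h1 : z⁻¹ * y ∈ N₁ := hηN _ (by rw [hρ1]; exact lt_trans hy hrη)
      have h2 : (z, z⁻¹ * y) ∈ U₁ ×ˢ N₁ := ⟨hzU, h1⟩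
      simpa using hUN h2
    let Y : Set (EuclideanSpace ℝ (Fin p)) := {v | ‖v‖ ≤ R * r ∧ ‖A a v‖ ≤ R * r ^ 2}
    have hYc : IsClosed Y :=
      IsClosed.inter (isClosed_le continuous_norm continuous_const)
        (isClosed_le (A a).continuous.norm continuous_const)
    have hK : MeasurableSet (T ∩ (fun ξ => -P a + ξ) ⁻¹' Y) :=
      h.isOpen_target.measurableSet.inter (hYc.preimage (by fun_prop)).measurableSet
    have hBm : MeasurableSet (openBall ρ z r) := by
      have hc : Continuous fun y => ρ z y :=
        hρ.continuous.comp (f := fun y => (z, y)) (by fun_prop)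
      exact (isOpen_lt hc continuous_const).measurableSet
    have hcov : openBall ρ z r ∩ S ⊆ (fun ξ => (extChartAt 𝓘(ℝ, E) x).symm (Γ ξ)) ''
        (T ∩ (fun ξ => -P a + ξ) ⁻¹' Y) := by
      rintro y ⟨hyB, hyS⟩
      have hyO := hballO y hyB
      have hfb := hzero y ⟨hyS, hyO⟩
      have hrely := hrel z hzO y hyO
      obtain ⟨h1, h2⟩ := hab hfa _ hyO.2 hfb
      obtain ⟨h3, h4⟩ := hbox (z⁻¹ * y) r hrr₁ (by rw [hρ1]; exact hyB)
      rw [← hrely] at h3 h4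
      obtain ⟨h5, h6⟩ := aniso_norm_le hπ.norm_le (T := relDeriv x a ∘L J a) hC₁ hC₂ hr hr1
        h1 h2 h3 h4
      refine ⟨P (extChartAt 𝓘(ℝ, E) x y), ⟨h.mem_target _ hyO.2 hfb, ?_⟩, ?_⟩
      · rw [mem_preimage, neg_add_eq_sub]
        exact ⟨h5, h6⟩
      · simp only [h.graph_proj _ hyO.2 hfb]
        exact (extChartAt 𝓘(ℝ, E) x).left_inv hyO.1
    -- The patch bound asks for a Borel set, and the ball is open; dropping `S` costs nothing,
    -- because only the part of the ball in `S` has to be covered.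
    calc surfaceMeasure g p S (S ∩ openBall ρ z r) ≤ surfaceMeasure g p S (openBall ρ z r) :=
          measure_mono inter_subset_right
      _ ≤ ENNReal.ofReal D * volume (T ∩ (fun ξ => -P a + ξ) ⁻¹' Y) :=
          hupper _ hBm _ inter_subset_left hK hcov
      _ ≤ ENNReal.ofReal D * volume Y := by
          gcongr ENNReal.ofReal D * ?_
          exact (measure_mono inter_subset_right).trans (htrans Y).le
      _ ≤ ENNReal.ofReal D * (ENNReal.ofReal (r ^ d) * v₂) := by
          gcongr
          exact volume_aniso_le (A a) (inv_pos.2 hC₂) hr (hAa hrank)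
      _ = ENNReal.ofReal (D * v₂.toReal * r ^ d) := by
          rw [ENNReal.ofReal_mul (by positivity), ENNReal.ofReal_mul hD.le,
            ENNReal.ofReal_toReal hv₂t]
          ring
      _ ≤ ENNReal.ofReal ((D * v₂.toReal + 1) * r ^ d) := by
          gcongr
          linarith
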